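/- Let $n\in\mathbb N$, $m\in\mathbb R$ and $0\le\delta<\rho\le 1$. For $m'\in\mathbb R$ let $BS^{m'}_{\rho,\delta}=BS^{m'}_{\rho,\delta}(\mathbb R^n)$ be the set of all $\sigma\in C^\infty(\mathbb R^n\times\mathbb R^n\times\mathbb R^n;\mathbb C)$ such that for all multi-indices $\alpha,\beta,\gamma$ there is a constant $C_{\alpha\beta\gamma}>0$ with $$|\partial_x^\alpha\partial_\xi^\beta\partial_\eta^\gamma\sigma(x,\xi,\eta)|\le C_{\alpha\beta\gamma}(1+|\xi|+|\eta|)^{m'+\delta|\alpha|-\rho(|\beta|+|\gamma|)}\qquad\text{for all }x,\xi,\eta\in\mathbb R^n.$$ For such $\sigma$ and Schwartz functions $f,g$ on $\mathbb R^n$ let $$T_\sigma(f,g)(x)=\int_{\mathbb R^n}\int_{\mathbb R^n}\sigma(x,\xi,\eta)\,\widehat f(\xi)\,\widehat g(\eta)\,e^{ix\cdot(\xi+\eta)}\,d\xi\,d\eta,\qquad \widehat f(\xi)=(2\pi)^{-n}\int_{\mathbb R^n}f(x)e^{-ix\cdot\xi}\,dx .$$ Write $\langle u,v\rangle=\int_{\mathbb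 R^n}u(x)v(x)\,dx$, and write $\sigma\sim\sum_{j\ge0}\sigma_j$ if there is a non-increasing sequence $m_N\to-\infty$ with $\sigma-\sum_{j<N}\sigma_j\in BS^{m_N}_{\rho,\delta}$ for all $N>0$; a series over multi-indices $\alpha$ is read as the series over $j$ of its partial sums over $|\alpha|=j$. Let $\sigma\in BS^m_{\rho,\delta}$. Then there are $\sigma^{*1},\sigma^{*2}\in BS^m_{\rho,\delta}$, each unique in $\bigcup_{m'\in\mathbb R}BS^{m'}_{\rho,\delta}$, such that for all Schwartz functions $f,g,h$ $$\langle T_\sigma(f,g),h\rangle=\langle T_{\sigma^{*1}}(h,g),f\rangle=\langle T_{\sigma^{*2}}(f,h),g\rangle ,$$ and they have the asymptotic expansions $$\sigma^{*1}\sim\sum_\alpha\frac{(-i)^{|\alpha|}}{\alpha!}\,\partial_x^\alpha\partial_\xi^\alpha\bigl(\sigma(x,-\xi-\eta,\eta)\bigr),\qquad \sigma^{*2}\sim\sum_\alpha\frac{(-i)^{|\alpha|}}{\alpha!}\,\partial_x^\alpha\partial_\eta^\alpha\bigl(\sigma(x,\xi,-\xi-\eta)\bigr).$$ More precisely, for every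 $N\in\mathbb N$ (including $N=0$), $$\sigma^{*1}-\sum_{|\alpha|<N}\frac{(-i)^{|\alpha|}}{\alpha!}\,\partial_x^\alpha\partial_\xi^\alpha\bigl(\sigma(x,-\xi-\eta,\eta)\bigr)\in BS^{m+(\delta-\rho)N}_{\rho,\delta}$$ and $$\sigma^{*2}-\sum_{|\alpha|<N}\frac{(-i)^{|\alpha|}}{\alpha!}\,\partial_x^\alpha\partial_\eta^\alpha\bigl(\sigma(x,\xi,-\xi-\eta)\bigr)\in BS^{m+(\delta-\rho)N}_{\rho,\delta}.$$ -/

import Mathlib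

open Filter Topology MeasureTheory
open scoped ContDiff

noncomputable section

namespace BilinearHormander

/-- The space `ℝⁿ` with its Euclidean norm. -/
abbrev E (n : ℕ) : Type := EuclideanSpace ℝ (Fin n)

/-- The space `ℝⁿ × ℝⁿ × ℝⁿ` of the variables `(x, ξ, η)`. -/
abbrev Phase (n : ℕ) : Type := E n × E n × E n

/-- A (not yet restricted) bilinear symbol: a complex function of `(x, ξ, η)`. -/
abbrev Symb (n : ℕ) : Type := Phase n → ℂ

/-- A multi-index in `n` variables. -/
abbrev MultiIndex (n : ℕ) : Type := Fin n → ℕ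

namespace MultiIndex

/-- The length `|α| = α₁ + ⋯ + αₙ`. -/
def length {n : ℕ} (α : MultiIndex n) : ℕ := ∑ i, α i

/-- The factorial `α! = α₁! ⋯ αₙ!`. -/
def fact {n : ℕ} (α : MultiIndex n) : ℕ := ∏ i, Nat.factorial (α i)

/-- The finite set of the multi-indices of length `j`. -/
def ofLength (n j : ℕ) : Finset (MultiIndex n) := Finset.piAntidiag Finset.univ j

theorem mem_ofLength {n j : ℕ} {α : MultiIndex n} : α ∈ ofLength n j ↔ α.length = j := by
  simp [ofLength, length]

end MultiIndex

/-- The derivative of `F` in the direction `v`. -/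
def dirDeriv {n : ℕ} (v : Phase n) (F : Symb n) : Symb n := fun p => fderiv ℝ F p v

/-- `∂_{v₁}^{α₁} ⋯ ∂_{vₙ}^{αₙ} F` for directions `v₁, …, vₙ`. -/
def multiDeriv {n : ℕ} (v : Fin n → Phase n) (α : MultiIndex n) (F : Symb n) : Symb n :=
  (List.finRange n).foldr (fun i G => (dirDeriv (v i))^[α i] G) F

/-- The coordinate directions of the variable `x`. -/
def dirX {n : ℕ} (i : Fin n) : Phase n := (EuclideanSpace.single i 1, 0, 0)

/-- The coordinate directions of the variable `ξ`. -/
def dirXi {n : ℕ} (i : Fin n) : Phase n := (0, EuclideanSpace.single i 1, 0)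

/-- The coordinate directions of the variable `η`. -/
def dirEta {n : ℕ} (i : Fin n) : Phase n := (0, 0, EuclideanSpace.single i 1)

/-- The partial derivative `∂_x^α ∂_ξ^β ∂_η^γ F`. -/
def partialD {n : ℕ} (α β γ : MultiIndex n) (F : Symb n) : Symb n :=
  multiDeriv dirX α (multiDeriv dirXi β (multiDeriv dirEta γ F))

/-- The bilinear Hörmander class `BS^m_{ρ,δ}(ℝⁿ)`. -/
def BS (n : ℕ) (m ρ δ : ℝ) : Set (Symb n) :=
  {σ | ContDiff ℝ ∞ σ ∧ ∀ α β γ : MultiIndex n, ∃ C : ℝ, 0 < C ∧ ∀ x ξ η : E n,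
    ‖partialD α β γ σ (x, ξ, η)‖ ≤
      C * (1 + ‖ξ‖ + ‖η‖) ^
        (m + δ * (α.length : ℝ) - ρ * ((β.length : ℝ) + (γ.length : ℝ)))}

/-- `σ ∼ ∑ⱼ sⱼ` in the classes `BS_{ρ,δ}`: there is a non-increasing sequence `μ_N → -∞` such
that `σ - ∑_{j < N} sⱼ` lies in `BS^{μ_N}_{ρ,δ}` for all `N > 0`. -/
def IsAsymptoticTo {n : ℕ} (ρ δ : ℝ) (σ : Symb n) (s : ℕ → Symb n) : Prop :=
  ∃ μ : ℕ → ℝ, Antitone μ ∧ Tendsto μ atTop atBot ∧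
    ∀ N : ℕ, 0 < N → (σ - ∑ j ∈ Finset.range N, s j) ∈ BS n (μ N) ρ δ

/-- The Fourier transform `f̂(ξ) = (2π)⁻ⁿ ∫ f(x) e^{-i x·ξ} dx`. -/
def fourierHat {n : ℕ} (f : SchwartzMap (E n) ℂ) (ξ : E n) : ℂ :=
  (((2 * Real.pi) ^ n : ℝ) : ℂ)⁻¹ *
    ∫ x : E n, f x * Complex.exp (-Complex.I * ((inner ℝ x ξ : ℝ) : ℂ))

/-- The bilinear pseudodifferential operator
`T_σ(f, g)(x) = ∫ ∫ σ(x, ξ, η) f̂(ξ) ĝ(η) e^{i x·(ξ + η)} dξ dη` on Schwartz functions. -/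
def opT {n : ℕ} (σ : Symb n) (f g : SchwartzMap (E n) ℂ) (x : E n) : ℂ :=
  ∫ ξ : E n, ∫ η : E n,
    σ (x, ξ, η) * fourierHat f ξ * fourierHat g η *
      Complex.exp (Complex.I * ((inner ℝ x (ξ + η) : ℝ) : ℂ))

/-- `S` is the first transpose `T^{*1}`: `⟨T(f, g), h⟩ = ⟨S(h, g), f⟩` for all test functions. -/
def IsTransposeOne {n : ℕ}
    (T S : SchwartzMap (E n) ℂ → SchwartzMap (E n) ℂ → E n → ℂ) : Prop :=
  ∀ f g h : SchwartzMap (E n) ℂ, ∫ x : E n, T f g x * h x = ∫ x : E n, S h g x * f x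

/-- `S` is the second transpose `T^{*2}`: `⟨T(f, g), h⟩ = ⟨S(f, h), g⟩` for all test functions. -/
def IsTransposeTwo {n : ℕ}
    (T S : SchwartzMap (E n) ℂ → SchwartzMap (E n) ℂ → E n → ℂ) : Prop :=
  ∀ f g h : SchwartzMap (E n) ℂ, ∫ x : E n, T f g x * h x = ∫ x : E n, S f h x * g x

/-- The function `(x, ξ, η) ↦ σ(x, -ξ-η, η)`. -/
def reflectOne {n : ℕ} (σ : Symb n) : Symb n := fun p => σ (p.1, -p.2.1 - p.2.2, p.2.2)

/-- The function `(x, ξ, η) ↦ σ(x, ξ, -ξ-η)`. -/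
def reflectTwo {n : ℕ} (σ : Symb n) : Symb n := fun p => σ (p.1, p.2.1, -p.2.1 - p.2.2)

/-- The sum over `|α| = j` of the terms `((-i)^{|α|} / α!) ∂_x^α ∂_ξ^α (σ(x, -ξ-η, η))`. -/
def termOne {n : ℕ} (σ : Symb n) (j : ℕ) : Symb n :=
  ∑ α ∈ MultiIndex.ofLength n j,
    ((-Complex.I) ^ α.length / (α.fact : ℂ)) • partialD α α 0 (reflectOne σ)

/-- The sum over `|α| = j` of the terms `((-i)^{|α|} / α!) ∂_x^α ∂_η^α (σ(x, ξ, -ξ-η))`. -/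
def termTwo {n : ℕ} (σ : Symb n) (j : ℕ) : Symb n :=
  ∑ α ∈ MultiIndex.ofLength n j,
    ((-Complex.I) ^ α.length / (α.fact : ℂ)) • partialD α 0 α (reflectTwo σ)

end BilinearHormander

end

/-! By Fubini, ⟨T_σ(f,g),h⟩ is the absolutely convergent integral of σ against `opKernel f g h`. Put
τ(x,ξ,η) = σ(x,-ξ-η,η). Fourier inversion exchanges the roles of f and h and shows that the first
transpose has the symbol exp(-i ∂_x·∂_ξ) τ, that is, (2π)⁻ⁿ ∫∫ e^{-i z·θ} τ(x+z, ξ+θ, η) dz dθ, in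
which η is a mere parameter. For compactly supported τ this is `integral_reflectOne_mul_opKernel`.

The analysis rests on one estimate, `exists_norm_oscOp_le`: with λ = 1+|ξ|+|η|, the operators
exp(-it ∂_x·∂_ξ), 0 ≤ t ≤ 1, take bounded families of BS^m to functions O(λ^m), uniformly in t. The
substitution z → λ^{-δ} z, θ → λ^δ θ turns λ^{-m} τ into amplitudes with bounds independent of t and
of the base point (`symbolClass_scaledAmp`). They grow polynomially in θ, and a z-derivative costs
only (1+|θ|)^δ. Since δ < 1, integrating by parts with (1+|θ|²)⁻¹(1-Δ_z) beats any such growth,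
while (1+|z|²)⁻¹(1-Δ_θ) supplies the decay in z (`exists_fullReg_bound`).

The expansion is Taylor's formula in t at t = 0: the remainder after N terms is controlled by
exp(-it ∂_x·∂_ξ) applied to (-i ∂_x·∂_ξ)^N τ, a symbol of order m+(δ-ρ)N. The operator commutes with
derivatives, so the pointwise bound becomes a symbol estimate (`bsFamily_symbolLim_sub`). The
multinomial identity `sum_partialD_eq_mixedPow` gives the terms their multi-index form. General
symbols are limits of cut-off ones; the cutoffs are bounded in BS^0 because ρ ≤ 1, and the
regularized integrals converge by domination.

Uniqueness holds because the Fourier transform is onto the Schwartz space: the pairings determine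
the integrals of the symbol, times a unimodular factor, against all tensor products. The second
transpose is the first one conjugated by the exchange of ξ and η. -/

noncomputable section

namespace BilinearHormander

/-! ### Iterated directional derivatives and weighted symbol classes -/

section SymbolClass

variable {V D ι : Type*} [NormedAddCommGroup V] [NormedSpace ℝ V]

/-- The derivative of `F : V → ℂ` in the direction `v`. -/
def derivAlong (v : V) (F : V → ℂ) : V → ℂ := fun p => fderiv ℝ F p v

/-- The iterated derivative along the directions `e d`, for `d` in a list. -/
def iterDeriv (e : D → V) : List D → (V → ℂ) → V → ℂ
  | [], F => F
  | d :: l, F => iterDeriv e l (derivAlong (e d) F)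

@[simp] theorem iterDeriv_nil (e : D → V) (F : V → ℂ) : iterDeriv e [] F = F := rfl

theorem iterDeriv_cons (e : D → V) (d : D) (l : List D) (F : V → ℂ) :
    iterDeriv e (d :: l) F = iterDeriv e l (derivAlong (e d) F) := rfl

theorem contDiff_derivAlong {F : V → ℂ} (hF : ContDiff ℝ ∞ F) (v : V) :
    ContDiff ℝ ∞ (derivAlong v F) :=
  (hF.fderiv_right (m := ∞) (by simp)).clm_apply contDiff_const

theorem contDiff_iterDeriv {F : V → ℂ} (hF : ContDiff ℝ ∞ F) (e : D → V) (l : List D) :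
    ContDiff ℝ ∞ (iterDeriv e l F) := by
  induction l generalizing F with
  | nil => exact hF
  | cons d l ih => exact ih (contDiff_derivAlong hF _)

theorem contDiff_pi_mul {F G : V → ℂ} (hF : ContDiff ℝ ∞ F) (hG : ContDiff ℝ ∞ G) :
    ContDiff ℝ ∞ (F * G) := hF.mul hG

theorem differentiable_of_smooth {F : V → ℂ} (hF : ContDiff ℝ ∞ F) : Differentiable ℝ F :=
  hF.differentiable (by simp)

theorem derivAlong_add {F G : V → ℂ} (hF : ContDiff ℝ ∞ F) (hG : ContDiff ℝ ∞ G) (v : V) :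
    derivAlong v (F + G) = derivAlong v F + derivAlong v G := by
  ext p
  simp [derivAlong, fderiv_add (differentiable_of_smooth hF p) (differentiable_of_smooth hG p)]

theorem derivAlong_smul {F : V → ℂ} (hF : ContDiff ℝ ∞ F) (a : ℂ) (v : V) :
    derivAlong v (a • F) = a • derivAlong v F := by
  ext p
  simp [derivAlong, fderiv_const_smul (differentiable_of_smooth hF p) a]

theorem derivAlong_mul {F G : V → ℂ} (hF : ContDiff ℝ ∞ F) (hG : ContDiff ℝ ∞ G) (v : V) :
    derivAlong v (F * G) = derivAlong v F * G + F * derivAlong v G := by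
  ext p
  simp [derivAlong, fderiv_mul (differentiable_of_smooth hF p) (differentiable_of_smooth hG p)]
  ring

theorem derivAlong_sum {κ : Type*} (s : Finset κ) {F : κ → V → ℂ}
    (hF : ∀ k ∈ s, ContDiff ℝ ∞ (F k)) (v : V) :
    derivAlong v (∑ k ∈ s, F k) = ∑ k ∈ s, derivAlong v (F k) := by
  ext p
  simp only [derivAlong, Finset.sum_apply]
  rw [fderiv_sum fun k hk => differentiable_of_smooth (hF k hk) p]
  simp

theorem iterDeriv_add {F G : V → ℂ} (hF : ContDiff ℝ ∞ F) (hG : ContDiff ℝ ∞ G)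
    (e : D → V) (l : List D) :
    iterDeriv e l (F + G) = iterDeriv e l F + iterDeriv e l G := by
  induction l generalizing F G with
  | nil => rfl
  | cons d l ih =>
    rw [iterDeriv_cons, derivAlong_add hF hG, ih (contDiff_derivAlong hF _)
      (contDiff_derivAlong hG _)]
    rfl

theorem iterDeriv_smul {F : V → ℂ} (hF : ContDiff ℝ ∞ F) (a : ℂ) (e : D → V) (l : List D) :
    iterDeriv e l (a • F) = a • iterDeriv e l F := by
  induction l generalizing F with
  | nil => rfl
  | cons d l ih =>
    rw [iterDeriv_cons, derivAlong_smul hF, ih (contDiff_derivAlong hF _)]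
    rfl

theorem iterDeriv_append (e : D → V) (l l' : List D) (F : V → ℂ) :
    iterDeriv e (l ++ l') F = iterDeriv e l' (iterDeriv e l F) := by
  induction l generalizing F with
  | nil => rfl
  | cons d l ih => exact ih _

theorem derivAlong_comm {F : V → ℂ} (hF : ContDiff ℝ ∞ F) (v w : V) :
    derivAlong v (derivAlong w F) = derivAlong w (derivAlong v F) := by
  have key : ∀ a b p, derivAlong a (derivAlong b F) p = fderiv ℝ (fderiv ℝ F) p a b := by
    intro a b p
    have h : DifferentiableAt ℝ (fderiv ℝ F) p :=
      ((hF.fderiv_right (m := ∞) (by simp)).differentiable (by simp)) p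
    change fderiv ℝ (fun q => fderiv ℝ F q b) p a = _
    rw [fderiv_clm_apply h (differentiableAt_const _)]
    simp
  ext p
  rw [key, key]
  exact (hF.contDiffAt.isSymmSndFDerivAt (n := ∞) (by
    rw [minSmoothness_of_isRCLikeNormedField]
    exact WithTop.coe_le_coe.2 (le_top : (2 : ℕ∞) ≤ ⊤))) v w

theorem derivAlong_congr {F G : V → ℂ} {p : V} (h : F =ᶠ[𝓝 p] G) (v : V) :
    derivAlong v F =ᶠ[𝓝 p] derivAlong v G := by
  filter_upwards [h.fderiv (𝕜 := ℝ)] with q hq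
  simp [derivAlong, hq]

theorem iterDeriv_congr {F G : V → ℂ} {p : V} (h : F =ᶠ[𝓝 p] G) (e : D → V) (l : List D) :
    iterDeriv e l F =ᶠ[𝓝 p] iterDeriv e l G := by
  induction l generalizing F G with
  | nil => exact h
  | cons d l ih => exact ih (derivAlong_congr h _)

theorem hasCompactSupport_derivAlong {F : V → ℂ} (h : HasCompactSupport F) (v : V) :
    HasCompactSupport (derivAlong v F) :=
  (h.fderiv (𝕜 := ℝ)).comp_left (g := fun L : V →L[ℝ] ℂ => L v) (by simp)

/-- The total cost of a list of directions. -/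
def cost (c : D → ℝ) (l : List D) : ℝ := (l.map c).sum

@[simp] theorem cost_nil (c : D → ℝ) : cost c [] = 0 := rfl

@[simp] theorem cost_cons (c : D → ℝ) (d : D) (l : List D) : cost c (d :: l) = c d + cost c l := by
  simp [cost]

/-- The family `F` is uniformly bounded in the symbol class in which a derivative along
`e d` costs a factor `Λ ^ c d`, relative to the weight `w`. -/
structure SymbolClass (e : D → V) (c : D → ℝ) (Λ w : V → ℝ) (F : ι → V → ℂ) : Prop where
  smooth : ∀ i, ContDiff ℝ ∞ (F i)
  bound : ∀ l : List D, ∃ C : ℝ, 0 ≤ C ∧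
    ∀ i p, ‖iterDeriv e l (F i) p‖ ≤ C * (w p * Λ p ^ cost c l)

namespace SymbolClass

variable {e : D → V} {c c' : D → ℝ} {Λ w w' : V → ℝ} {F G : ι → V → ℂ}

theorem of_bound (hs : ∀ i, ContDiff ℝ ∞ (F i)) (hΛ : ∀ p, 0 < Λ p) (hw : ∀ p, 0 ≤ w p)
    (h : ∀ l : List D, ∃ C : ℝ,
      ∀ i p, ‖iterDeriv e l (F i) p‖ ≤ C * (w p * Λ p ^ cost c l)) :
    SymbolClass e c Λ w F := by
  refine ⟨hs, fun l => ?_⟩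
  obtain ⟨C, hC⟩ := h l
  refine ⟨max C 0, le_max_right _ _, fun i p => (hC i p).trans ?_⟩
  have := hw p
  have := hΛ p
  gcongr
  exact le_max_left _ _

theorem norm_le (h : SymbolClass e c Λ w F) : ∃ C : ℝ, 0 ≤ C ∧ ∀ i p, ‖F i p‖ ≤ C * w p := by
  obtain ⟨C, h0, hC⟩ := h.bound []
  exact ⟨C, h0, by simpa using hC⟩

/-- The cost of a derivative is moved into the weight while the class keeps its shape. This makes
inductions over lists of directions possible. -/
theorem derivAlong (h : SymbolClass e c Λ w F) (hΛ : ∀ p, 0 < Λ p) (d : D) :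
    SymbolClass e c Λ (fun p => w p * Λ p ^ c d) (fun i => derivAlong (e d) (F i)) := by
  refine ⟨fun i => contDiff_derivAlong (h.smooth i) _, fun l => ?_⟩
  obtain ⟨C, h0, hC⟩ := h.bound (d :: l)
  refine ⟨C, h0, fun i p => (hC i p).trans_eq ?_⟩
  rw [cost_cons, Real.rpow_add (hΛ p), mul_assoc]

theorem iterDeriv (h : SymbolClass e c Λ w F) (hΛ : ∀ p, 0 < Λ p) (l : List D) :
    SymbolClass e c Λ (fun p => w p * Λ p ^ cost c l) (fun i => iterDeriv e l (F i)) := by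
  refine ⟨fun i => contDiff_iterDeriv (h.smooth i) _ _, fun l' => ?_⟩
  obtain ⟨C, h0, hC⟩ := h.bound (l ++ l')
  refine ⟨C, h0, fun i p => ?_⟩
  have := hC i p
  rw [iterDeriv_append] at this
  refine this.trans_eq ?_
  rw [mul_assoc, ← Real.rpow_add (hΛ p)]
  simp [cost]

theorem add (hF : SymbolClass e c Λ w F) (hG : SymbolClass e c Λ w G) :
    SymbolClass e c Λ w (fun i => F i + G i) := by
  refine ⟨fun i => (hF.smooth i).add (hG.smooth i), fun l => ?_⟩
  obtain ⟨C, h0, hC⟩ := hF.bound l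
  obtain ⟨C', h0', hC'⟩ := hG.bound l
  refine ⟨C + C', by positivity, fun i p => ?_⟩
  rw [iterDeriv_add (hF.smooth i) (hG.smooth i), Pi.add_apply, add_mul]
  exact (norm_add_le _ _).trans (add_le_add (hC i p) (hC' i p))

theorem smul (hF : SymbolClass e c Λ w F) (a : ℂ) : SymbolClass e c Λ w (fun i => a • F i) := by
  refine ⟨fun i => (hF.smooth i).const_smul a, fun l => ?_⟩
  obtain ⟨C, h0, hC⟩ := hF.bound l
  refine ⟨‖a‖ * C, by positivity, fun i p => ?_⟩
  rw [iterDeriv_smul (hF.smooth i), Pi.smul_apply, norm_smul, mul_assoc]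
  exact mul_le_mul_of_nonneg_left (hC i p) (norm_nonneg _)

theorem sub (hF : SymbolClass e c Λ w F) (hG : SymbolClass e c Λ w G) :
    SymbolClass e c Λ w (fun i => F i - G i) := by
  have := hF.add (hG.smul (-1))
  simpa [sub_eq_add_neg] using this

theorem zero : SymbolClass e c Λ w (fun _ : ι => (0 : V → ℂ)) := by
  refine ⟨fun i => contDiff_const, fun l => ⟨0, le_rfl, fun i p => ?_⟩⟩
  have := iterDeriv_smul (contDiff_const (c := (0 : ℂ))) 0 e l
  have h2 : BilinearHormander.iterDeriv e l (0 : V → ℂ) = 0 := by simpa using this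
  simp [h2]

theorem sum {κ : Type*} (s : Finset κ) {F : κ → ι → V → ℂ}
    (hF : ∀ k ∈ s, SymbolClass e c Λ w (F k)) :
    SymbolClass e c Λ w (fun i => ∑ k ∈ s, F k i) := by
  classical
  induction s using Finset.induction_on with
  | empty => simpa using zero
  | insert a s ha ih =>
    simp only [Finset.sum_insert ha]
    exact (hF a (by simp)).add (ih fun k hk => hF k (by simp [hk]))

theorem mono_weight (hF : SymbolClass e c Λ w F) (hΛ : ∀ p, 0 < Λ p)
    {B : ℝ} (hB : 0 ≤ B) (hw : ∀ p, w p ≤ B * w' p) :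
    SymbolClass e c Λ w' F := by
  refine ⟨hF.smooth, fun l => ?_⟩
  obtain ⟨C, h0, hC⟩ := hF.bound l
  refine ⟨C * B, by positivity, fun i p => (hC i p).trans ?_⟩
  have h2 := hΛ p
  calc C * (w p * Λ p ^ cost c l) ≤ C * ((B * w' p) * Λ p ^ cost c l) := by
        gcongr
        exact hw p
    _ = _ := by ring

theorem reindex {κ : Type*} (hF : SymbolClass e c Λ w F) (f : κ → ι) :
    SymbolClass e c Λ w (fun k => F (f k)) := by
  refine ⟨fun k => hF.smooth _, fun l => ?_⟩
  obtain ⟨C, h0, hC⟩ := hF.bound l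
  exact ⟨C, h0, fun i p => hC _ p⟩

/-- Leibniz rule without binomial coefficients: in the induction both weights are general, so a
derivative that falls on one factor is absorbed into the weight of that factor. -/
theorem mul (hF : SymbolClass e c Λ w F) (hG : SymbolClass e c Λ w' G) (hΛ : ∀ p, 0 < Λ p) :
    SymbolClass e c Λ (fun p => w p * w' p) (fun i => F i * G i) := by
  refine ⟨fun i => (hF.smooth i).mul (hG.smooth i), fun l => ?_⟩
  induction l generalizing F G w w' with
  | nil =>
    obtain ⟨C, h0, hC⟩ := hF.norm_le
    obtain ⟨C', h0', hC'⟩ := hG.norm_le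
    refine ⟨C * C', by positivity, fun i p => ?_⟩
    simp only [iterDeriv_nil, Pi.mul_apply, norm_mul, cost_nil, Real.rpow_zero, mul_one]
    calc ‖F i p‖ * ‖G i p‖ ≤ (C * w p) * (C' * w' p) :=
          mul_le_mul (hC i p) (hC' i p) (norm_nonneg _) ((norm_nonneg _).trans (hC i p))
      _ = _ := by ring
  | cons d l ih =>
    obtain ⟨C, h0, hC⟩ := ih (hF.derivAlong hΛ d) hG
    obtain ⟨C', h0', hC'⟩ := ih hF (hG.derivAlong hΛ d)
    refine ⟨C + C', by positivity, fun i p => ?_⟩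
    rw [iterDeriv_cons, derivAlong_mul (hF.smooth i) (hG.smooth i), iterDeriv_add
      (contDiff_pi_mul (contDiff_derivAlong (hF.smooth i) _) (hG.smooth i))
      (contDiff_pi_mul (hF.smooth i) (contDiff_derivAlong (hG.smooth i) _)), Pi.add_apply]
    refine (norm_add_le _ _).trans ((add_le_add (hC i p) (hC' i p)).trans_eq ?_)
    rw [cost_cons, Real.rpow_add (hΛ p)]
    ring

end SymbolClass

end SymbolClass

/-! ### Integration by parts against an oscillating exponential -/

section IntegrationByParts

variable {V : Type*} [NormedAddCommGroup V] [NormedSpace ℝ V]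

theorem contDiff_pi_smul {F : V → ℂ} (hF : ContDiff ℝ ∞ F) (a : ℂ) :
    ContDiff ℝ ∞ (a • F) := hF.const_smul a

theorem contDiff_pi_sum {κ : Type*} (s : Finset κ) {F : κ → V → ℂ}
    (hF : ∀ k ∈ s, ContDiff ℝ ∞ (F k)) : ContDiff ℝ ∞ (∑ k ∈ s, F k) := by
  have := ContDiff.sum hF
  convert this using 1
  ext p
  simp

theorem contDiff_cexp_neg_I {ph : V → ℝ} (hph : ContDiff ℝ ∞ ph) :
    ContDiff ℝ ∞ fun p => Complex.exp (-Complex.I * (ph p : ℂ)) :=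
  (contDiff_const.mul (Complex.ofRealCLM.contDiff.comp hph)).cexp

theorem norm_cexp_neg_I (a : ℝ) : ‖Complex.exp (-Complex.I * (a : ℂ))‖ = 1 := by
  have : -Complex.I * (a : ℂ) = ((-a : ℝ) : ℂ) * Complex.I := by push_cast; ring
  rw [this, Complex.norm_exp_ofReal_mul_I]

theorem norm_cexp_I (a : ℝ) : ‖Complex.exp (Complex.I * (a : ℂ))‖ = 1 := by
  rw [mul_comm, Complex.norm_exp_ofReal_mul_I]

theorem derivAlong_cexp_neg_I {ph : V → ℝ} (hph : ContDiff ℝ ∞ ph) (v p : V) :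
    fderiv ℝ (fun p => Complex.exp (-Complex.I * (ph p : ℂ))) p v =
      -Complex.I * (fderiv ℝ ph p v : ℂ) * Complex.exp (-Complex.I * (ph p : ℂ)) := by
  have h1 : HasFDerivAt ph (fderiv ℝ ph p) p := (hph.differentiable (by simp) p).hasFDerivAt
  have h2 := ((Complex.ofRealCLM.hasFDerivAt.comp p h1).const_mul (-Complex.I)).cexp
  have h3 : (fun p => Complex.exp (-Complex.I * (ph p : ℂ))) =
      fun p => Complex.exp (-Complex.I * (Complex.ofRealCLM ∘ ph) p) := rfl
  rw [h3, h2.fderiv]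
  simp
  ring

/-- Integration by parts against the oscillating factor `exp (-i ph)`. -/
theorem integral_cexp_mul_derivAlong [FiniteDimensional ℝ V]
    [MeasurableSpace V] [BorelSpace V] (μ : Measure V) [μ.IsAddHaarMeasure] {ph : V → ℝ}
    (hph : ContDiff ℝ ∞ ph) (v : V)
    {G : V → ℂ} (hG : ContDiff ℝ ∞ G) (hc : HasCompactSupport G) :
    ∫ p, Complex.exp (-Complex.I * (ph p : ℂ)) * derivAlong v G p ∂μ =
      ∫ p, Complex.exp (-Complex.I * (ph p : ℂ)) *
        (Complex.I * (fderiv ℝ ph p v : ℂ) * G p) ∂μ := by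
  have he := contDiff_cexp_neg_I hph
  have hd := contDiff_derivAlong he v
  have hG' := contDiff_derivAlong hG v
  have h := integral_mul_fderiv_eq_neg_fderiv_mul_of_integrable (μ := μ) (𝕜 := ℂ)
    (f := fun p => Complex.exp (-Complex.I * (ph p : ℂ))) (g := G) (v := v)
    ((hd.continuous.mul hG.continuous).integrable_of_hasCompactSupport hc.mul_left)
    ((he.continuous.mul hG'.continuous).integrable_of_hasCompactSupport
      (hasCompactSupport_derivAlong hc v).mul_left)
    ((he.continuous.mul hG.continuous).integrable_of_hasCompactSupport hc.mul_left)
    (fun x _ => he.differentiable (by simp) x) (fun x _ => hG.differentiable (by simp) x)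
  refine h.trans ?_
  rw [← integral_neg]
  congr 1
  ext p
  rw [derivAlong_cexp_neg_I hph]
  ring

end IntegrationByParts

/-- The space of the integration variables `(z, θ)` of an oscillatory integral. -/
abbrev OscSpace (n : ℕ) : Type := E n × E n

instance (n : ℕ) : (volume : Measure (OscSpace n)).IsAddHaarMeasure :=
  inferInstanceAs ((volume : Measure (E n)).prod volume).IsAddHaarMeasure

/-! ### Regularizing operators for the phase z·θ -/

section Regularization

variable {n : ℕ}

/-- The variable `z` (for `false`) or `θ` (for `true`). -/
def part (n : ℕ) (b : Bool) : OscSpace n →L[ℝ] E n :=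
  bif b then ContinuousLinearMap.snd ℝ _ _ else ContinuousLinearMap.fst ℝ _ _

/-- The coordinate directions of the space of the pairs `(z, θ)`. -/
def oscDir (d : Bool × Fin n) : OscSpace n :=
  bif d.1 then (0, EuclideanSpace.single d.2 1) else (EuclideanSpace.single d.2 1, 0)

theorem part_oscDir (b : Bool) (d : Bool × Fin n) :
    part n b (oscDir d) = if b = d.1 then EuclideanSpace.single d.2 1 else 0 := by
  obtain ⟨b', i⟩ := d
  cases b <;> cases b' <;> simp [part, oscDir]

/-- The phase `(z, θ) ↦ z · θ`. -/
def oscPhase (p : OscSpace n) : ℝ := inner ℝ p.1 p.2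

theorem contDiff_oscPhase : ContDiff ℝ ∞ (oscPhase (n := n)) :=
  contDiff_fst.inner ℝ contDiff_snd

theorem fderiv_oscPhase (b : Bool) (i : Fin n) (p : OscSpace n) :
    fderiv ℝ oscPhase p (oscDir (b, i)) = part n (!b) p i := by
  have h : HasFDerivAt (oscPhase (n := n)) _ p :=
    (hasFDerivAt_fst (𝕜 := ℝ) (p := p)).inner ℝ (hasFDerivAt_snd (𝕜 := ℝ) (p := p))
  rw [h.fderiv]
  cases b <;> simp [part, oscDir, EuclideanSpace.inner_single_left,
    EuclideanSpace.inner_single_right]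

/-- The weight `(1 + |θ|²)⁻¹` (for `false`) or `(1 + |z|²)⁻¹` (for `true`). -/
def regWeight (b : Bool) (p : OscSpace n) : ℂ := (((1 + ‖part n (!b) p‖ ^ 2)⁻¹ : ℝ) : ℂ)

/-- The regularizing operator `(1 + |θ|²)⁻¹ (1 - Δ_z)` (for `false`)
or `(1 + |z|²)⁻¹ (1 - Δ_θ)` (for `true`). -/
def reg (b : Bool) (F : OscSpace n → ℂ) : OscSpace n → ℂ :=
  regWeight b * (F - ∑ i, derivAlong (oscDir (b, i)) (derivAlong (oscDir (b, i)) F))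

theorem contDiff_regWeight (b : Bool) : ContDiff ℝ ∞ (regWeight (n := n) b) := by
  refine Complex.ofRealCLM.contDiff.comp (ContDiff.inv ?_ fun p => by positivity)
  exact contDiff_const.add ((part n (!b)).contDiff.norm_sq ℝ)

/-- With u the weight and x its variable, ∂_j u = -2 u (x_j u). It is written as a product of u and
x_j u because these are the factors allowed in `WeightPoly`. -/
theorem derivAlong_regWeight (b : Bool) (d : Bool × Fin n) :
    derivAlong (oscDir d) (regWeight b) =
      if d.1 = !b then (-2 : ℂ) • (regWeight b * fun p => (part n (!b) p d.2 : ℂ) * regWeight b p)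
      else 0 := by
  ext p
  have h0 : HasFDerivAt (fun p => 1 + ‖part n (!b) p‖ ^ 2) _ p :=
    ((part n (!b)).hasFDerivAt.norm_sq).const_add 1
  have hne : (1 + ‖part n (!b) p‖ ^ 2) ≠ 0 := by positivity
  have h2 := Complex.ofRealCLM.hasFDerivAt.comp p ((hasDerivAt_inv hne).comp_hasFDerivAt p h0)
  have h4 : derivAlong (oscDir d) (regWeight b) p = _ :=
    congrArg (fun L => L (oscDir d)) h2.fderiv
  rw [h4]
  have hp := part_oscDir (!b) d
  split_ifs with hd
  · rw [if_pos hd.symm] at hp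
    simp [hp, regWeight, EuclideanSpace.inner_single_right, ← inv_pow]
    ring
  · rw [if_neg (Ne.symm hd)] at hp
    simp [hp]

theorem contDiff_reg (b : Bool) {F : OscSpace n → ℂ} (hF : ContDiff ℝ ∞ F) :
    ContDiff ℝ ∞ (reg b F) := by
  refine contDiff_pi_mul (contDiff_regWeight b) (hF.sub ?_)
  exact contDiff_pi_sum _ fun i _ => contDiff_derivAlong (contDiff_derivAlong hF _) _

theorem hasCompactSupport_reg (b : Bool) {F : OscSpace n → ℂ} (hF : HasCompactSupport F) :
    HasCompactSupport (reg b F) := by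
  refine HasCompactSupport.mul_left (f := regWeight b) (hF.sub ?_)
  have : ∀ s : Finset (Fin n), HasCompactSupport
      (∑ i ∈ s, derivAlong (oscDir (b, i)) (derivAlong (oscDir (b, i)) F)) := by
    intro s
    induction s using Finset.induction_on with
    | empty => simpa using HasCompactSupport.zero
    | insert a s ha ih =>
      rw [Finset.sum_insert ha]
      exact (hasCompactSupport_derivAlong (hasCompactSupport_derivAlong hF _) _).add ih
  exact this _

theorem reg_congr (b : Bool) {F G : OscSpace n → ℂ} {p : OscSpace n} (h : F =ᶠ[𝓝 p] G) :
    reg b F =ᶠ[𝓝 p] reg b G := by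
  have : ∀ᶠ q in 𝓝 p, ∀ i, derivAlong (oscDir (b, i)) (derivAlong (oscDir (b, i)) F) q =
      derivAlong (oscDir (b, i)) (derivAlong (oscDir (b, i)) G) q :=
    eventually_all.2 fun i => derivAlong_congr (derivAlong_congr h _) _
  filter_upwards [h, this] with q h1 h2
  simp [reg, h1, h2]

/-- The oscillating factor `e^{-i z·θ}`. -/
def oscFactor (p : OscSpace n) : ℂ := Complex.exp (-Complex.I * (oscPhase p : ℂ))

theorem continuous_oscFactor : Continuous (oscFactor (n := n)) :=
  (contDiff_cexp_neg_I contDiff_oscPhase).continuous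

theorem norm_oscFactor (p : OscSpace n) : ‖oscFactor p‖ = 1 := norm_cexp_neg_I _

/-- The oscillating factor is an eigenfunction: (1-Δ_z) e^{-i z·θ} = (1+|θ|²) e^{-i z·θ}, and
likewise with z and θ exchanged. The weight does not depend on the variable that is differentiated,
so moving 1-Δ onto the exponential cancels it. -/
theorem integral_oscFactor_mul_reg (b : Bool) {F : OscSpace n → ℂ} (hF : ContDiff ℝ ∞ F)
    (hc : HasCompactSupport F) :
    ∫ p, oscFactor p * reg b F p = ∫ p, oscFactor p * F p := by
  have hw := contDiff_regWeight (n := n) b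
  have hint : ∀ {G : OscSpace n → ℂ}, ContDiff ℝ ∞ G → HasCompactSupport G →
      Integrable (fun p => oscFactor p * G p) := fun hG hcG =>
    (continuous_oscFactor.mul hG.continuous).integrable_of_hasCompactSupport hcG.mul_left
  have hcoord : ∀ i, ContDiff ℝ ∞ fun p : OscSpace n => (part n (!b) p i : ℂ) := by
    intro i
    exact Complex.ofRealCLM.contDiff.comp
      ((EuclideanSpace.proj (𝕜 := ℝ) i).contDiff.comp (part n (!b)).contDiff)
  -- Two integrations by parts in the same direction. Each yields a factor i x_i that is constant in
  -- that direction, hence the total factor (i x_i)² = -x_i².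
  have step : ∀ i, ∫ p, oscFactor p * (regWeight b p *
        derivAlong (oscDir (b, i)) (derivAlong (oscDir (b, i)) F) p) =
      ∫ p, oscFactor p * (-((part n (!b) p i : ℂ)) ^ 2 * regWeight b p * F p) := by
    intro i
    set v := oscDir (b, i) with hv
    have hz : derivAlong v (regWeight b) = 0 := by
      rw [hv, derivAlong_regWeight, if_neg (by cases b <;> simp)]
    have hcz : derivAlong v (fun p : OscSpace n => (part n (!b) p i : ℂ)) = 0 := by
      ext p
      have h := Complex.ofRealCLM.hasFDerivAt.comp p
        (((EuclideanSpace.proj (𝕜 := ℝ) i).comp (part n (!b))).hasFDerivAt (x := p))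
      have : derivAlong v (fun p : OscSpace n => (part n (!b) p i : ℂ)) p = _ :=
        congrArg (fun L => L v) h.fderiv
      rw [this]
      have := part_oscDir (!b) (b, i)
      rw [if_neg (by cases b <;> simp)] at this
      simp [hv, this]
    have hF1 := contDiff_derivAlong hF v
    have hc1 := hasCompactSupport_derivAlong hc v
    have e1 : ∀ p, regWeight b p * derivAlong v (derivAlong v F) p =
        derivAlong v (regWeight b * derivAlong v F) p := by
      intro p
      rw [derivAlong_mul hw hF1, hz]
      simp
    have e2 : ∀ p, Complex.I * (part n (!b) p i : ℂ) * (regWeight b p * derivAlong v F p) =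
        derivAlong v (((Complex.I) • (fun p => (part n (!b) p i : ℂ))) *
          (regWeight b * F)) p := by
      intro p
      rw [derivAlong_mul (contDiff_pi_smul (hcoord i) _) (contDiff_pi_mul hw hF),
        derivAlong_smul (hcoord i), hcz, derivAlong_mul hw hF, hz]
      simp [mul_assoc]
    simp_rw [e1]
    have i1 := integral_cexp_mul_derivAlong (volume : Measure (OscSpace n)) contDiff_oscPhase v
      (contDiff_pi_mul hw hF1) (hc1.mul_left (f := regWeight b))
    simp_rw [hv, fderiv_oscPhase] at i1
    rw [← hv] at i1
    refine i1.trans ?_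
    simp_rw [Pi.mul_apply, e2]
    have i2 := integral_cexp_mul_derivAlong (volume : Measure (OscSpace n)) contDiff_oscPhase v
      (contDiff_pi_mul (contDiff_pi_smul (hcoord i) Complex.I) (contDiff_pi_mul hw hF))
      ((hc.mul_left (f := regWeight b)).mul_left
        (f := Complex.I • (fun p : OscSpace n => (part n (!b) p i : ℂ))))
    simp_rw [hv, fderiv_oscPhase] at i2
    rw [← hv] at i2
    refine i2.trans ?_
    congr 1
    ext p
    simp only [Pi.mul_apply, Pi.smul_apply, smul_eq_mul, oscFactor]
    linear_combination (Complex.exp (-Complex.I * (oscPhase p : ℂ)) *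
      (part n (!b) p i : ℂ) ^ 2 * regWeight b p * F p) * Complex.I_sq
  have hsum : ∀ p, oscFactor p * reg b F p = oscFactor p * (regWeight b p * F p) -
      ∑ i, oscFactor p * (regWeight b p *
        derivAlong (oscDir (b, i)) (derivAlong (oscDir (b, i)) F) p) := by
    intro p
    simp [reg, mul_sub, Finset.mul_sum]
  simp_rw [hsum]
  have hA : Integrable fun p => oscFactor p * (regWeight b p * F p) :=
    hint (contDiff_pi_mul hw hF) hc.mul_left
  have hB : ∀ i, Integrable fun p => oscFactor p * (regWeight b p *
        derivAlong (oscDir (b, i)) (derivAlong (oscDir (b, i)) F) p) := fun i =>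
    hint (contDiff_pi_mul hw (contDiff_derivAlong (contDiff_derivAlong hF _) _))
      (hasCompactSupport_derivAlong (hasCompactSupport_derivAlong hc _) _).mul_left
  have hC : ∀ i, Integrable fun p => oscFactor p *
      (-((part n (!b) p i : ℂ)) ^ 2 * regWeight b p * F p) := fun i =>
    hint (((((hcoord i).pow 2).neg).mul hw).mul hF) hc.mul_left
  rw [integral_sub hA (integrable_finsetSum _ fun i _ => hB i),
    integral_finsetSum _ fun i _ => hB i]
  simp_rw [step]
  rw [← integral_finsetSum _ fun i _ => hC i,
    ← integral_sub hA (integrable_finsetSum _ fun i _ => hC i)]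
  congr 1
  ext p
  have hn : ((‖part n (!b) p‖ ^ 2 : ℝ) : ℂ) = ∑ i, (part n (!b) p i : ℂ) ^ 2 := by
    rw [EuclideanSpace.norm_sq_eq]
    push_cast
    refine Finset.sum_congr rfl fun i _ => ?_
    rw [Real.norm_eq_abs, ← Complex.ofReal_pow, sq_abs, Complex.ofReal_pow]
  have hu : regWeight b p * (1 + ∑ i, (part n (!b) p i : ℂ) ^ 2) = 1 := by
    rw [← hn, regWeight]
    have : (1 + ‖part n (!b) p‖ ^ 2) ≠ 0 := by positivity
    exact_mod_cast inv_mul_cancel₀ this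
  rw [← Finset.mul_sum, ← Finset.sum_mul, ← Finset.sum_mul, Finset.sum_neg_distrib]
  linear_combination oscFactor p * F p * hu

end Regularization

/-! ### Symbol estimates for the regularization, and convergence of oscillatory integrals -/

section RegWeight

variable {n : ℕ}

/-- The functions `x_j / (1 + |x|²)`, where `x = θ` (for `false`) or `x = z` (for `true`). -/
def regCoord (b : Bool) (j : Fin n) (p : OscSpace n) : ℂ := (part n (!b) p j : ℂ)

theorem contDiff_regCoord (b : Bool) (j : Fin n) : ContDiff ℝ ∞ (regCoord (n := n) b j) :=
  Complex.ofRealCLM.contDiff.comp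
    ((EuclideanSpace.proj (𝕜 := ℝ) j).contDiff.comp (part n (!b)).contDiff)

theorem derivAlong_regCoord (b : Bool) (j : Fin n) (d : Bool × Fin n) :
    ∃ a : ℂ, derivAlong (oscDir d) (regCoord b j) = fun _ => a := by
  refine ⟨(part n (!b) (oscDir d) j : ℂ), ?_⟩
  ext p
  have h := Complex.ofRealCLM.hasFDerivAt.comp p
    (((EuclideanSpace.proj (𝕜 := ℝ) j).comp (part n (!b))).hasFDerivAt (x := p))
  exact congrArg (fun L => L (oscDir d)) h.fderiv

/-- The functions obtained from `u = (1 + |x|²)⁻¹` by products with `u` and with the `x_j u` and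
by linear combinations. -/
inductive WeightPoly (b : Bool) : (OscSpace n → ℂ) → Prop
  | base : WeightPoly b (regWeight b)
  | mul_base {F} : WeightPoly b F → WeightPoly b (F * regWeight b)
  | mul_coord {F} (j : Fin n) : WeightPoly b F → WeightPoly b (F * (regCoord b j * regWeight b))
  | add {F G} : WeightPoly b F → WeightPoly b G → WeightPoly b (F + G)
  | smul {F} (a : ℂ) : WeightPoly b F → WeightPoly b (a • F)

namespace WeightPoly

variable {b : Bool} {F : OscSpace n → ℂ}

theorem contDiff (h : WeightPoly b F) : ContDiff ℝ ∞ F := by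
  induction h with
  | base => exact contDiff_regWeight b
  | mul_base _ ih => exact contDiff_pi_mul ih (contDiff_regWeight b)
  | mul_coord j _ ih =>
    exact contDiff_pi_mul ih (contDiff_pi_mul (contDiff_regCoord b j) (contDiff_regWeight b))
  | add _ _ ih ih' => exact ih.add ih'
  | smul a _ ih => exact contDiff_pi_smul ih a

theorem zero : WeightPoly (n := n) b 0 := by simpa using smul 0 (base (b := b))

theorem derivAlong_regWeight_mem (d : Bool × Fin n) {G : OscSpace n → ℂ}
    (hG : WeightPoly b G) : WeightPoly b (G * derivAlong (oscDir d) (regWeight b)) := by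
  rw [derivAlong_regWeight]
  split_ifs with h
  · have := smul (-2) ((mul_coord d.2 (mul_base hG)))
    convert this using 1
    ext p
    simp [regCoord]
    ring
  · simpa using zero

/-- The class is closed because ∂u = -2 u (x_j u), while ∂(x_j u) is a constant times u plus a
multiple of (x_j u)(x_k u); no new factor appears. -/
theorem derivAlong_mem (h : WeightPoly b F) (d : Bool × Fin n) :
    WeightPoly b (derivAlong (oscDir d) F) := by
  induction h with
  | base =>
    rw [derivAlong_regWeight]
    split_ifs with h
    · have := smul (-2) ((mul_coord d.2 (base (b := b))))
      exact this
    · exact zero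
  | mul_base hF ih =>
    rw [derivAlong_mul hF.contDiff (contDiff_regWeight b)]
    exact add (mul_base ih) (derivAlong_regWeight_mem d hF)
  | @mul_coord G j hF ih =>
    obtain ⟨a, ha⟩ := derivAlong_regCoord b j d
    have hj := contDiff_regCoord (n := n) b j
    have hw := contDiff_regWeight (n := n) b
    rw [derivAlong_mul hF.contDiff (contDiff_pi_mul hj hw), derivAlong_mul hj hw, ha]
    refine add (mul_coord j ih) ?_
    have h1 := smul a (mul_base hF)
    have h2 : WeightPoly b (G * (regCoord b j * derivAlong (oscDir d) (regWeight b))) := by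
      rw [derivAlong_regWeight]
      split_ifs with h
      · have := smul (-2) (mul_coord d.2 (mul_coord j hF))
        convert this using 1
        ext p
        simp [regCoord]
        ring
      · simpa using zero
    convert add h1 h2 using 1
    ext p
    simp
    ring
  | add hF hG ih ih' => rw [derivAlong_add hF.contDiff hG.contDiff]; exact add ih ih'
  | smul a hF ih => rw [derivAlong_smul hF.contDiff]; exact smul a ih

theorem iterDeriv_mem (h : WeightPoly b F) (l : List (Bool × Fin n)) :
    WeightPoly b (iterDeriv oscDir l F) := by
  induction l generalizing F with
  | nil => exact h
  | cons d l ih => exact ih (h.derivAlong_mem d)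

theorem norm_regWeight (p : OscSpace n) : ‖regWeight b p‖ = (1 + ‖part n (!b) p‖ ^ 2)⁻¹ := by
  rw [regWeight, Complex.norm_real, Real.norm_of_nonneg (by positivity)]

/-- Every product contains the base factor u, and the further factors u and x_j u have modulus at
most 1. -/
theorem norm_le (h : WeightPoly b F) :
    ∃ C : ℝ, 0 ≤ C ∧ ∀ p, ‖F p‖ ≤ C * (1 + ‖part n (!b) p‖ ^ 2)⁻¹ := by
  induction h with
  | base => exact ⟨1, by simp, fun p => by rw [norm_regWeight, one_mul]⟩
  | mul_base hF ih =>
    obtain ⟨C, h0, hC⟩ := ih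
    refine ⟨C, h0, fun p => ?_⟩
    rw [Pi.mul_apply, norm_mul, norm_regWeight]
    refine (mul_le_of_le_one_right (norm_nonneg _) (inv_le_one_of_one_le₀ ?_)).trans (hC p)
    nlinarith [norm_nonneg (part n (!b) p)]
  | mul_coord j hF ih =>
    obtain ⟨C, h0, hC⟩ := ih
    refine ⟨C, h0, fun p => ?_⟩
    rw [Pi.mul_apply, norm_mul, Pi.mul_apply, norm_mul, norm_regWeight]
    refine (mul_le_of_le_one_right (norm_nonneg _) ?_).trans (hC p)
    rw [← div_eq_mul_inv, div_le_one (by positivity), regCoord, Complex.norm_real]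
    have := PiLp.norm_apply_le (part n (!b) p) j
    nlinarith [sq_nonneg (‖part n (!b) p‖ - 1)]
  | add hF hG ih ih' =>
    obtain ⟨C, h0, hC⟩ := ih
    obtain ⟨C', h0', hC'⟩ := ih'
    refine ⟨C + C', by positivity, fun p => ?_⟩
    rw [add_mul]
    exact (norm_add_le _ _).trans (add_le_add (hC p) (hC' p))
  | smul a hF ih =>
    obtain ⟨C, h0, hC⟩ := ih
    refine ⟨‖a‖ * C, by positivity, fun p => ?_⟩
    rw [Pi.smul_apply, norm_smul, mul_assoc]
    exact mul_le_mul_of_nonneg_left (hC p) (norm_nonneg _)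

end WeightPoly

/-- The growth weight `1 + |θ|`. -/
def thetaWeight (p : OscSpace n) : ℝ := 1 + ‖p.2‖

theorem one_le_thetaWeight (p : OscSpace n) : 1 ≤ thetaWeight p := by simp [thetaWeight]

theorem thetaWeight_pos (p : OscSpace n) : 0 < thetaWeight p :=
  zero_lt_one.trans_le (one_le_thetaWeight p)

/-- The cost `δ` for a derivative in `z` and `κ` for a derivative in `θ`. -/
def oscCost (δ κ : ℝ) (d : Bool × Fin n) : ℝ := bif d.1 then κ else δ

/-- Every derivative of u is O(u). The costs are nonnegative, so the factor `thetaWeight p ^ cost`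
allowed by the class is at least 1 and only helps. -/
theorem symbolClass_regWeight {ι : Type*} {δ κ : ℝ} (hδ : 0 ≤ δ) (hκ : 0 ≤ κ) (b : Bool) :
    SymbolClass oscDir (oscCost δ κ) thetaWeight (fun p => (1 + ‖part n (!b) p‖) ^ (-2 : ℝ))
      (fun _ : ι => regWeight b) := by
  refine ⟨fun _ => contDiff_regWeight b, fun l => ?_⟩
  obtain ⟨C, h0, hC⟩ := (WeightPoly.iterDeriv_mem (WeightPoly.base (b := b)) l).norm_le
  refine ⟨C * 2, by positivity, fun _ p => (hC p).trans ?_⟩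
  have h1 : 1 ≤ thetaWeight p ^ cost (oscCost δ κ) l := by
    refine Real.one_le_rpow (one_le_thetaWeight p) (List.sum_nonneg ?_)
    simp only [List.mem_map]
    rintro _ ⟨⟨d, i⟩, _, rfl⟩
    cases d <;> simpa [oscCost]
  set x := ‖part n (!b) p‖
  have hx : 0 ≤ x := norm_nonneg _
  have h2 : (1 + x ^ 2)⁻¹ ≤ 2 * (1 + x) ^ (-2 : ℝ) := by
    rw [Real.rpow_neg (by positivity), ← div_eq_mul_inv, inv_eq_one_div,
      div_le_div_iff₀ (by positivity) (by positivity)]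
    norm_cast
    nlinarith [sq_nonneg (x - 1)]
  rw [mul_assoc]
  gcongr
  refine h2.trans ?_
  rw [← mul_assoc]
  exact le_mul_of_one_le_right (by positivity) h1

/-- The Laplacian costs two derivatives, hence the exponent 2δ or 2κ. The undifferentiated term fits
the same weight because that exponent is nonnegative. -/
theorem symbolClass_reg {ι : Type*} {δ κ : ℝ} (hδ : 0 ≤ δ) (hκ : 0 ≤ κ) (b : Bool)
    {w : OscSpace n → ℝ} (hw : ∀ p, 0 ≤ w p) {F : ι → OscSpace n → ℂ}
    (hF : SymbolClass oscDir (oscCost δ κ) thetaWeight w F) :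
    SymbolClass oscDir (oscCost δ κ) thetaWeight
      (fun p => (1 + ‖part n (!b) p‖) ^ (-2 : ℝ) *
        (w p * thetaWeight p ^ (2 * (bif b then κ else δ)))) (fun i => reg b (F i)) := by
  have hpos := thetaWeight_pos (n := n)
  refine (symbolClass_regWeight hδ hκ b).mul (SymbolClass.sub ?_ (SymbolClass.sum _ ?_)) hpos
  · refine hF.mono_weight hpos zero_le_one fun p => ?_
    rw [one_mul]
    refine le_mul_of_one_le_right (hw p) (Real.one_le_rpow (one_le_thetaWeight p) ?_)
    cases b <;> simpa
  · intro i _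
    refine ((hF.derivAlong hpos (b, i)).derivAlong hpos (b, i)).mono_weight hpos zero_le_one
      fun p => ?_
    rw [one_mul, mul_assoc, ← Real.rpow_add (hpos p)]
    simp [oscCost, two_mul]

/-- The operator `M ^ k N ^ q` with `N = (1 + |θ|²)⁻¹ (1 - Δ_z)` and
`M = (1 + |z|²)⁻¹ (1 - Δ_θ)`. -/
def fullReg (k q : ℕ) (F : OscSpace n → ℂ) : OscSpace n → ℂ :=
  (reg true)^[k] ((reg false)^[q] F)

theorem contDiff_iterate_reg (b : Bool) (k : ℕ) {F : OscSpace n → ℂ} (hF : ContDiff ℝ ∞ F) :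
    ContDiff ℝ ∞ ((reg b)^[k] F) := by
  induction k with
  | zero => exact hF
  | succ k ih => rw [Function.iterate_succ_apply']; exact contDiff_reg b ih

theorem hasCompactSupport_iterate_reg (b : Bool) (k : ℕ) {F : OscSpace n → ℂ}
    (hF : HasCompactSupport F) : HasCompactSupport ((reg b)^[k] F) := by
  induction k with
  | zero => exact hF
  | succ k ih => rw [Function.iterate_succ_apply']; exact hasCompactSupport_reg b ih

theorem iterate_reg_congr (b : Bool) (k : ℕ) {F G : OscSpace n → ℂ} {p : OscSpace n}
    (h : F =ᶠ[𝓝 p] G) : (reg b)^[k] F =ᶠ[𝓝 p] (reg b)^[k] G := by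
  induction k with
  | zero => exact h
  | succ k ih => simp only [Function.iterate_succ_apply']; exact reg_congr b ih

theorem fullReg_congr (k q : ℕ) {F G : OscSpace n → ℂ} {p : OscSpace n}
    (h : F =ᶠ[𝓝 p] G) : fullReg k q F p = fullReg k q G p :=
  (iterate_reg_congr true k (iterate_reg_congr false q h)).eq_of_nhds

theorem integral_oscFactor_mul_iterate_reg (b : Bool) (k : ℕ) {F : OscSpace n → ℂ}
    (hF : ContDiff ℝ ∞ F) (hc : HasCompactSupport F) :
    ∫ p, oscFactor p * (reg b)^[k] F p = ∫ p, oscFactor p * F p := by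
  induction k with
  | zero => rfl
  | succ k ih =>
    rw [← ih]
    simp only [Function.iterate_succ_apply']
    exact integral_oscFactor_mul_reg b (contDiff_iterate_reg b k hF)
      (hasCompactSupport_iterate_reg b k hc)

theorem integral_oscFactor_mul_fullReg (k q : ℕ) {F : OscSpace n → ℂ}
    (hF : ContDiff ℝ ∞ F) (hc : HasCompactSupport F) :
    ∫ p, oscFactor p * fullReg k q F p = ∫ p, oscFactor p * F p := by
  rw [← integral_oscFactor_mul_iterate_reg false q hF hc]
  exact integral_oscFactor_mul_iterate_reg true k (contDiff_iterate_reg _ _ hF)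
    (hasCompactSupport_iterate_reg _ _ hc)

/-- Each application gains (1+|θ|)^{-2} and loses (1+|θ|)^{2δ}; for δ < 1 this is a net gain, which
repetition makes as large as desired. -/
theorem symbolClass_iterate_reg_false {ι : Type*} {δ κ r : ℝ} (hδ : 0 ≤ δ) (hκ : 0 ≤ κ)
    {F : ι → OscSpace n → ℂ}
    (hF : SymbolClass oscDir (oscCost δ κ) thetaWeight (fun p => thetaWeight p ^ r) F) (q : ℕ) :
    SymbolClass oscDir (oscCost δ κ) thetaWeight
      (fun p => thetaWeight p ^ (r - 2 * q * (1 - δ))) (fun i => (reg false)^[q] (F i)) := by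
  induction q with
  | zero => simpa using hF
  | succ q ih =>
    simp only [Function.iterate_succ_apply']
    refine (symbolClass_reg hδ hκ false (fun p => Real.rpow_nonneg (thetaWeight_pos p).le _)
      ih).mono_weight thetaWeight_pos zero_le_one fun p => le_of_eq ?_
    have hp := thetaWeight_pos p
    change thetaWeight p ^ (-2 : ℝ) * _ = _
    rw [← Real.rpow_add hp, ← Real.rpow_add hp, one_mul]
    congr 1
    push_cast
    simp
    ring

/-- Each application gains (1+|z|)^{-2} and loses (1+|θ|)^{2κ}. No upper bound on κ is imposed; the
loss is paid for by the other operator. -/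
theorem symbolClass_iterate_reg_true {ι : Type*} {δ κ r : ℝ} (hδ : 0 ≤ δ) (hκ : 0 ≤ κ)
    {F : ι → OscSpace n → ℂ}
    (hF : SymbolClass oscDir (oscCost δ κ) thetaWeight (fun p => thetaWeight p ^ r) F) (k : ℕ) :
    SymbolClass oscDir (oscCost δ κ) thetaWeight
      (fun p => (1 + ‖p.1‖) ^ (-(2 * k) : ℝ) * thetaWeight p ^ (r + 2 * k * κ))
      (fun i => (reg true)^[k] (F i)) := by
  induction k with
  | zero => simpa using hF
  | succ k ih =>
    simp only [Function.iterate_succ_apply']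
    refine (symbolClass_reg hδ hκ true (fun p => mul_nonneg (by positivity)
      (Real.rpow_nonneg (thetaWeight_pos p).le _))
      ih).mono_weight thetaWeight_pos zero_le_one fun p => le_of_eq ?_
    have hp := thetaWeight_pos p
    have hz : 0 < 1 + ‖p.1‖ := by positivity
    change (1 + ‖p.1‖) ^ (-2 : ℝ) * _ = _
    rw [mul_assoc, ← Real.rpow_add hp, ← mul_assoc, ← Real.rpow_add hz, one_mul]
    congr 2
    · push_cast
      ring
    · push_cast
      simp
      ring

/-- Amplitudes in a class with `δ < 1` are dominated by a fixed integrable function once they are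
regularized. -/
theorem exists_fullReg_bound {ι : Type*} {δ κ r : ℝ} (hδ : 0 ≤ δ) (hδ1 : δ < 1) (hκ : 0 ≤ κ)
    {F : ι → OscSpace n → ℂ}
    (hF : SymbolClass oscDir (oscCost δ κ) thetaWeight (fun p => thetaWeight p ^ r) F) :
    ∃ (k q : ℕ) (g : OscSpace n → ℝ), Integrable g ∧ ∀ i p, ‖fullReg k q (F i) p‖ ≤ g p := by
  -- With k = n+1 the decay in z is of order 2(n+1), and q is chosen so that the θ-exponent r -
  -- 2q(1-δ) + 2(n+1)κ is at most -(n+1). The exponent -(n+1) is integrable on ℝⁿ.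
  obtain ⟨q, hq⟩ := exists_nat_ge ((n + 1 + r + 2 * (n + 1 : ℕ) * κ) / (2 * (1 - δ)))
  rw [div_le_iff₀ (by linarith)] at hq
  have h := symbolClass_iterate_reg_true hδ hκ
    (symbolClass_iterate_reg_false hδ hκ hF q) (n + 1)
  obtain ⟨C, h0, hC⟩ := h.norm_le
  refine ⟨n + 1, q, fun p => C * ((1 + ‖p.1‖) ^ (-(n + 1) : ℝ) * (1 + ‖p.2‖) ^ (-(n + 1) : ℝ)),
    ?_, fun i p => (hC i p).trans ?_⟩
  · refine Integrable.const_mul ?_ C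
    have : Integrable (fun x : E n => (1 + ‖x‖) ^ (-(n + 1) : ℝ)) :=
      integrable_one_add_norm (by simp)
    exact this.mul_prod this
  · have h1 : 1 ≤ 1 + ‖p.1‖ := by simp
    refine mul_le_mul_of_nonneg_left (mul_le_mul (Real.rpow_le_rpow_of_exponent_le h1 ?_)
      (Real.rpow_le_rpow_of_exponent_le (one_le_thetaWeight p) ?_)
      (Real.rpow_nonneg (thetaWeight_pos p).le _) (by positivity)) h0
    · push_cast
      linarith
    · push_cast at hq ⊢
      linarith

/-- Uniform bound for oscillatory integrals. -/
theorem exists_norm_integral_oscFactor_le {ι : Type*} {δ κ r : ℝ} (hδ : 0 ≤ δ) (hδ1 : δ < 1)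
    (hκ : 0 ≤ κ) {F : ι → OscSpace n → ℂ} (hc : ∀ i, HasCompactSupport (F i))
    (hF : SymbolClass oscDir (oscCost δ κ) thetaWeight (fun p => thetaWeight p ^ r) F) :
    ∃ C : ℝ, 0 ≤ C ∧ ∀ i, ‖∫ p, oscFactor p * F i p‖ ≤ C := by
  obtain ⟨k, q, g, hg, h⟩ := exists_fullReg_bound hδ hδ1 hκ hF
  refine ⟨max (∫ p, g p) 0, le_max_right _ _, fun i => le_max_of_le_left ?_⟩
  rw [← integral_oscFactor_mul_fullReg k q (hF.smooth i) (hc i)]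
  refine norm_integral_le_of_norm_le hg (Eventually.of_forall fun p => ?_)
  rw [norm_mul, norm_oscFactor, one_mul]
  exact h i p

/-- Oscillatory integrals of locally eventually constant bounded sequences of amplitudes
converge; the limit depends only on the limit amplitude. -/
theorem exists_tendsto_integral_oscFactor {δ κ r : ℝ} (hδ : 0 ≤ δ) (hδ1 : δ < 1)
    (hκ : 0 ≤ κ) {F G : ℕ → OscSpace n → ℂ} {H : OscSpace n → ℂ}
    (hFc : ∀ i, HasCompactSupport (F i)) (hGc : ∀ i, HasCompactSupport (G i))
    (hF : SymbolClass oscDir (oscCost δ κ) thetaWeight (fun p => thetaWeight p ^ r) F)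
    (hG : SymbolClass oscDir (oscCost δ κ) thetaWeight (fun p => thetaWeight p ^ r) G)
    (hFH : ∀ p, ∀ᶠ i in atTop, F i =ᶠ[𝓝 p] H) (hGH : ∀ p, ∀ᶠ i in atTop, G i =ᶠ[𝓝 p] H) :
    ∃ ℓ : ℂ, Tendsto (fun i => ∫ p, oscFactor p * F i p) atTop (𝓝 ℓ) ∧
      Tendsto (fun i => ∫ p, oscFactor p * G i p) atTop (𝓝 ℓ) := by
  -- Both sequences are merged into one family, so that a single choice of k, q and g serves them.
  -- Both limits are then the same integral of `fullReg k q H`.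
  have hFG : SymbolClass oscDir (oscCost δ κ) thetaWeight (fun p => thetaWeight p ^ r)
      (fun i : Bool × ℕ => bif i.1 then F i.2 else G i.2) := by
    refine ⟨fun i => ?_, fun l => ?_⟩
    · obtain ⟨b, i⟩ := i
      cases b
      exacts [hG.smooth i, hF.smooth i]
    · obtain ⟨C, h0, hC⟩ := hF.bound l
      obtain ⟨C', h0', hC'⟩ := hG.bound l
      refine ⟨C + C', by positivity, ?_⟩
      rintro ⟨b, i⟩ p
      have hpos : 0 ≤ thetaWeight p ^ r * thetaWeight p ^ cost (oscCost δ κ) l := by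
        have := (thetaWeight_pos p).le
        positivity
      cases b
      · exact (hC' i p).trans (mul_le_mul_of_nonneg_right (by linarith) hpos)
      · exact (hC i p).trans (mul_le_mul_of_nonneg_right (by linarith) hpos)
  obtain ⟨k, q, g, hg, h⟩ := exists_fullReg_bound hδ hδ1 hκ hFG
  have key : ∀ K : ℕ → OscSpace n → ℂ, (∀ i, ContDiff ℝ ∞ (K i)) →
      (∀ i, HasCompactSupport (K i)) → (∀ i p, ‖fullReg k q (K i) p‖ ≤ g p) →
      (∀ p, ∀ᶠ i in atTop, K i =ᶠ[𝓝 p] H) →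
      Tendsto (fun i => ∫ p, oscFactor p * K i p) atTop
        (𝓝 (∫ p, oscFactor p * fullReg k q H p)) := by
    intro K hs hKc hKb hKH
    simp_rw [← fun i => integral_oscFactor_mul_fullReg k q (hs i) (hKc i)]
    refine tendsto_integral_of_dominated_convergence g (fun i => ?_) hg (fun i => ?_) ?_
    · exact (continuous_oscFactor.mul (contDiff_iterate_reg true k
        (contDiff_iterate_reg false q (hs i))).continuous).aestronglyMeasurable
    · refine Eventually.of_forall fun p => ?_
      rw [norm_mul, norm_oscFactor, one_mul]
      exact hKb i p
    -- The regularization is local: at each point the regularized amplitudes eventually equal the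
    -- limit value.
    · refine Eventually.of_forall fun p => ?_
      refine Tendsto.congr' ?_ tendsto_const_nhds
      filter_upwards [hKH p] with i hi
      rw [fullReg_congr k q hi]
  exact ⟨_, key F hF.smooth hFc (fun i p => h (true, i) p) hFH,
    key G hG.smooth hGc (fun i p => h (false, i) p) hGH⟩

end RegWeight

/-- Serves the anisotropic dilations `scaleMap` and the isotropic ones in `cutoff`. Directions go to
multiples of directions, so the chain rule produces no sums. -/
theorem iterDeriv_comp_affine {V V' D D' : Type*} [NormedAddCommGroup V] [NormedSpace ℝ V]
    [NormedAddCommGroup V'] [NormedSpace ℝ V'] {e : D → V} {e' : D' → V'} {f : D → D'}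
    {a : D → ℝ} {L : V →L[ℝ] V'} (hL : ∀ d, L (e d) = a d • e' (f d)) (p : V')
    {F : V' → ℂ} (hF : ContDiff ℝ ∞ F) (l : List D) :
    iterDeriv e l (fun w => F (p + L w)) =
      fun w => ((l.map a).prod : ℂ) * iterDeriv e' (l.map f) F (p + L w) := by
  induction l generalizing F with
  | nil => simp
  | cons d l ih =>
    have h : derivAlong (e d) (fun w => F (p + L w)) =
        (a d : ℂ) • fun w => derivAlong (e' (f d)) F (p + L w) := by
      ext w
      have h1 : HasFDerivAt (fun w => F (p + L w)) ((fderiv ℝ F (p + L w)).comp L) w :=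
        ((hF.differentiable (by simp) _).hasFDerivAt).comp w (L.hasFDerivAt.const_add p)
      simp [derivAlong, h1.fderiv, hL]
    have hs : ContDiff ℝ ∞ fun w => derivAlong (e' (f d)) F (p + L w) :=
      (contDiff_derivAlong hF _).comp (contDiff_const.add L.contDiff)
    rw [iterDeriv_cons, h, iterDeriv_smul hs, ih (contDiff_derivAlong hF _)]
    ext w
    simp [iterDeriv_cons, mul_assoc]

/-! ### Anisotropic scaling of bilinear symbols -/

section BSClass

variable {n : ℕ}

/-- The coordinate directions of the phase space. -/
def phaseDir : Fin n ⊕ Fin n ⊕ Fin n → Phase n := Sum.elim dirX (Sum.elim dirXi dirEta)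

/-- The cost `δ` for a derivative in `x`, and `-ρ` for a derivative in `ξ` or `η`. -/
def phaseCost (ρ δ : ℝ) : Fin n ⊕ Fin n ⊕ Fin n → ℝ :=
  Sum.elim (fun _ => δ) (Sum.elim (fun _ => -ρ) fun _ => -ρ)

/-- The weight `1 + |ξ| + |η|`. -/
def phaseWeight (p : Phase n) : ℝ := 1 + ‖p.2.1‖ + ‖p.2.2‖

theorem one_le_phaseWeight (p : Phase n) : 1 ≤ phaseWeight p := by
  have := norm_nonneg p.2.1
  have := norm_nonneg p.2.2
  simp only [phaseWeight]
  linarith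

theorem phaseWeight_pos (p : Phase n) : 0 < phaseWeight p :=
  zero_lt_one.trans_le (one_le_phaseWeight p)

/-- Bounded families in `BS^m_{ρ,δ}`. -/
abbrev BSFamily {ι : Type*} (m ρ δ : ℝ) (F : ι → Symb n) : Prop :=
  SymbolClass phaseDir (phaseCost ρ δ) phaseWeight (fun p => phaseWeight p ^ m) F

/-- The map `(z, θ) ↦ (a z, b θ, 0)`. -/
def scaleMap (a b : ℝ) : OscSpace n →L[ℝ] Phase n :=
  (a • ContinuousLinearMap.fst ℝ _ _).prod ((b • ContinuousLinearMap.snd ℝ _ _).prod 0)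

@[simp] theorem scaleMap_apply (a b : ℝ) (w : OscSpace n) :
    scaleMap a b w = (a • w.1, b • w.2, 0) := rfl

theorem scaleMap_oscDir (a b : ℝ) (d : Bool × Fin n) :
    scaleMap a b (oscDir d) = (bif d.1 then b else a) •
      phaseDir (bif d.1 then Sum.inr (Sum.inl d.2) else Sum.inl d.2) := by
  obtain ⟨c, i⟩ := d
  cases c <;> simp [oscDir, phaseDir, dirX, dirXi]

section Weights

variable {δ t : ℝ}

theorem phaseWeight_add_scaleMap_le (hδ1 : δ < 1) (ht0 : 0 ≤ t) (ht1 : t ≤ 1) (p : Phase n)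
    (w : OscSpace n) (a : ℝ) :
    phaseWeight (p + scaleMap a (t * phaseWeight p ^ δ) w) ≤ phaseWeight p * thetaWeight w := by
  have h1 := one_le_phaseWeight p
  have h2 : phaseWeight p ^ δ ≤ phaseWeight p := by
    simpa using Real.rpow_le_rpow_of_exponent_le h1 hδ1.le
  have h0 : 0 ≤ phaseWeight p ^ δ := Real.rpow_nonneg (by linarith) _
  have h3 : ‖p.2.1 + (t * phaseWeight p ^ δ) • w.2‖ ≤ ‖p.2.1‖ + phaseWeight p * ‖w.2‖ := by
    refine (norm_add_le _ _).trans ?_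
    rw [norm_smul, Real.norm_of_nonneg (by positivity)]
    gcongr
    nlinarith
  simp only [phaseWeight, thetaWeight] at h3 ⊢
  simp only [scaleMap_apply, Prod.snd_add, Prod.fst_add, add_zero]
  nlinarith

/-- A shift of size λ^δ|θ| either is at most λ/2, and then the weight at least keeps half its size,
or it is larger, and then λ^{1-δ} < 2|θ|, so λ itself is bounded by a power of 1+|θ|. -/
theorem phaseWeight_le_add_scaleMap (hδ : 0 ≤ δ) (hδ1 : δ < 1) (ht0 : 0 ≤ t) (ht1 : t ≤ 1)
    (p : Phase n) (w : OscSpace n) (a : ℝ) :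
    phaseWeight p ≤ phaseWeight (p + scaleMap a (t * phaseWeight p ^ δ) w) *
      (2 * thetaWeight w) ^ (1 / (1 - δ)) := by
  set μ := phaseWeight (p + scaleMap a (t * phaseWeight p ^ δ) w) with hμ
  have h1 := one_le_phaseWeight p
  have hμ1 : 1 ≤ μ := one_le_phaseWeight _
  have hΘ := one_le_thetaWeight w
  have hκ : 1 ≤ 1 / (1 - δ) := by rw [le_div_iff₀ (by linarith)]; linarith
  have h0 : 0 ≤ phaseWeight p ^ δ := Real.rpow_nonneg (by linarith) _
  have h3 : phaseWeight p ≤ μ + phaseWeight p ^ δ * ‖w.2‖ := by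
    have h4 : ‖p.2.1‖ ≤ ‖p.2.1 + (t * phaseWeight p ^ δ) • w.2‖ + phaseWeight p ^ δ * ‖w.2‖ := by
      have := norm_sub_le (p.2.1 + (t * phaseWeight p ^ δ) • w.2) ((t * phaseWeight p ^ δ) • w.2)
      rw [add_sub_cancel_right] at this
      refine this.trans ?_
      rw [norm_smul (t * phaseWeight p ^ δ), Real.norm_of_nonneg (by positivity)]
      gcongr
      nlinarith
    have h5 : μ = 1 + ‖p.2.1 + (t * phaseWeight p ^ δ) • w.2‖ + ‖p.2.2‖ := by
      simp [hμ, phaseWeight]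
    have h6 : phaseWeight p = 1 + ‖p.2.1‖ + ‖p.2.2‖ := rfl
    linarith
  have hb : 2 * thetaWeight w ≤ (2 * thetaWeight w) ^ (1 / (1 - δ)) := by
    simpa using Real.rpow_le_rpow_of_exponent_le (by linarith : 1 ≤ 2 * thetaWeight w) hκ
  by_cases hc : phaseWeight p ^ δ * ‖w.2‖ ≤ phaseWeight p / 2
  · nlinarith
  · push Not at hc
    have hw : phaseWeight p ^ (1 - δ) ≤ 2 * thetaWeight w := by
      rw [Real.rpow_sub (by linarith), Real.rpow_one, div_le_iff₀ (by positivity)]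
      simp only [thetaWeight]
      nlinarith
    have h7 : phaseWeight p ≤ (2 * thetaWeight w) ^ (1 / (1 - δ)) := by
      have := Real.rpow_le_rpow (by positivity) hw (by positivity : 0 ≤ 1 / (1 - δ))
      rwa [← Real.rpow_mul (by linarith), mul_one_div_cancel (by linarith), Real.rpow_one] at this
    nlinarith

end Weights

/-- The scaled amplitudes `(1 + |ξ| + |η|)^{-m} τ(p + (λ^{-δ} z, t λ^δ θ, 0))`. -/
def scaledAmp (m δ t : ℝ) (p : Phase n) (τ : Symb n) : OscSpace n → ℂ :=
  (((phaseWeight p ^ (-m) : ℝ)) : ℂ) •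
    fun w => τ (p + scaleMap (phaseWeight p ^ (-δ)) (t * phaseWeight p ^ δ) w)

/-- Let λ and μ be the phase weights at the base point and at the shifted point, and Θ = 1+|θ|. A
z-derivative produces λ^{-δ} μ^δ ≤ Θ^δ. A θ-derivative produces t λ^δ μ^{-ρ} ≤ (λ/μ)^δ ≤
(2Θ)^{δ/(1-δ)}, by t ≤ 1, δ ≤ ρ and μ ≥ 1. The prefactor λ^{-m} μ^m is at most (2Θ)^{|m|/(1-δ)}.
None of these bounds depends on t or on the base point. -/
theorem symbolClass_scaledAmp {ι : Type*} {m ρ δ : ℝ} (hδ : 0 ≤ δ) (hδ1 : δ < 1) (hδρ : δ ≤ ρ)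
    {τ : ι → Symb n} (hτ : BSFamily m ρ δ τ) :
    SymbolClass oscDir (oscCost δ (δ / (1 - δ))) thetaWeight
      (fun w => thetaWeight w ^ (|m| / (1 - δ)))
      (fun i : ι × Set.Icc (0 : ℝ) 1 × Phase n => scaledAmp m δ i.2.1 i.2.2 (τ i.1)) := by
  have hcomp : ∀ i : ι × Set.Icc (0 : ℝ) 1 × Phase n, ContDiff ℝ ∞ fun w =>
      τ i.1 (i.2.2 + scaleMap (phaseWeight i.2.2 ^ (-δ)) (i.2.1 * phaseWeight i.2.2 ^ δ) w) :=
    fun i => (hτ.smooth _).comp (contDiff_const.add (scaleMap _ _).contDiff)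
  refine ⟨fun i => contDiff_pi_smul (hcomp i) _, fun l => ?_⟩
  obtain ⟨C, h0, hC⟩ := hτ.bound
    (l.map fun d => bif d.1 then Sum.inr (Sum.inl d.2) else Sum.inl d.2)
  -- The first power of 2 comes from the prefactor λ^{-m} μ^m, the second from the derivatives, one
  -- factor 2^{δ/(1-δ)} for each.
  refine ⟨C * (2 ^ (|m| / (1 - δ)) * (2 ^ (δ / (1 - δ))) ^ l.length), by positivity, ?_⟩
  rintro ⟨i, ⟨t, ht0, ht1⟩, p⟩ w
  have hone := one_le_phaseWeight p
  set lam := phaseWeight p with hlam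
  have hlam0 : 0 < lam := by linarith
  rw [scaledAmp, iterDeriv_smul (hcomp ⟨i, ⟨t, ht0, ht1⟩, p⟩),
    iterDeriv_comp_affine (scaleMap_oscDir (lam ^ (-δ)) (t * lam ^ δ)) p (hτ.smooth i)]
  set μ := phaseWeight (p + scaleMap (lam ^ (-δ)) (t * lam ^ δ) w) with hμ
  have hμ1 : 1 ≤ μ := one_le_phaseWeight _
  have hμ0 : 0 < μ := by linarith
  have hΘ1 := one_le_thetaWeight w
  set Θ := thetaWeight w with hΘ
  have hΘ0 : 0 < Θ := by linarith
  have u1 : μ ≤ lam * Θ := phaseWeight_add_scaleMap_le hδ1 ht0 ht1 p w _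
  have u2 : lam ≤ μ * (2 * Θ) ^ (1 / (1 - δ)) :=
    phaseWeight_le_add_scaleMap hδ hδ1 ht0 ht1 p w _
  have hδ' : 0 < 1 - δ := by linarith
  have u3 : lam / μ ≤ (2 * Θ) ^ (1 / (1 - δ)) := by
    rw [div_le_iff₀ hμ0]; linarith
  have u4 : μ / lam ≤ (2 * Θ) ^ (1 / (1 - δ)) := by
    rw [div_le_iff₀ hlam0]
    have hκ : 1 ≤ 1 / (1 - δ) := by rw [le_div_iff₀ hδ']; linarith
    have hb : 2 * Θ ≤ (2 * Θ) ^ (1 / (1 - δ)) := by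
      simpa using Real.rpow_le_rpow_of_exponent_le (by linarith : 1 ≤ 2 * Θ) hκ
    nlinarith
  have v1 : lam ^ (-m) * μ ^ m ≤ 2 ^ (|m| / (1 - δ)) * Θ ^ (|m| / (1 - δ)) := by
    rw [← Real.mul_rpow zero_le_two hΘ0.le]
    have e1 : (2 * Θ) ^ (|m| / (1 - δ)) = ((2 * Θ) ^ (1 / (1 - δ))) ^ |m| := by
      rw [← Real.rpow_mul (by positivity)]
      ring_nf
    rw [e1]
    rcases le_total 0 m with hm | hm
    · rw [abs_of_nonneg hm, Real.rpow_neg hlam0.le, ← div_eq_inv_mul,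
        ← Real.div_rpow hμ0.le hlam0.le]
      exact Real.rpow_le_rpow (by positivity) u4 hm
    · have : μ ^ m = (μ ^ (-m))⁻¹ := by rw [← Real.rpow_neg hμ0.le, neg_neg]
      rw [abs_of_nonpos hm, this, ← div_eq_mul_inv, ← Real.div_rpow hlam0.le hμ0.le]
      exact Real.rpow_le_rpow (by positivity) u3 (by linarith)
  have v2 : ∀ l : List (Bool × Fin n),
      ‖((l.map fun d => bif d.1 then t * lam ^ δ else lam ^ (-δ)).prod : ℂ)‖ *
        μ ^ cost (phaseCost ρ δ)
          (l.map fun d => (bif d.1 then Sum.inr (Sum.inl d.2) else Sum.inl d.2 :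
            Fin n ⊕ Fin n ⊕ Fin n)) ≤
      (2 ^ (δ / (1 - δ))) ^ l.length * Θ ^ cost (oscCost δ (δ / (1 - δ))) l := by
    intro l
    induction l with
    | nil => simp
    | cons d l ih =>
      have hd : ‖(((bif d.1 then t * lam ^ δ else lam ^ (-δ) : ℝ)) : ℂ)‖ *
          μ ^ phaseCost ρ δ (bif d.1 then Sum.inr (Sum.inl d.2) else Sum.inl d.2 :
            Fin n ⊕ Fin n ⊕ Fin n) ≤
          2 ^ (δ / (1 - δ)) * Θ ^ oscCost δ (δ / (1 - δ)) d := by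
        obtain ⟨b, j⟩ := d
        cases b
        · simp only [cond_false, phaseCost, Sum.elim_inl, oscCost]
          rw [Complex.norm_real, Real.norm_of_nonneg (by positivity), Real.rpow_neg hlam0.le,
            ← div_eq_inv_mul, ← Real.div_rpow hμ0.le hlam0.le]
          have h1 : (μ / lam) ^ δ ≤ Θ ^ δ :=
            Real.rpow_le_rpow (by positivity) (by rw [div_le_iff₀ hlam0]; linarith) hδ
          have h2 : (1 : ℝ) ≤ 2 ^ (δ / (1 - δ)) :=
            Real.one_le_rpow one_le_two (by positivity)
          have h3 : 0 ≤ Θ ^ δ := by positivity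
          nlinarith
        · simp only [cond_true, phaseCost, Sum.elim_inl, Sum.elim_inr, oscCost]
          rw [Complex.norm_real, Real.norm_of_nonneg (by positivity)]
          rw [← Real.mul_rpow zero_le_two hΘ0.le]
          have e1 : (2 * Θ) ^ (δ / (1 - δ)) = ((2 * Θ) ^ (1 / (1 - δ))) ^ δ := by
            rw [← Real.rpow_mul (by positivity)]
            ring_nf
          rw [e1]
          have h1 : (lam / μ) ^ δ ≤ ((2 * Θ) ^ (1 / (1 - δ))) ^ δ :=
            Real.rpow_le_rpow (by positivity) u3 hδ
          refine le_trans ?_ h1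
          rw [Real.div_rpow hlam0.le hμ0.le, div_eq_mul_inv, ← Real.rpow_neg hμ0.le]
          have h2 : μ ^ (-ρ) ≤ μ ^ (-δ) := Real.rpow_le_rpow_of_exponent_le hμ1 (by linarith)
          have h3 : t * lam ^ δ ≤ lam ^ δ := mul_le_of_le_one_left (by positivity) ht1
          gcongr
      simp only [List.map_cons, List.prod_cons, cost_cons, List.length_cons]
      rw [Real.rpow_add hμ0, Real.rpow_add hΘ0, pow_succ, Complex.ofReal_mul, norm_mul]
      calc _ = (‖(((bif d.1 then t * lam ^ δ else lam ^ (-δ) : ℝ)) : ℂ)‖ *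
          μ ^ phaseCost ρ δ (bif d.1 then Sum.inr (Sum.inl d.2) else Sum.inl d.2 :
            Fin n ⊕ Fin n ⊕ Fin n)) * _ := by
            rw [mul_mul_mul_comm]
        _ ≤ (2 ^ (δ / (1 - δ)) * Θ ^ oscCost δ (δ / (1 - δ)) d) * _ :=
            mul_le_mul hd ih (by positivity) (by positivity)
        _ = _ := by ring
  have hCi := hC i (p + scaleMap (lam ^ (-δ)) (t * lam ^ δ) w)
  rw [Pi.smul_apply, norm_smul, norm_mul, Complex.norm_real,
    Real.norm_of_nonneg (by positivity : 0 ≤ lam ^ (-m))]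
  refine (mul_le_mul_of_nonneg_left (mul_le_mul_of_nonneg_left hCi (norm_nonneg _))
    (by positivity)).trans ?_
  rw [← hμ]
  calc _ = C * ((lam ^ (-m) * μ ^ m) * (‖((l.map fun d => bif d.1 then t * lam ^ δ
            else lam ^ (-δ)).prod : ℂ)‖ * μ ^ cost (phaseCost ρ δ)
          (l.map fun d => (bif d.1 then Sum.inr (Sum.inl d.2) else Sum.inl d.2 :
            Fin n ⊕ Fin n ⊕ Fin n)))) := by ring
    _ ≤ C * ((2 ^ (|m| / (1 - δ)) * Θ ^ (|m| / (1 - δ))) *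
        ((2 ^ (δ / (1 - δ))) ^ l.length * Θ ^ cost (oscCost δ (δ / (1 - δ))) l)) := by
        refine mul_le_mul_of_nonneg_left ?_ h0
        exact mul_le_mul v1 (v2 l) (by positivity) (by positivity)
    _ = _ := by ring

end BSClass

open FourierTransform

/-! ### Fourier inversion in the normalization (2π)⁻ⁿ -/

section Fourier

variable {n : ℕ}

theorem fourierHat_eq (f : SchwartzMap (E n) ℂ) (ξ : E n) :
    fourierHat f ξ = (((2 * Real.pi) ^ n : ℝ) : ℂ)⁻¹ * (𝓕 f) ((2 * Real.pi)⁻¹ • ξ) := by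
  rw [fourierHat, SchwartzMap.fourier_coe, Real.fourier_eq']
  congr 2
  ext x
  rw [smul_eq_mul, mul_comm]
  congr 2
  rw [inner_smul_right]
  push_cast
  field_simp

theorem integral_comp_two_pi_smul (F : E n → ℂ) :
    ∫ x, F ((2 * Real.pi)⁻¹ • x) = (((2 * Real.pi) ^ n : ℝ) : ℂ) * ∫ x, F x := by
  rw [Measure.integral_comp_smul, finrank_euclideanSpace_fin, inv_pow, inv_inv,
    abs_of_pos (by positivity), Complex.real_smul]

theorem two_pi_pow_ne_zero : (((2 * Real.pi) ^ n : ℝ) : ℂ) ≠ 0 := by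
  have : ((2 * Real.pi) ^ n : ℝ) ≠ 0 := by positivity
  exact_mod_cast this

/-- Fourier inversion: the Jacobian (2π)ⁿ of the change of variable by 2π cancels the factor in
`fourierHat`. -/
theorem integral_fourierHat_mul_cexp (h : SchwartzMap (E n) ℂ) (x : E n) :
    ∫ ζ, fourierHat h ζ * Complex.exp (Complex.I * ((inner ℝ x ζ : ℝ) : ℂ)) = h x := by
  obtain ⟨G, hG⟩ : ∃ G : E n → ℂ, G = fun w => Complex.exp
    (((2 * Real.pi * (inner ℝ w x : ℝ) : ℝ) : ℂ) * Complex.I) • (𝓕 h : SchwartzMap (E n) ℂ) w :=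
    ⟨_, rfl⟩
  have h1 : ∀ ζ : E n, fourierHat h ζ * Complex.exp (Complex.I * ((inner ℝ x ζ : ℝ) : ℂ)) =
      (((2 * Real.pi) ^ n : ℝ) : ℂ)⁻¹ * G ((2 * Real.pi)⁻¹ • ζ) := by
    intro ζ
    rw [fourierHat_eq, hG]
    beta_reduce
    rw [smul_eq_mul, mul_comm (Complex.exp _), ← mul_assoc, real_inner_smul_left,
      real_inner_comm]
    congr 2
    push_cast
    field_simp
  simp_rw [h1]
  rw [integral_const_mul, integral_comp_two_pi_smul, inv_mul_cancel_left₀ two_pi_pow_ne_zero, hG,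
    ← Real.fourierInv_eq' (𝓕 h : SchwartzMap (E n) ℂ) x, ← SchwartzMap.fourierInv_coe,
    FourierPair.fourierInv_fourier_eq]

/-- The rescaling of a Schwartz function. -/
def schwartzScale (a : ℝ) (ha : a ≠ 0) (f : SchwartzMap (E n) ℂ) : SchwartzMap (E n) ℂ :=
  SchwartzMap.compCLMOfContinuousLinearEquiv ℂ
    (ContinuousLinearEquiv.smulLeft (R₁ := ℝ) (M₁ := E n) (Units.mk0 a ha)) f

theorem schwartzScale_apply (a : ℝ) (ha : a ≠ 0) (f : SchwartzMap (E n) ℂ) (x : E n) :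
    schwartzScale a ha f x = f (a • x) := rfl

/-- The Fourier transform as a Schwartz function. -/
def schwartzHat (f : SchwartzMap (E n) ℂ) : SchwartzMap (E n) ℂ :=
  (((2 * Real.pi) ^ n : ℝ) : ℂ)⁻¹ • schwartzScale (2 * Real.pi)⁻¹ (by positivity) (𝓕 f)

@[simp] theorem schwartzHat_apply (f : SchwartzMap (E n) ℂ) (ξ : E n) :
    schwartzHat f ξ = fourierHat f ξ := by
  rw [fourierHat_eq]
  rfl

theorem exists_schwartzHat_eq (H : SchwartzMap (E n) ℂ) : ∃ h, schwartzHat h = H := by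
  refine ⟨𝓕⁻ ((((2 * Real.pi) ^ n : ℝ) : ℂ) • schwartzScale (2 * Real.pi) (by positivity) H), ?_⟩
  ext ξ
  rw [schwartzHat, FourierInvPair.fourier_fourierInv_eq, smul_apply,
    schwartzScale_apply, smul_apply, schwartzScale_apply, smul_smul,
    smul_inv_smul₀ (by positivity), inv_mul_cancel₀ two_pi_pow_ne_zero, one_smul]

end Fourier

/-! ### The operator exp(-i t ∂_x·∂_ξ) as an iterated integral -/

section Slices

variable {n : ℕ}

/-- The partial Fourier integral `∫ e^{-i z·θ} τ(p + (z, tθ, 0)) dz`. -/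
def sliceFT (t : ℝ) (τ : Symb n) (p : Phase n) (θ : E n) : ℂ :=
  ∫ z : E n, Complex.exp (-Complex.I * ((inner ℝ z θ : ℝ) : ℂ)) * τ (p + scaleMap 1 t (z, θ))

/-- The operator `exp (-i t ∂_x · ∂_ξ)` on compactly supported symbols, as the oscillatory integral
`(2π)⁻ⁿ ∫∫ e^{-i z·θ} τ(p + (z, tθ, 0)) dz dθ`. -/
def oscOp (t : ℝ) (τ : Symb n) (p : Phase n) : ℂ :=
  (((2 * Real.pi) ^ n : ℝ) : ℂ)⁻¹ * ∫ θ : E n, sliceFT t τ p θ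

/-- At t = 0 the symbol is not shifted in ξ, and this is Fourier inversion at the origin for z ↦
τ(p+(z,0,0)). The joint integrand then has no decay in θ, so the integral must be iterated, with z
first. -/
theorem oscOp_zero {τ : Symb n} (hτ : ContDiff ℝ ∞ τ) (hc : HasCompactSupport τ) (p : Phase n) :
    oscOp 0 τ p = τ p := by
  have hemb : IsClosedEmbedding fun z : E n => p + ((z, 0, 0) : Phase n) :=
    (Homeomorph.addLeft p).isClosedEmbedding.comp
      ((LinearMap.inl ℝ (E n) (E n × E n)).isClosedEmbedding_of_injective
        (LinearMap.ker_eq_bot.2 LinearMap.inl_injective))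
  have hs : ContDiff ℝ ∞ fun z : E n => τ (p + ((z, 0, 0) : Phase n)) :=
    hτ.comp (contDiff_const.add (contDiff_id.prodMk contDiff_const))
  let f : SchwartzMap (E n) ℂ := (hc.comp_isClosedEmbedding hemb).toSchwartzMap hs
  have hf : ∀ z, f z = τ (p + ((z, 0, 0) : Phase n)) := fun z => rfl
  have h1 : ∀ θ, sliceFT 0 τ p θ = (((2 * Real.pi) ^ n : ℝ) : ℂ) * (fourierHat f θ *
      Complex.exp (Complex.I * ((inner ℝ (0 : E n) θ : ℝ) : ℂ))) := by
    intro θ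
    rw [fourierHat, inner_zero_left, Complex.ofReal_zero, mul_zero, Complex.exp_zero, mul_one,
      mul_inv_cancel_left₀ two_pi_pow_ne_zero, sliceFT]
    congr 1
    ext z
    simp [hf, mul_comm]
  rw [oscOp]
  simp_rw [h1]
  rw [integral_const_mul, inv_mul_cancel_left₀ two_pi_pow_ne_zero, integral_fourierHat_mul_cexp,
    hf]
  congr 1
  ext <;> simp

theorem exists_support_bound {V : Type*} [NormedAddCommGroup V] {τ : V → ℂ}
    (hτ : Continuous τ) (hc : HasCompactSupport τ) :
    ∃ R M : ℝ, 0 ≤ R ∧ 0 ≤ M ∧ (∀ p, ‖τ p‖ ≤ M) ∧ ∀ p, R < ‖p‖ → τ p = 0 := by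
  obtain ⟨M, hM⟩ := hτ.bounded_above_of_compact_support hc
  obtain ⟨R, hR⟩ := hc.isBounded.subset_closedBall 0
  refine ⟨max R 0, max M 0, le_max_right _ _, le_max_right _ _,
    fun p => (hM p).trans (le_max_left _ _), fun p hp => ?_⟩
  by_contra h
  have := hR (subset_tsupport _ (Function.mem_support.2 h))
  rw [mem_closedBall_zero_iff] at this
  exact absurd ((le_max_left R 0).trans_lt hp) (by linarith)

theorem norm_fst_le_add_scaleMap (a b : ℝ) (p : Phase n) (w : OscSpace n) :
    |a| * ‖w.1‖ ≤ ‖p + scaleMap a b w‖ + ‖p‖ := by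
  have h1 : ‖p.1 + a • w.1‖ ≤ ‖p + scaleMap a b w‖ := norm_fst_le (p + scaleMap a b w)
  have h2 : ‖p.1‖ ≤ ‖p‖ := norm_fst_le p
  have h3 := norm_sub_le (p.1 + a • w.1) p.1
  rw [add_sub_cancel_left, norm_smul, Real.norm_eq_abs] at h3
  linarith

theorem norm_snd_le_add_scaleMap (a b : ℝ) (p : Phase n) (w : OscSpace n) :
    |b| * ‖w.2‖ ≤ ‖p + scaleMap a b w‖ + ‖p‖ := by
  have h1 : ‖p.2.1 + b • w.2‖ ≤ ‖p + scaleMap a b w‖ :=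
    (norm_fst_le (p + scaleMap a b w).2).trans (norm_snd_le (p + scaleMap a b w))
  have h2 : ‖p.2.1‖ ≤ ‖p‖ := (norm_fst_le p.2).trans (norm_snd_le p)
  have h3 := norm_sub_le (p.2.1 + b • w.2) p.2.1
  rw [add_sub_cancel_left, norm_smul, Real.norm_eq_abs] at h3
  linarith

/-- The majorant depends neither on t nor on θ, as differentiation in t under the integral requires.
-/
theorem norm_comp_scaleMap_le_indicator {τ : Symb n} {R M : ℝ} (hM : ∀ p, ‖τ p‖ ≤ M)
    (hR : ∀ p, R < ‖p‖ → τ p = 0) (t : ℝ) (p : Phase n) (z θ : E n) :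
    ‖τ (p + scaleMap 1 t (z, θ))‖ ≤
      (Metric.closedBall (0 : E n) (R + ‖p‖)).indicator (fun _ => M) z := by
  by_cases hz : z ∈ Metric.closedBall (0 : E n) (R + ‖p‖)
  · rw [Set.indicator_of_mem hz]
    exact hM _
  · rw [Set.indicator_of_notMem hz, hR, norm_zero]
    rw [mem_closedBall_zero_iff, not_le] at hz
    have := norm_fst_le_add_scaleMap 1 t p (z, θ)
    simp only [abs_one, one_mul] at this
    linarith

theorem integrable_indicator_closedBall (r M : ℝ) :
    Integrable ((Metric.closedBall (0 : E n) r).indicator (fun _ => M)) :=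
  (continuous_const.continuousOn.integrableOn_compact (isCompact_closedBall 0 r)).integrable_indicator
     Metric.isClosed_closedBall.measurableSet

end Slices

/-! ### The evolution equation in t -/

section SliceDerivatives

variable {n : ℕ}

/-- The operator `∂_x · ∂_ξ`. -/
def mixedLap (τ : Symb n) : Symb n :=
  ∑ j, derivAlong (dirX j) (derivAlong (dirXi j) τ)

theorem contDiff_mixedLap {τ : Symb n} (hτ : ContDiff ℝ ∞ τ) : ContDiff ℝ ∞ (mixedLap τ) :=
  contDiff_pi_sum _ fun _ _ => contDiff_derivAlong (contDiff_derivAlong hτ _) _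

theorem hasCompactSupport_finsetSum {V κ : Type*} [TopologicalSpace V] (s : Finset κ)
    {F : κ → V → ℂ} (hF : ∀ k ∈ s, HasCompactSupport (F k)) :
    HasCompactSupport (∑ k ∈ s, F k) := by
  classical
  induction s using Finset.induction_on with
  | empty => simpa using HasCompactSupport.zero
  | insert a s ha ih =>
    rw [Finset.sum_insert ha]
    exact (hF a (by simp)).add (ih fun k hk => hF k (by simp [hk]))

theorem hasCompactSupport_mixedLap {τ : Symb n} (hτ : HasCompactSupport τ) :
    HasCompactSupport (mixedLap τ) :=
  hasCompactSupport_finsetSum _ fun _ _ =>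
    hasCompactSupport_derivAlong (hasCompactSupport_derivAlong hτ _) _

variable {τ : Symb n}

theorem norm_cexp_mul_slice_le {R M : ℝ} (hM : ∀ p, ‖τ p‖ ≤ M)
    (hR : ∀ p, R < ‖p‖ → τ p = 0) (t : ℝ) (p : Phase n) (z θ : E n) :
    ‖Complex.exp (-Complex.I * ((inner ℝ z θ : ℝ) : ℂ)) * τ (p + scaleMap 1 t (z, θ))‖ ≤
      (Metric.closedBall (0 : E n) (R + ‖p‖)).indicator (fun _ => M) z := by
  rw [norm_mul, norm_cexp_neg_I, one_mul]
  exact norm_comp_scaleMap_le_indicator hM hR t p z θ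

theorem continuous_slice (hτ : Continuous τ) (t : ℝ) (p : Phase n) :
    Continuous fun w : E n × E n => Complex.exp (-Complex.I * ((inner ℝ w.2 w.1 : ℝ) : ℂ)) *
      τ (p + scaleMap 1 t (w.2, w.1)) :=
  Continuous.mul (by fun_prop) (hτ.comp (continuous_const.add
    ((scaleMap 1 t).continuous.comp (continuous_snd.prodMk continuous_fst))))

theorem integrable_slice (hτ : Continuous τ) (hc : HasCompactSupport τ) (t : ℝ) (p : Phase n)
    (θ : E n) :
    Integrable fun z => Complex.exp (-Complex.I * ((inner ℝ z θ : ℝ) : ℂ)) *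
      τ (p + scaleMap 1 t (z, θ)) := by
  obtain ⟨R, M, -, -, hM, hR⟩ := exists_support_bound hτ hc
  refine (integrable_indicator_closedBall (R + ‖p‖) M).mono'
    ((continuous_slice hτ t p).comp (Continuous.prodMk_right θ)).aestronglyMeasurable
    (Eventually.of_forall fun z => norm_cexp_mul_slice_le hM hR t p z θ)

theorem sliceFT_add {τ' : Symb n} (hτ : Continuous τ) (hc : HasCompactSupport τ)
    (hτ' : Continuous τ') (hc' : HasCompactSupport τ') (t : ℝ) (p : Phase n) (θ : E n) :
    sliceFT t (τ + τ') p θ = sliceFT t τ p θ + sliceFT t τ' p θ := by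
  simp only [sliceFT]
  rw [← integral_add (integrable_slice hτ hc t p θ) (integrable_slice hτ' hc' t p θ)]
  congr 1
  ext z
  simp [mul_add]

theorem sliceFT_smul (a : ℂ) (t : ℝ) (p : Phase n) (θ : E n) :
    sliceFT t (a • τ) p θ = a * sliceFT t τ p θ := by
  simp only [sliceFT]
  rw [← integral_const_mul]
  congr 1
  ext z
  simp
  ring

theorem sliceFT_sum {κ : Type*} (s : Finset κ) {F : κ → Symb n}
    (hF : ∀ k ∈ s, Continuous (F k)) (hc : ∀ k ∈ s, HasCompactSupport (F k)) (t : ℝ) (p : Phase n)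
    (θ : E n) : sliceFT t (∑ k ∈ s, F k) p θ = ∑ k ∈ s, sliceFT t (F k) p θ := by
  simp only [sliceFT]
  rw [← integral_finsetSum _ fun k hk => integrable_slice (hF k hk) (hc k hk) t p θ]
  congr 1
  ext z
  simp [Finset.mul_sum]

theorem sliceFT_derivAlong_dirX (hτ : ContDiff ℝ ∞ τ) (hc : HasCompactSupport τ) (t : ℝ)
    (p : Phase n) (θ : E n) (j : Fin n) :
    sliceFT t (derivAlong (dirX j) τ) p θ = Complex.I * θ j * sliceFT t τ p θ := by
  have hph : ContDiff ℝ ∞ fun z : E n => (inner ℝ z θ : ℝ) := contDiff_id.inner ℝ contDiff_const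
  have hemb : IsClosedEmbedding fun z : E n => p + scaleMap 1 t (z, θ) := by
    have : (fun z : E n => p + scaleMap 1 t (z, θ)) =
        fun z => (p + (0, t • θ, 0)) + LinearMap.inl ℝ (E n) (E n × E n) z := by
      ext z <;> simp
    rw [this]
    exact (Homeomorph.addLeft _).isClosedEmbedding.comp
      ((LinearMap.inl ℝ (E n) (E n × E n)).isClosedEmbedding_of_injective
        (LinearMap.ker_eq_bot.2 LinearMap.inl_injective))
  have hs : ContDiff ℝ ∞ fun z : E n => τ (p + scaleMap 1 t (z, θ)) :=
    hτ.comp (contDiff_const.add ((scaleMap 1 t).contDiff.comp (contDiff_id.prodMk contDiff_const)))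
  have h := integral_cexp_mul_derivAlong (volume : Measure (E n)) hph (EuclideanSpace.single j 1)
    hs (hc.comp_isClosedEmbedding hemb)
  have h1 : ∀ z : E n, fderiv ℝ (fun z : E n => (inner ℝ z θ : ℝ)) z (EuclideanSpace.single j 1) =
      θ j := by
    intro z
    have : HasFDerivAt (fun z : E n => (inner ℝ z θ : ℝ)) _ z :=
      (hasFDerivAt_id z).inner ℝ (hasFDerivAt_const θ z)
    rw [this.fderiv]
    simp [EuclideanSpace.inner_single_left]
  have h2 : ∀ z : E n, derivAlong (EuclideanSpace.single j 1)
      (fun z : E n => τ (p + scaleMap 1 t (z, θ))) z =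
      derivAlong (dirX j) τ (p + scaleMap 1 t (z, θ)) := by
    intro z
    have hd : HasFDerivAt (fun z : E n => p + scaleMap 1 t (z, θ)) _ z :=
      (((scaleMap 1 t).hasFDerivAt (x := (z, θ))).comp z
        ((hasFDerivAt_id (𝕜 := ℝ) z).prodMk (hasFDerivAt_const θ z))).const_add p
    have hd2 : HasFDerivAt (fun z : E n => τ (p + scaleMap 1 t (z, θ))) _ z :=
      ((hτ.differentiable (by simp) _).hasFDerivAt).comp z hd
    rw [derivAlong, derivAlong, hd2.fderiv]
    simp [dirX]
  simp_rw [h1, h2] at h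
  rw [sliceFT, sliceFT, h, ← integral_const_mul]
  congr 1
  ext z
  ring

/-- Partial Fourier integrals decay rapidly, uniformly in the parameter `t`. -/
theorem exists_sliceFT_decay (hτ : ContDiff ℝ ∞ τ) (hc : HasCompactSupport τ) (p : Phase n)
    (q : ℕ) : ∃ C : ℝ, ∀ t θ, (1 + ‖θ‖ ^ 2) ^ q * ‖sliceFT t τ p θ‖ ≤ C := by
  induction q generalizing τ with
  | zero =>
    obtain ⟨R, M, -, -, hM, hR⟩ := exists_support_bound hτ.continuous hc
    refine ⟨∫ z, (Metric.closedBall (0 : E n) (R + ‖p‖)).indicator (fun _ => M) z, fun t θ => ?_⟩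
    rw [pow_zero, one_mul]
    exact norm_integral_le_of_norm_le (integrable_indicator_closedBall _ _)
      (Eventually.of_forall fun z => norm_cexp_mul_slice_le hM hR t p z θ)
  | succ q ih =>
    have hs2 : ∀ j, ContDiff ℝ ∞ (derivAlong (dirX j) (derivAlong (dirX j) τ)) := fun j =>
      contDiff_derivAlong (contDiff_derivAlong hτ _) _
    have hc2 : ∀ j, HasCompactSupport (derivAlong (dirX j) (derivAlong (dirX j) τ)) := fun j =>
      hasCompactSupport_derivAlong (hasCompactSupport_derivAlong hc _) _
    have hss : ContDiff ℝ ∞ (∑ j, derivAlong (dirX j) (derivAlong (dirX j) τ)) :=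
      contDiff_pi_sum _ fun j _ => hs2 j
    have hcs : HasCompactSupport (∑ j, derivAlong (dirX j) (derivAlong (dirX j) τ)) :=
      hasCompactSupport_finsetSum _ fun j _ => hc2 j
    have hss' := contDiff_pi_smul hss (-1)
    have hcs' : HasCompactSupport ((-1 : ℂ) • ∑ j, derivAlong (dirX j) (derivAlong (dirX j) τ)) :=
      hcs.smul_left (f := fun _ => (-1 : ℂ))
    obtain ⟨C, hC⟩ := ih (τ := τ + (-1 : ℂ) • ∑ j, derivAlong (dirX j) (derivAlong (dirX j) τ))
      (hτ.add hss') (hc.add hcs')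
    refine ⟨C, fun t θ => ?_⟩
    -- Passing from τ to (1-Δ_x)τ multiplies the slice transform by 1+|θ|², so the induction
    -- hypothesis for (1-Δ_x)τ yields one more power.
    have key : sliceFT t (τ + (-1 : ℂ) • ∑ j, derivAlong (dirX j) (derivAlong (dirX j) τ)) p θ =
        ((1 + ‖θ‖ ^ 2 : ℝ) : ℂ) * sliceFT t τ p θ := by
      rw [sliceFT_add hτ.continuous hc hss'.continuous hcs', sliceFT_smul,
        sliceFT_sum _ (fun j _ => (hs2 j).continuous) fun j _ => hc2 j]
      simp_rw [fun j => sliceFT_derivAlong_dirX (contDiff_derivAlong hτ (dirX j))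
        (hasCompactSupport_derivAlong hc (dirX j)) t p θ j,
        fun j => sliceFT_derivAlong_dirX hτ hc t p θ j, ← mul_assoc]
      rw [← Finset.sum_mul, EuclideanSpace.norm_sq_eq]
      have : ∑ j, Complex.I * θ j * Complex.I * θ j = -((∑ j, ‖θ j‖ ^ 2 : ℝ) : ℂ) := by
        push_cast
        rw [← Finset.sum_neg_distrib]
        refine Finset.sum_congr rfl fun j _ => ?_
        rw [Real.norm_eq_abs, ← Complex.ofReal_pow, sq_abs, Complex.ofReal_pow]
        linear_combination (θ j : ℂ) ^ 2 * Complex.I_sq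
      rw [this]
      push_cast
      ring
    have := hC t θ
    rw [key, norm_mul, Complex.norm_real, Real.norm_of_nonneg (by positivity)] at this
    calc _ = _ := by ring
      _ ≤ C := this

theorem exists_integrable_sliceFT_bound (hτ : ContDiff ℝ ∞ τ) (hc : HasCompactSupport τ)
    (p : Phase n) : ∃ g : E n → ℝ, Integrable g ∧ ∀ t θ, ‖sliceFT t τ p θ‖ ≤ g θ := by
  obtain ⟨C, hC⟩ := exists_sliceFT_decay hτ hc p (n + 1)
  refine ⟨fun θ => (|C| * 2 ^ (n + 1)) * (1 + ‖θ‖) ^ (-(n + 1) : ℝ), ?_, fun t θ => ?_⟩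
  · exact (integrable_one_add_norm (by simp)).const_mul _
  · have h1 := (hC t θ).trans (le_abs_self C)
    have h2 : (1 + ‖θ‖) ≤ 2 * (1 + ‖θ‖ ^ 2) := by nlinarith [sq_nonneg (‖θ‖ - 1)]
    have h3 : (1 + ‖θ‖) ^ (n + 1) ≤ 2 ^ (n + 1) * (1 + ‖θ‖ ^ 2) ^ (n + 1) := by
      rw [← mul_pow]
      gcongr
    have h4 : (1 + ‖θ‖) ^ (-(n + 1) : ℝ) = ((1 + ‖θ‖) ^ (n + 1))⁻¹ := by
      rw [Real.rpow_neg (by positivity)]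
      norm_cast
    beta_reduce
    rw [h4, ← div_eq_mul_inv, le_div_iff₀ (by positivity)]
    have h5 := norm_nonneg (sliceFT t τ p θ)
    calc _ ≤ ‖sliceFT t τ p θ‖ * (2 ^ (n + 1) * (1 + ‖θ‖ ^ 2) ^ (n + 1)) := by gcongr
      _ = ((1 + ‖θ‖ ^ 2) ^ (n + 1) * ‖sliceFT t τ p θ‖) * 2 ^ (n + 1) := by ring
      _ ≤ _ := by gcongr

theorem aestronglyMeasurable_sliceFT (hτ : Continuous τ) (t : ℝ) (p : Phase n) :
    AEStronglyMeasurable (sliceFT t τ p) volume :=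
  (StronglyMeasurable.integral_prod_right (f := fun θ z : E n =>
    Complex.exp (-Complex.I * ((inner ℝ z θ : ℝ) : ℂ)) * τ (p + scaleMap 1 t (z, θ)))
    (continuous_slice hτ t p).stronglyMeasurable).aestronglyMeasurable

theorem integrable_sliceFT (hτ : ContDiff ℝ ∞ τ) (hc : HasCompactSupport τ) (t : ℝ)
    (p : Phase n) : Integrable (sliceFT t τ p) := by
  obtain ⟨g, hg, h⟩ := exists_integrable_sliceFT_bound hτ hc p
  exact hg.mono' (aestronglyMeasurable_sliceFT hτ.continuous t p)
    (Eventually.of_forall fun θ => h t θ)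

theorem sliceFT_mixedLap (hτ : ContDiff ℝ ∞ τ) (hc : HasCompactSupport τ) (t : ℝ) (p : Phase n)
    (θ : E n) : sliceFT t ((-Complex.I) • mixedLap τ) p θ =
      ∑ j, θ j * sliceFT t (derivAlong (dirXi j) τ) p θ := by
  rw [sliceFT_smul, mixedLap, sliceFT_sum _
    (fun j _ => (contDiff_derivAlong (contDiff_derivAlong hτ _) _).continuous) fun j _ =>
      hasCompactSupport_derivAlong (hasCompactSupport_derivAlong hc _) _, Finset.mul_sum]
  refine Finset.sum_congr rfl fun j _ => ?_
  rw [sliceFT_derivAlong_dirX (contDiff_derivAlong hτ _) (hasCompactSupport_derivAlong hc _)]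
  linear_combination -(θ j : ℂ) * sliceFT t (derivAlong (dirXi j) τ) p θ * Complex.I_sq

/-- Differentiating τ(p+(z,tθ,0)) in t produces θ·∂_ξ τ; inside the z-integral each θ_j is traded
for -i ∂_{x_j}. -/
theorem hasDerivAt_sliceFT (hτ : ContDiff ℝ ∞ τ) (hc : HasCompactSupport τ) (t : ℝ)
    (p : Phase n) (θ : E n) :
    HasDerivAt (fun t => sliceFT t τ p θ) (sliceFT t ((-Complex.I) • mixedLap τ) p θ) t := by
  have hdir : ∀ s z, HasDerivAt (fun s : ℝ => τ (p + scaleMap 1 s (z, θ)))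
      (∑ j, θ j * derivAlong (dirXi j) τ (p + scaleMap 1 s (z, θ))) s := by
    intro s z
    have h1 : HasDerivAt (fun s : ℝ => p + scaleMap 1 s (z, θ)) ((0, θ, 0) : Phase n) s := by
      have h2 : HasDerivAt (fun s : ℝ => s • ((0, θ, 0) : Phase n)) ((0, θ, 0) : Phase n) s := by
        simpa using (hasDerivAt_id s).smul_const ((0, θ, 0) : Phase n)
      have h3 : (fun s : ℝ => p + scaleMap 1 s (z, θ)) =
          fun s => (p + (z, 0, 0)) + s • ((0, θ, 0) : Phase n) := by
        ext s <;> simp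
      rw [h3]
      exact h2.const_add (p + (z, 0, 0))
    have h2 : HasDerivAt (fun s : ℝ => τ (p + scaleMap 1 s (z, θ))) _ s :=
      (hτ.differentiable (by simp) _).hasFDerivAt.comp_hasDerivAt s h1
    refine h2.congr_deriv ?_
    have h4 : ((0, θ, 0) : Phase n) = ∑ j, θ j • dirXi j := by
      have : θ = ∑ j, θ j • EuclideanSpace.single j (1 : ℝ) := by
        ext i
        simp [Finset.sum_apply, Pi.single_apply]
      ext1
      · simp [dirXi, Prod.fst_sum]
      · ext1
        · simpa [dirXi, Prod.fst_sum, Prod.snd_sum] using this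
        · simp [dirXi, Prod.snd_sum]
    rw [h4, map_sum]
    simp [derivAlong]
  have hsm : ∀ j, ContDiff ℝ ∞ (derivAlong (dirXi j) τ) := fun j => contDiff_derivAlong hτ _
  have hcm : ∀ j, HasCompactSupport (derivAlong (dirXi j) τ) := fun j =>
    hasCompactSupport_derivAlong hc _
  choose R M hR0 hM0 hM hR using fun j => exists_support_bound (hsm j).continuous (hcm j)
  have hmain := (hasDerivAt_integral_of_dominated_loc_of_deriv_le (μ := (volume : Measure (E n)))
    (F := fun s z => Complex.exp (-Complex.I * ((inner ℝ z θ : ℝ) : ℂ)) *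
      τ (p + scaleMap 1 s (z, θ))) (x₀ := t) (s := Set.univ)
    (F' := fun s z => Complex.exp (-Complex.I * ((inner ℝ z θ : ℝ) : ℂ)) *
      ∑ j, θ j * derivAlong (dirXi j) τ (p + scaleMap 1 s (z, θ)))
    (bound := fun z => ∑ j, |θ j| *
      (Metric.closedBall (0 : E n) (R j + ‖p‖)).indicator (fun _ => M j) z)
    Filter.univ_mem
    (Eventually.of_forall fun s => (integrable_slice hτ.continuous hc s p θ).aestronglyMeasurable)
    (integrable_slice hτ.continuous hc t p θ) ?_ ?_ ?_ ?_).2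
  · refine hmain.congr_deriv ?_
    rw [sliceFT_mixedLap hτ hc]
    simp only [sliceFT]
    simp_rw [← integral_const_mul]
    rw [← integral_finsetSum _ fun j _ =>
      (integrable_slice (hsm j).continuous (hcm j) t p θ).const_mul _]
    congr 1
    ext z
    rw [Finset.mul_sum]
    refine Finset.sum_congr rfl fun j _ => ?_
    ring
  · refine Continuous.aestronglyMeasurable ?_
    have := fun j => (hsm j).continuous
    fun_prop
  · refine Eventually.of_forall fun z s _ => ?_
    rw [norm_mul, norm_cexp_neg_I, one_mul]
    refine norm_sum_le_of_le _ fun j _ => ?_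
    rw [norm_mul, Complex.norm_real, Real.norm_eq_abs]
    exact mul_le_mul_of_nonneg_left (norm_comp_scaleMap_le_indicator (hM j) (hR j) s p z θ)
      (abs_nonneg _)
  · exact integrable_finsetSum _ fun j _ => (integrable_indicator_closedBall _ _).const_mul _
  · exact Eventually.of_forall fun z s _ => (hdir s z).const_mul _

/-- This is the equation d/dt e^{tA} = e^{tA} A with A = -i ∂_x·∂_ξ. The slice transforms of Aτ have
an integrable majorant in θ that is independent of t. -/
theorem hasDerivAt_oscOp (hτ : ContDiff ℝ ∞ τ) (hc : HasCompactSupport τ) (t : ℝ)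
    (p : Phase n) :
    HasDerivAt (fun t => oscOp t τ p) (oscOp t ((-Complex.I) • mixedLap τ) p) t := by
  have hs := contDiff_pi_smul (contDiff_mixedLap hτ) (-Complex.I)
  have hcs : HasCompactSupport ((-Complex.I) • mixedLap τ) :=
    (hasCompactSupport_mixedLap hc).smul_left (f := fun _ => -Complex.I)
  obtain ⟨g, hg, h⟩ := exists_integrable_sliceFT_bound hs hcs p
  refine HasDerivAt.const_mul _ ?_
  exact (hasDerivAt_integral_of_dominated_loc_of_deriv_le (s := Set.univ) Filter.univ_mem
    (Eventually.of_forall fun s => aestronglyMeasurable_sliceFT hτ.continuous s p)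
    (integrable_sliceFT hτ hc t p) (aestronglyMeasurable_sliceFT hs.continuous t p)
    (Eventually.of_forall fun θ s _ => h s θ) hg
    (Eventually.of_forall fun θ s _ => hasDerivAt_sliceFT hτ hc s p θ)).2

end SliceDerivatives

/-! ### Uniform bounds and Taylor expansion in t -/

section OscOp

variable {n : ℕ} {ι : Type*} {m ρ δ : ℝ}

theorem hasCompactSupport_comp_scaleMap {τ : Symb n} (hτ : Continuous τ)
    (hc : HasCompactSupport τ) {a b : ℝ} (ha : 0 < a) (hb : 0 < b) (p : Phase n) :
    HasCompactSupport fun w => τ (p + scaleMap a b w) := by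
  obtain ⟨R, M, -, -, -, hR⟩ := exists_support_bound hτ hc
  refine HasCompactSupport.intro (isCompact_closedBall (0 : OscSpace n)
    (max ((R + ‖p‖) / a) ((R + ‖p‖) / b))) fun w hw => hR _ ?_
  rw [mem_closedBall_zero_iff, not_le] at hw
  replace hw := hw.trans_eq (Prod.norm_def w)
  have h1 := norm_fst_le_add_scaleMap a b p w
  have h2 := norm_snd_le_add_scaleMap a b p w
  rw [abs_of_pos ha] at h1
  rw [abs_of_pos hb] at h2
  rcases lt_max_iff.1 hw with h | h
  · have := (le_max_left _ _).trans_lt h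
    rw [div_lt_iff₀ ha] at this
    linarith
  · have := (le_max_right _ _).trans_lt h
    rw [div_lt_iff₀ hb] at this
    linarith

/-- For t > 0 the joint integrand has compact support, so Fubini applies. The phase is invariant
under z → s z, θ → s⁻¹ θ, and the two Jacobians cancel; s is later taken to be λ^{-δ}. -/
theorem oscOp_eq_integral_scaleMap {τ : Symb n} (hτ : Continuous τ) (hc : HasCompactSupport τ)
    {t s : ℝ} (ht : 0 < t) (hs : 0 < s) (p : Phase n) :
    oscOp t τ p = (((2 * Real.pi) ^ n : ℝ) : ℂ)⁻¹ *
      ∫ w, oscFactor w * τ (p + scaleMap s (t * s⁻¹) w) := by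
  have hint : Integrable fun w : OscSpace n => oscFactor w * τ (p + scaleMap s (t * s⁻¹) w) :=
    (continuous_oscFactor.mul (hτ.comp (continuous_const.add
      (scaleMap s (t * s⁻¹)).continuous))).integrable_of_hasCompactSupport
      (hasCompactSupport_comp_scaleMap hτ hc hs (by positivity) p).mul_left
  rw [oscOp, Measure.volume_eq_prod, integral_prod_symm _ hint]
  congr 1
  have h1 : ∀ θ : E n, ∫ z : E n, oscFactor (z, θ) * τ (p + scaleMap s (t * s⁻¹) (z, θ)) =
      ((s ^ n)⁻¹ : ℝ) • sliceFT t τ p (s⁻¹ • θ) := by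
    intro θ
    have h2 : ∀ z : E n, oscFactor (z, θ) * τ (p + scaleMap s (t * s⁻¹) (z, θ)) =
        (fun z : E n => Complex.exp (-Complex.I * ((inner ℝ z (s⁻¹ • θ) : ℝ) : ℂ)) *
          τ (p + scaleMap 1 t (z, s⁻¹ • θ))) (s • z) := by
      intro z
      simp [oscFactor, oscPhase, real_inner_smul_left, real_inner_smul_right, smul_smul, hs.ne']
    refine (integral_congr_ae (Eventually.of_forall h2)).trans ?_
    have h3 := Measure.integral_comp_smul_of_nonneg (volume : Measure (E n))
      (fun z : E n => Complex.exp (-Complex.I * ((inner ℝ z (s⁻¹ • θ) : ℝ) : ℂ)) *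
        τ (p + scaleMap 1 t (z, s⁻¹ • θ))) s (hR := hs.le)
    rw [finrank_euclideanSpace_fin] at h3
    exact h3
  simp_rw [h1]
  rw [integral_smul, Measure.integral_comp_inv_smul_of_nonneg _ _ hs.le,
    finrank_euclideanSpace_fin, smul_smul, inv_mul_cancel₀ (by positivity), one_smul]

theorem oscOp_eq_integral_scaledAmp {τ : Symb n} (hτ : Continuous τ) (hc : HasCompactSupport τ)
    (m δ : ℝ) {t : ℝ} (ht : 0 < t) (p : Phase n) :
    oscOp t τ p = (((2 * Real.pi) ^ n : ℝ) : ℂ)⁻¹ * ((phaseWeight p ^ m : ℝ) : ℂ) *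
      ∫ w, oscFactor w * scaledAmp m δ t p τ w := by
  have hp := phaseWeight_pos p
  rw [oscOp_eq_integral_scaleMap hτ hc ht (Real.rpow_pos_of_pos hp (-δ)), mul_assoc]
  congr 1
  rw [← integral_const_mul]
  congr 1
  ext w
  rw [← Real.rpow_neg hp.le, neg_neg, scaledAmp, Pi.smul_apply, smul_eq_mul,
    mul_left_comm (oscFactor w), ← mul_assoc, ← Complex.ofReal_mul, ← Real.rpow_add hp]
  simp

theorem hasCompactSupport_scaledAmp {τ : Symb n} (hτ : Continuous τ) (hc : HasCompactSupport τ)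
    (m δ : ℝ) {t : ℝ} (ht : 0 < t) (p : Phase n) : HasCompactSupport (scaledAmp m δ t p τ) := by
  have hp := phaseWeight_pos p
  exact (hasCompactSupport_comp_scaleMap hτ hc (Real.rpow_pos_of_pos hp _)
    (mul_pos ht (Real.rpow_pos_of_pos hp _)) p).mul_left
    (f := fun _ => ((phaseWeight p ^ (-m) : ℝ) : ℂ))

/-- The operators `exp (-i t ∂_x · ∂_ξ)`, `0 ≤ t ≤ 1`, are uniformly bounded on `BS^m_{ρ,δ}`. -/
theorem exists_norm_oscOp_le (hδ : 0 ≤ δ) (hδ1 : δ < 1) (hδρ : δ ≤ ρ) {τ : ι → Symb n}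
    (hτ : BSFamily m ρ δ τ) (hc : ∀ i, HasCompactSupport (τ i)) :
    ∃ C : ℝ, 0 ≤ C ∧ ∀ i, ∀ t ∈ Set.Icc (0 : ℝ) 1, ∀ p,
      ‖oscOp t (τ i) p‖ ≤ C * phaseWeight p ^ m := by
  have h1 := symbolClass_scaledAmp hδ hδ1 hδρ hτ
  -- Only t > 0 is kept, because the scaled amplitude need not have compact support at t = 0. That
  -- case is settled separately by `oscOp_zero`.
  have h2 := h1.reindex (fun i : {i : ι × Set.Icc (0 : ℝ) 1 × Phase n // 0 < (i.2.1 : ℝ)} => i.1)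
  obtain ⟨C, hC0, hC⟩ := exists_norm_integral_oscFactor_le hδ hδ1
    (div_nonneg hδ (by linarith)) (fun i => hasCompactSupport_scaledAmp
      (hτ.smooth _).continuous (hc _) m δ i.2 _) h2
  obtain ⟨C', hC0', hC'⟩ := hτ.norm_le
  refine ⟨max (((2 * Real.pi) ^ n)⁻¹ * C) C', by positivity, fun i t ht p => ?_⟩
  have hp := phaseWeight_pos p
  rcases ht.1.eq_or_lt with h0 | h0
  · rw [← h0, oscOp_zero (hτ.smooth i) (hc i)]
    refine (hC' i p).trans ?_
    gcongr
    exact le_max_right _ _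
  · rw [oscOp_eq_integral_scaledAmp (hτ.smooth i).continuous (hc i) m δ h0, norm_mul, norm_mul,
      norm_inv, Complex.norm_real, Complex.norm_real, Real.norm_of_nonneg (by positivity),
      Real.norm_of_nonneg (by positivity)]
    have := hC ⟨⟨i, ⟨t, ht⟩, p⟩, h0⟩
    calc _ ≤ ((2 * Real.pi) ^ n)⁻¹ * phaseWeight p ^ m * C := by gcongr
      _ = (((2 * Real.pi) ^ n)⁻¹ * C) * phaseWeight p ^ m := by ring
      _ ≤ _ := by
        gcongr
        exact le_max_left _ _

/-- The derivative of the remainder of order N+1 is the remainder of order N of the shifted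
sequence, and the mean value inequality on [0,1] preserves the bound C. The factor 1/N! is not
needed. -/
theorem norm_sub_taylor_le {h : ℕ → ℝ → ℂ} (hd : ∀ j t, HasDerivAt (h j) (h (j + 1) t) t)
    (N : ℕ) {C : ℝ} (hC : ∀ t ∈ Set.Icc (0 : ℝ) 1, ‖h N t‖ ≤ C) :
    ∀ t ∈ Set.Icc (0 : ℝ) 1,
      ‖h 0 t - ∑ j ∈ Finset.range N, (t ^ j / j.factorial : ℝ) * h j 0‖ ≤ C := by
  induction N generalizing h with
  | zero => simpa using hC
  | succ N ih =>
    have ih' := ih (h := fun j => h (j + 1)) (fun j t => hd (j + 1) t) hC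
    have hC0 : 0 ≤ C := (norm_nonneg _).trans (hC 0 (by simp))
    set f : ℝ → ℂ := fun t => h 0 t -
      ∑ j ∈ Finset.range (N + 1), (t ^ j / j.factorial : ℝ) * h j 0 with hf
    have hf0 : f 0 = 0 := by
      simp only [hf]
      rw [Finset.sum_range_succ']
      simp
    have hfd : ∀ t, HasDerivAt f (h 1 t -
        ∑ j ∈ Finset.range N, (t ^ j / j.factorial : ℝ) * h (j + 1) 0) t := by
      intro t
      have hpow : ∀ j : ℕ, HasDerivAt (fun t : ℝ => ((t ^ (j + 1) / (j + 1).factorial : ℝ) : ℂ))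
          (((t ^ j / j.factorial : ℝ)) : ℂ) t := by
        intro j
        refine HasDerivAt.ofReal_comp ?_
        refine ((hasDerivAt_pow (j + 1) t).div_const _).congr_deriv ?_
        rw [Nat.factorial_succ]
        push_cast
        have : ((j : ℝ) + 1) ≠ 0 := by positivity
        have : (j.factorial : ℝ) ≠ 0 := by positivity
        field_simp
      have hfe : f = fun t => h 0 t - (∑ j ∈ Finset.range N,
          ((t ^ (j + 1) / (j + 1).factorial : ℝ) : ℂ) * h (j + 1) 0 + h 0 0) := by
        ext t
        simp only [hf]
        rw [Finset.sum_range_succ']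
        simp
      rw [hfe]
      refine (hd 0 t).sub (HasDerivAt.add_const _ ?_)
      exact HasDerivAt.fun_sum fun j _ => (hpow j).mul_const _
    intro t ht
    have := norm_image_sub_le_of_norm_deriv_le_segment' (f := f) (a := 0) (b := 1)
      (fun x _ => (hfd x).hasDerivWithinAt) (fun x hx => ih' x ⟨hx.1, hx.2.le⟩) t ht
    rw [hf0, sub_zero, sub_zero] at this
    exact this.trans (mul_le_of_le_one_right hC0 ht.2)

/-- The iterates of `-i ∂_x · ∂_ξ`. -/
def mixedPow (j : ℕ) (τ : Symb n) : Symb n := (fun σ : Symb n => (-Complex.I) • mixedLap σ)^[j] τ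

@[simp] theorem mixedPow_zero (τ : Symb n) : mixedPow 0 τ = τ := rfl

theorem mixedPow_succ (j : ℕ) (τ : Symb n) :
    mixedPow (j + 1) τ = (-Complex.I) • mixedLap (mixedPow j τ) :=
  Function.iterate_succ_apply' _ _ _

theorem hasCompactSupport_mixedPow {τ : Symb n} (hτ : HasCompactSupport τ) (j : ℕ) :
    HasCompactSupport (mixedPow j τ) := by
  induction j with
  | zero => exact hτ
  | succ j ih =>
    rw [mixedPow_succ]
    exact (hasCompactSupport_mixedLap ih).mul_left (f := fun _ => -Complex.I)

theorem contDiff_mixedPow {τ : Symb n} (hτ : ContDiff ℝ ∞ τ) (j : ℕ) :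
    ContDiff ℝ ∞ (mixedPow j τ) := by
  induction j with
  | zero => exact hτ
  | succ j ih =>
    rw [mixedPow_succ]
    exact contDiff_pi_smul (contDiff_mixedLap ih) _

theorem mixedLap_congr {F G : Symb n} {p : Phase n} (h : F =ᶠ[𝓝 p] G) :
    mixedLap F =ᶠ[𝓝 p] mixedLap G := by
  have : ∀ᶠ q in 𝓝 p, ∀ j, derivAlong (dirX j) (derivAlong (dirXi j) F) q =
      derivAlong (dirX j) (derivAlong (dirXi j) G) q :=
    eventually_all.2 fun i => derivAlong_congr (derivAlong_congr h _) _
  filter_upwards [this] with q h2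
  simp [mixedLap, h2]

theorem mixedPow_congr {F G : Symb n} {p : Phase n} (h : F =ᶠ[𝓝 p] G) (j : ℕ) :
    mixedPow j F =ᶠ[𝓝 p] mixedPow j G := by
  induction j with
  | zero => exact h
  | succ j ih =>
    simp only [mixedPow_succ]
    filter_upwards [mixedLap_congr ih] with q hq
    simp [hq]

theorem BSFamily.derivAlong {τ : ι → Symb n} (hτ : BSFamily m ρ δ τ)
    (d : Fin n ⊕ Fin n ⊕ Fin n) :
    BSFamily (m + phaseCost ρ δ d) ρ δ (fun i => derivAlong (phaseDir d) (τ i)) := by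
  have := SymbolClass.derivAlong hτ phaseWeight_pos d
  simpa only [← Real.rpow_add (phaseWeight_pos _)] using this

theorem BSFamily.iterDeriv {τ : ι → Symb n} (hτ : BSFamily m ρ δ τ)
    (l : List (Fin n ⊕ Fin n ⊕ Fin n)) :
    BSFamily (m + cost (phaseCost ρ δ) l) ρ δ (fun i => iterDeriv phaseDir l (τ i)) := by
  have := SymbolClass.iterDeriv hτ phaseWeight_pos l
  simpa only [← Real.rpow_add (phaseWeight_pos _)] using this

theorem BSFamily.mono {τ : ι → Symb n} {m' : ℝ} (hτ : BSFamily m ρ δ τ) (h : m ≤ m') :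
    BSFamily m' ρ δ τ :=
  SymbolClass.mono_weight hτ phaseWeight_pos zero_le_one fun p => by
    rw [one_mul]
    exact Real.rpow_le_rpow_of_exponent_le (one_le_phaseWeight p) h

theorem BSFamily.mul {σ τ : ι → Symb n} {m' : ℝ} (hσ : BSFamily m ρ δ σ)
    (hτ : BSFamily m' ρ δ τ) : BSFamily (m + m') ρ δ (fun i => σ i * τ i) := by
  have := SymbolClass.mul hσ hτ phaseWeight_pos
  simpa only [← Real.rpow_add (phaseWeight_pos _)] using this

/-- Each ∂_{x_k} ∂_{ξ_k} raises the order by δ and lowers it by ρ. -/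
theorem BSFamily.mixedPow {τ : ι → Symb n} (hτ : BSFamily m ρ δ τ) (j : ℕ) :
    BSFamily (m + (δ - ρ) * j) ρ δ (fun i => mixedPow j (τ i)) := by
  induction j with
  | zero => simpa using hτ
  | succ j ih =>
    simp only [mixedPow_succ]
    refine SymbolClass.smul (SymbolClass.sum _ fun k _ => ?_) _
    have h := BSFamily.derivAlong (BSFamily.derivAlong ih (Sum.inr (Sum.inl k))) (Sum.inl k)
    refine BSFamily.mono h (le_of_eq ?_)
    simp [phaseCost]
    ring

/-- Remainder estimate for the expansion of `exp (-i ∂_x · ∂_ξ)`. -/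
theorem exists_norm_oscOp_sub_le (hδ : 0 ≤ δ) (hδ1 : δ < 1) (hδρ : δ ≤ ρ) {τ : ι → Symb n}
    (hτ : BSFamily m ρ δ τ) (hc : ∀ i, HasCompactSupport (τ i)) (N : ℕ) :
    ∃ C : ℝ, 0 ≤ C ∧ ∀ i p, ‖oscOp 1 (τ i) p -
      ∑ j ∈ Finset.range N, ((j.factorial : ℂ))⁻¹ * mixedPow j (τ i) p‖ ≤
        C * phaseWeight p ^ (m + (δ - ρ) * N) := by
  obtain ⟨C, hC0, hC⟩ := exists_norm_oscOp_le hδ hδ1 hδρ (BSFamily.mixedPow hτ N)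
    fun i => hasCompactSupport_mixedPow (hc i) N
  refine ⟨C, hC0, fun i p => ?_⟩
  have h := norm_sub_taylor_le (h := fun j t => oscOp t (mixedPow j (τ i)) p) (fun j t => by
    have := hasDerivAt_oscOp (contDiff_mixedPow (hτ.smooth i) j)
      (hasCompactSupport_mixedPow (hc i) j) t p
    rwa [← mixedPow_succ] at this) N (fun t ht => hC i t ht p) 1 (by simp)
  simp only [oscOp_zero (contDiff_mixedPow (hτ.smooth i) _) (hasCompactSupport_mixedPow (hc i) _)]
    at h
  simpa using h

end OscOp

/-! ### Cutoff functions bounded in BS^0 -/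

section Cutoff

variable {n : ℕ} {m ρ δ : ℝ}

theorem iterDeriv_zero {V D : Type*} [NormedAddCommGroup V] [NormedSpace ℝ V] (e : D → V)
    (l : List D) : iterDeriv e l (0 : V → ℂ) = 0 := by
  simpa using iterDeriv_smul (contDiff_const (c := (0 : ℂ))) 0 e l

/-- A smooth cutoff function which is `1` near the origin. -/
def baseCutoff (n : ℕ) (p : Phase n) : ℂ :=
  ((⟨1, 2, one_pos, one_lt_two⟩ : ContDiffBump (0 : Phase n)) p : ℂ)

theorem contDiff_baseCutoff : ContDiff ℝ ∞ (baseCutoff n) :=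
  Complex.ofRealCLM.contDiff.comp (ContDiffBump.contDiff _)

theorem baseCutoff_eq_one {p : Phase n} (h : ‖p‖ ≤ 1) : baseCutoff n p = 1 := by
  rw [baseCutoff, ContDiffBump.one_of_mem_closedBall _ (by simpa using h)]
  simp

theorem baseCutoff_eq_zero {p : Phase n} (h : 2 ≤ ‖p‖) : baseCutoff n p = 0 := by
  rw [baseCutoff, ContDiffBump.zero_of_le_dist _ (by simpa using h)]
  simp

/-- The cutoff functions `χ(p / (k + 1))`. -/
def cutoff (n k : ℕ) (p : Phase n) : ℂ := baseCutoff n (((k : ℝ) + 1)⁻¹ • p)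

theorem contDiff_cutoff (k : ℕ) : ContDiff ℝ ∞ (cutoff n k) :=
  contDiff_baseCutoff.comp (contDiff_const_smul _)

theorem norm_inv_smul_nat (k : ℕ) (p : Phase n) :
    ‖((k : ℝ) + 1)⁻¹ • p‖ = ‖p‖ / (k + 1) := by
  rw [norm_smul, norm_inv, Real.norm_of_nonneg (by positivity), div_eq_inv_mul]

theorem hasCompactSupport_cutoff (k : ℕ) : HasCompactSupport (cutoff n k) := by
  refine HasCompactSupport.intro (isCompact_closedBall (0 : Phase n) (2 * (k + 1)))
    fun p hp => baseCutoff_eq_zero ?_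
  rw [mem_closedBall_zero_iff, not_le] at hp
  rw [norm_inv_smul_nat, le_div_iff₀ (by positivity)]
  exact hp.le

theorem cutoff_eventuallyEq_one (p : Phase n) : ∀ᶠ k in atTop, cutoff n k =ᶠ[𝓝 p] 1 := by
  obtain ⟨K, hK⟩ := exists_nat_ge (‖p‖ + 1)
  filter_upwards [eventually_ge_atTop K] with k hk
  filter_upwards [Metric.ball_mem_nhds p one_pos] with q hq
  refine baseCutoff_eq_one ?_
  rw [norm_inv_smul_nat, div_le_one (by positivity)]
  have h1 : ‖q - p‖ < 1 := by simpa [dist_eq_norm] using hq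
  have h2 := norm_sub_norm_le q p
  have h3 : (K : ℝ) ≤ k := by exact_mod_cast hk
  linarith

theorem neg_length_le_cost (hδ : 0 ≤ δ) (hρ : ρ ≤ 1) (l : List (Fin n ⊕ Fin n ⊕ Fin n)) :
    -(l.length : ℝ) ≤ cost (phaseCost ρ δ) l := by
  induction l with
  | nil => simp
  | cons d l ih =>
    have hd : -1 ≤ phaseCost (n := n) ρ δ d := by
      rcases d with d | d | d <;> simp [phaseCost] <;> linarith
    simp only [cost_cons, List.length_cons]
    push_cast
    linarith

/-- A derivative of order j brings (k+1)^{-j} and vanishes for |p| > 2(k+1), so on its support the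
phase weight is at most 5(k+1). Since δ ≥ 0 and ρ ≤ 1, every direction costs at least -1, which is
what this gain pays for. -/
theorem bsFamily_cutoff (hδ : 0 ≤ δ) (hρ : ρ ≤ 1) : BSFamily 0 ρ δ (cutoff n) := by
  refine SymbolClass.of_bound contDiff_cutoff phaseWeight_pos (fun p => by simp) fun l => ?_
  have hs := contDiff_iterDeriv (contDiff_baseCutoff (n := n)) phaseDir l
  have hzero : ∀ p : Phase n, 2 < ‖p‖ → iterDeriv phaseDir l (baseCutoff n) p = 0 := by
    intro p hp
    have h0 : baseCutoff n =ᶠ[𝓝 p] 0 := by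
      filter_upwards [(isOpen_lt continuous_const continuous_norm).mem_nhds hp] with q hq
      exact baseCutoff_eq_zero (le_of_lt hq)
    rw [(iterDeriv_congr h0 phaseDir l).eq_of_nhds, iterDeriv_zero]
    rfl
  have hc : HasCompactSupport (iterDeriv phaseDir l (baseCutoff n)) :=
    HasCompactSupport.intro (isCompact_closedBall (0 : Phase n) 2) fun p hp => hzero p (by
      rwa [mem_closedBall_zero_iff, not_le] at hp)
  obtain ⟨-, M, -, hM0, hM, -⟩ := exists_support_bound hs.continuous hc
  refine ⟨M * 5 ^ l.length, fun k p => ?_⟩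
  have hk : (0 : ℝ) < k + 1 := by positivity
  have hcut : cutoff n k = fun w => baseCutoff n (0 + ((((k : ℝ) + 1)⁻¹ •
      ContinuousLinearMap.id ℝ (Phase n)) w)) := by
    ext w
    simp [cutoff]
  have hw := phaseWeight_pos p
  rw [hcut, iterDeriv_comp_affine (e' := phaseDir) (f := id) (a := fun _ => ((k : ℝ) + 1)⁻¹)
    (fun d => by simp) 0 contDiff_baseCutoff]
  simp only [List.map_const', List.prod_replicate, List.map_id, zero_add, Real.rpow_zero, one_mul,
    smul_apply, ContinuousLinearMap.id_apply]
  rw [norm_mul, Complex.norm_real, Real.norm_of_nonneg (by positivity)]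
  by_cases hp : 2 < ‖((k : ℝ) + 1)⁻¹ • p‖
  · rw [hzero _ hp, norm_zero, mul_zero]
    positivity
  · rw [norm_inv_smul_nat, not_lt, div_le_iff₀ hk] at hp
    -- On the support the weight is at most 1 + 2(k+1) + 2(k+1).
    have hw5 : phaseWeight p ≤ 5 * (k + 1) := by
      have h1 : ‖p.2.1‖ ≤ ‖p‖ := (norm_fst_le p.2).trans (norm_snd_le p)
      have h2 : ‖p.2.2‖ ≤ ‖p‖ := (norm_snd_le p.2).trans (norm_snd_le p)
      have h3 : (0 : ℝ) ≤ k := by positivity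
      rw [phaseWeight]
      linarith
    have hcost := neg_length_le_cost (n := n) hδ hρ l
    have h1 : ((k : ℝ) + 1)⁻¹ ^ l.length ≤
        5 ^ l.length * phaseWeight p ^ cost (phaseCost ρ δ) l := by
      have h2 : phaseWeight p ^ (-(l.length : ℝ)) ≤ phaseWeight p ^ cost (phaseCost ρ δ) l :=
        Real.rpow_le_rpow_of_exponent_le (one_le_phaseWeight p) hcost
      refine le_trans ?_ (mul_le_mul_of_nonneg_left h2 (by positivity))
      rw [Real.rpow_neg hw.le, Real.rpow_natCast, ← inv_pow, ← mul_pow]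
      refine pow_le_pow_left₀ (by positivity) ?_ _
      rw [← div_eq_mul_inv, inv_eq_one_div, div_le_div_iff₀ hk hw]
      linarith
    calc _ ≤ (5 ^ l.length * phaseWeight p ^ cost (phaseCost ρ δ) l) * M :=
          mul_le_mul h1 (hM _) (norm_nonneg _) (by positivity)
      _ = _ := by ring

end Cutoff

/-! ### Extension to symbols without compact support -/

section SymbolLim

variable {n : ℕ} {m ρ δ : ℝ}

/-- The operator `exp (-i ∂_x · ∂_ξ)` on symbols. -/
def symbolLim (τ : Symb n) (p : Phase n) : ℂ :=
  limUnder atTop fun k => oscOp 1 (cutoff n k * τ) p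

/-- Bounded sequences in `BS^m_{ρ,δ}` of compactly supported symbols which are locally eventually
equal to `τ`. -/
structure IsApprox (m ρ δ : ℝ) (F : ℕ → Symb n) (τ : Symb n) : Prop where
  family : BSFamily m ρ δ F
  compact : ∀ k, HasCompactSupport (F k)
  eventuallyEq : ∀ p, ∀ᶠ k in atTop, F k =ᶠ[𝓝 p] τ

theorem isApprox_cutoff_mul (hδ : 0 ≤ δ) (hρ : ρ ≤ 1) {τ : Symb n}
    (hτ : BSFamily m ρ δ fun _ : Unit => τ) :
    IsApprox m ρ δ (fun k => cutoff n k * τ) τ where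
  family := by
    have := BSFamily.mul (bsFamily_cutoff (n := n) hδ hρ) (hτ.reindex fun _ : ℕ => ())
    rwa [zero_add] at this
  compact k := (hasCompactSupport_cutoff k).mul_right
  eventuallyEq p := by
    filter_upwards [cutoff_eventuallyEq_one p] with k hk
    filter_upwards [hk] with q hq
    simp [hq]

namespace IsApprox

variable {F G : ℕ → Symb n} {τ : Symb n}

theorem derivAlong (h : IsApprox m ρ δ F τ) (d : Fin n ⊕ Fin n ⊕ Fin n) :
    IsApprox (m + phaseCost ρ δ d) ρ δ (fun k => derivAlong (phaseDir d) (F k))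
      (derivAlong (phaseDir d) τ) where
  family := BSFamily.derivAlong h.family d
  compact k := hasCompactSupport_derivAlong (h.compact k) _
  eventuallyEq p := (h.eventuallyEq p).mono fun _ hk => derivAlong_congr hk _

/-- The limit does not depend on the approximating sequence: both scaled sequences of amplitudes are
locally eventually equal to the same limit amplitude. -/
theorem exists_tendsto (hδ : 0 ≤ δ) (hδ1 : δ < 1) (hδρ : δ ≤ ρ) (hF : IsApprox m ρ δ F τ)
    (hG : IsApprox m ρ δ G τ) (p : Phase n) :
    ∃ ℓ, Tendsto (fun k => oscOp 1 (F k) p) atTop (𝓝 ℓ) ∧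
      Tendsto (fun k => oscOp 1 (G k) p) atTop (𝓝 ℓ) := by
  have hsc : ∀ {K : ℕ → Symb n}, BSFamily m ρ δ K →
      SymbolClass oscDir (oscCost δ (δ / (1 - δ))) thetaWeight
        (fun w => thetaWeight w ^ (|m| / (1 - δ))) (fun k => scaledAmp m δ 1 p (K k)) := by
    intro K hK
    exact (symbolClass_scaledAmp hδ hδ1 hδρ hK).reindex
      fun k : ℕ => (k, (⟨1, by simp⟩ : Set.Icc (0 : ℝ) 1), p)
  have hev : ∀ {K : ℕ → Symb n}, IsApprox m ρ δ K τ → ∀ w, ∀ᶠ k in atTop,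
      scaledAmp m δ 1 p (K k) =ᶠ[𝓝 w] scaledAmp m δ 1 p τ := by
    intro K hK w
    set φ : OscSpace n → Phase n := fun w =>
      p + scaleMap (phaseWeight p ^ (-δ)) (1 * phaseWeight p ^ δ) w with hφ
    have hφc : Continuous φ := continuous_const.add (scaleMap _ _).continuous
    filter_upwards [hK.eventuallyEq (φ w)] with k hk
    filter_upwards [hφc.continuousAt.eventually hk] with v hv
    exact congrArg (fun z : ℂ => ((phaseWeight p ^ (-m) : ℝ) : ℂ) • z) hv
  obtain ⟨ℓ, h1, h2⟩ := exists_tendsto_integral_oscFactor hδ hδ1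
    (div_nonneg hδ (by linarith))
    (fun k => hasCompactSupport_scaledAmp (hF.family.smooth k).continuous (hF.compact k) m δ
      one_pos p)
    (fun k => hasCompactSupport_scaledAmp (hG.family.smooth k).continuous (hG.compact k) m δ
      one_pos p) (hsc hF.family) (hsc hG.family) (hev hF) (hev hG)
  simp_rw [fun k => oscOp_eq_integral_scaledAmp (hF.family.smooth k).continuous (hF.compact k) m δ
      one_pos p, fun k => oscOp_eq_integral_scaledAmp (hG.family.smooth k).continuous
      (hG.compact k) m δ one_pos p]
  exact ⟨_, h1.const_mul _, h2.const_mul _⟩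

/-- Needed because the derivatives of `cutoff n k * τ` are not the cutoffs of the derivatives of τ;
they are nevertheless an admissible approximation, so they yield the same limit. -/
theorem tendsto (hδ : 0 ≤ δ) (hδ1 : δ < 1) (hδρ : δ ≤ ρ) (hρ : ρ ≤ 1)
    (hF : IsApprox m ρ δ F τ) (hτ : BSFamily m ρ δ fun _ : Unit => τ) (p : Phase n) :
    Tendsto (fun k => oscOp 1 (F k) p) atTop (𝓝 (symbolLim τ p)) := by
  obtain ⟨ℓ, h1, h2⟩ := hF.exists_tendsto hδ hδ1 hδρ (isApprox_cutoff_mul hδ hρ hτ) p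
  rw [symbolLim, h2.limUnder_eq]
  exact h1

end IsApprox

/-- The remainder estimate has a constant uniform in the cutoff and passes to the pointwise limit;
the finitely many terms of the expansion are eventually constant in k. -/
theorem exists_norm_symbolLim_sub_le (hδ : 0 ≤ δ) (hδ1 : δ < 1) (hδρ : δ ≤ ρ) (hρ : ρ ≤ 1)
    {τ : Symb n} (hτ : BSFamily m ρ δ fun _ : Unit => τ) (N : ℕ) :
    ∃ C : ℝ, 0 ≤ C ∧ ∀ p, ‖symbolLim τ p -
      ∑ j ∈ Finset.range N, ((j.factorial : ℂ))⁻¹ * mixedPow j τ p‖ ≤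
        C * phaseWeight p ^ (m + (δ - ρ) * N) := by
  have happ := isApprox_cutoff_mul hδ hρ hτ
  obtain ⟨C, hC0, hC⟩ := exists_norm_oscOp_sub_le hδ hδ1 hδρ happ.family happ.compact N
  refine ⟨C, hC0, fun p => ?_⟩
  refine le_of_tendsto (Tendsto.norm ((happ.tendsto hδ hδ1 hδρ hρ hτ p).sub
    (tendsto_finsetSum _ fun j _ => ?_)) ) (Eventually.of_forall fun k => hC k p)
  refine Tendsto.congr' ?_ tendsto_const_nhds
  filter_upwards [happ.eventuallyEq p] with k hk
  rw [(mixedPow_congr hk j).eq_of_nhds]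

/-- The coordinates of the phase space. -/
def phaseCoord : Fin n ⊕ Fin n ⊕ Fin n → Phase n →L[ℝ] ℝ :=
  Sum.elim (fun i => (EuclideanSpace.proj i).comp (ContinuousLinearMap.fst ℝ _ _))
    (Sum.elim
      (fun i => (EuclideanSpace.proj i).comp
        ((ContinuousLinearMap.fst ℝ _ _).comp (ContinuousLinearMap.snd ℝ _ _)))
      (fun i => (EuclideanSpace.proj i).comp
        ((ContinuousLinearMap.snd ℝ _ _).comp (ContinuousLinearMap.snd ℝ _ _))))

theorem sum_phaseCoord (v : Phase n) : ∑ d, phaseCoord d v • phaseDir d = v := by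
  have h : ∀ x : E n, ∑ i, x i • EuclideanSpace.single i (1 : ℝ) = x := by
    intro x
    ext i
    simp [Finset.sum_apply, Pi.single_apply]
  rw [Fintype.sum_sum_type, Fintype.sum_sum_type]
  ext1
  · simpa [phaseCoord, phaseDir, dirX, dirXi, dirEta, Prod.fst_sum, Prod.snd_sum] using h v.1
  · ext1
    · simpa [phaseCoord, phaseDir, dirX, dirXi, dirEta, Prod.fst_sum, Prod.snd_sum] using h v.2.1
    · simpa [phaseCoord, phaseDir, dirX, dirXi, dirEta, Prod.fst_sum, Prod.snd_sum] using h v.2.2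

theorem phaseCoord_phaseDir (d d' : Fin n ⊕ Fin n ⊕ Fin n) :
    phaseCoord d (phaseDir d') = if d = d' then 1 else 0 := by
  rcases d with d | d | d <;> rcases d' with d' | d' | d' <;>
    simp [phaseCoord, phaseDir, dirX, dirXi, dirEta]

theorem norm_phaseCoord_le (d : Fin n ⊕ Fin n ⊕ Fin n) (v : Phase n) :
    |phaseCoord d v| ≤ ‖v‖ := by
  rcases d with d | d | d
  · exact (PiLp.norm_apply_le v.1 d).trans (norm_fst_le v)
  · exact (PiLp.norm_apply_le v.2.1 d).trans ((norm_fst_le v.2).trans (norm_snd_le v))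
  · exact (PiLp.norm_apply_le v.2.2 d).trans ((norm_snd_le v.2).trans (norm_snd_le v))

theorem derivAlong_eq_sum (F : Symb n) (v p : Phase n) :
    derivAlong v F p = ∑ d, phaseCoord d v * derivAlong (phaseDir d) F p := by
  conv_lhs => rw [← sum_phaseCoord v]
  simp [derivAlong]

/-- The linear map with given values in the coordinate directions. -/
def gradMap (a : Fin n ⊕ Fin n ⊕ Fin n → ℂ) : Phase n →L[ℝ] ℂ :=
  ∑ d, (phaseCoord d).smulRight (a d)

theorem gradMap_apply (a : Fin n ⊕ Fin n ⊕ Fin n → ℂ) (v : Phase n) :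
    gradMap a v = ∑ d, phaseCoord d v * a d := by
  simp [gradMap]

theorem gradMap_phaseDir (a : Fin n ⊕ Fin n ⊕ Fin n → ℂ) (d : Fin n ⊕ Fin n ⊕ Fin n) :
    gradMap a (phaseDir d) = a d := by
  rw [gradMap_apply, Finset.sum_eq_single d]
  · simp [phaseCoord_phaseDir]
  · intro b _ hb
    simp [phaseCoord_phaseDir, hb]
  · simp

theorem norm_gradMap_le (a : Fin n ⊕ Fin n ⊕ Fin n → ℂ) : ‖gradMap a‖ ≤ ∑ d, ‖a d‖ := by
  refine ContinuousLinearMap.opNorm_le_bound _ (Finset.sum_nonneg fun _ _ => norm_nonneg _)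
    fun v => ?_
  rw [gradMap_apply, Finset.sum_mul]
  refine norm_sum_le_of_le _ fun d _ => ?_
  rw [norm_mul, Complex.norm_real, mul_comm]
  exact mul_le_mul_of_nonneg_left (norm_phaseCoord_le d v) (norm_nonneg _)

/-- In the form with unit scaling the base point enters only through a translation of τ, so the
derivative under the integral falls on τ alone. -/
theorem hasFDerivAt_oscOp {τ : Symb n} (hτ : ContDiff ℝ ∞ τ) (hc : HasCompactSupport τ)
    (p : Phase n) :
    HasFDerivAt (oscOp 1 τ) (gradMap fun d => oscOp 1 (derivAlong (phaseDir d) τ) p) p := by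
  have hfd : Continuous (fderiv ℝ τ) := (hτ.fderiv_right (m := ∞) (by simp)).continuous
  obtain ⟨R, hR⟩ := hc.isBounded.subset_closedBall 0
  obtain ⟨M, hM⟩ := hfd.bounded_above_of_compact_support (hc.fderiv (𝕜 := ℝ))
  have hshift : ∀ q : Phase n, Continuous fun w : OscSpace n => q + scaleMap 1 1 w := fun q =>
    continuous_const.add (scaleMap 1 1).continuous
  have hint : ∀ {σ : Symb n}, Continuous σ → HasCompactSupport σ → ∀ q,
      Integrable fun w : OscSpace n => oscFactor w * σ (q + scaleMap 1 1 w) := fun hσ hcσ q =>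
    (continuous_oscFactor.mul (hσ.comp (hshift q))).integrable_of_hasCompactSupport
      (hasCompactSupport_comp_scaleMap hσ hcσ one_pos one_pos q).mul_left
  have hrep : ∀ {σ : Symb n}, Continuous σ → HasCompactSupport σ → ∀ q, oscOp 1 σ q =
      (((2 * Real.pi) ^ n : ℝ) : ℂ)⁻¹ * ∫ w, oscFactor w * σ (q + scaleMap 1 1 w) := by
    intro σ hσ hcσ q
    simpa using oscOp_eq_integral_scaleMap hσ hcσ one_pos one_pos q
  have hmeas : AEStronglyMeasurable (fun w : OscSpace n => oscFactor w •
      fderiv ℝ τ (p + scaleMap 1 1 w)) volume :=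
    (continuous_oscFactor.smul (hfd.comp (hshift p))).aestronglyMeasurable
  -- For q within distance 1 of p, the translated supports lie in the common ball of radius R + ‖p‖
  -- + 1.
  have hbd : ∀ w : OscSpace n, ∀ q ∈ Metric.ball p 1,
      ‖oscFactor w • fderiv ℝ τ (q + scaleMap 1 1 w)‖ ≤
        (Metric.closedBall (0 : OscSpace n) (R + ‖p‖ + 1)).indicator (fun _ => M) w := by
    intro w q hq
    rw [norm_smul, norm_oscFactor, one_mul]
    by_cases hw : w ∈ Metric.closedBall (0 : OscSpace n) (R + ‖p‖ + 1)
    · rw [Set.indicator_of_mem hw]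
      exact hM _
    · rw [Set.indicator_of_notMem hw]
      refine le_of_eq (norm_eq_zero.2 ?_)
      by_contra h
      have h1 : q + scaleMap 1 1 w ∈ tsupport τ :=
        support_fderiv_subset ℝ (Function.mem_support.2 h)
      have h2 := hR h1
      rw [mem_closedBall_zero_iff] at h2 hw
      rw [not_le] at hw
      have h3 := norm_fst_le_add_scaleMap 1 1 q w
      have h4 := norm_snd_le_add_scaleMap 1 1 q w
      rw [abs_one, one_mul] at h3 h4
      have h5 : ‖w‖ ≤ ‖q + scaleMap 1 1 w‖ + ‖q‖ := max_le h3 h4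
      have h6 : ‖q - p‖ < 1 := by simpa [dist_eq_norm] using hq
      have h7 := norm_sub_norm_le q p
      linarith
  have hbi : Integrable ((Metric.closedBall (0 : OscSpace n) (R + ‖p‖ + 1)).indicator
      (fun _ => M)) :=
    (continuous_const.continuousOn.integrableOn_compact
      (isCompact_closedBall 0 _)).integrable_indicator Metric.isClosed_closedBall.measurableSet
  have hmain := hasFDerivAt_integral_of_dominated_of_fderiv_le (𝕜 := ℝ)
    (μ := (volume : Measure (OscSpace n)))
    (F := fun q w => oscFactor w * τ (q + scaleMap 1 1 w)) (x₀ := p)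
    (F' := fun q w => oscFactor w • fderiv ℝ τ (q + scaleMap 1 1 w))
    (Metric.ball_mem_nhds p one_pos)
    (Eventually.of_forall fun q => (hint hτ.continuous hc q).aestronglyMeasurable)
    (hint hτ.continuous hc p) hmeas (Eventually.of_forall hbd) hbi
    (Eventually.of_forall fun w q _ => by
      have h1 : HasFDerivAt (fun q => τ (q + scaleMap 1 1 w))
          (fderiv ℝ τ (q + scaleMap 1 1 w)) q :=
        (((hτ.differentiable (by simp) _).hasFDerivAt).comp q
          ((hasFDerivAt_id q).add_const _)).congr_fderiv (ContinuousLinearMap.comp_id _)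
      exact h1.const_mul (oscFactor w))
  have hI : Integrable (fun w : OscSpace n => oscFactor w • fderiv ℝ τ (p + scaleMap 1 1 w)) :=
    hbi.mono' hmeas (Eventually.of_forall fun w => hbd w p (Metric.mem_ball_self one_pos))
  have hfun : oscOp 1 τ = fun q => (((2 * Real.pi) ^ n : ℝ) : ℂ)⁻¹ *
      ∫ w, oscFactor w * τ (q + scaleMap 1 1 w) := by
    ext q
    exact hrep hτ.continuous hc q
  rw [hfun]
  refine (hmain.const_mul _).congr_fderiv ?_
  refine ContinuousLinearMap.ext fun v => ?_
  rw [gradMap_apply, _root_.smul_apply, ContinuousLinearMap.integral_apply hI]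
  simp_rw [fun d => hrep (contDiff_derivAlong hτ (phaseDir d)).continuous
    (hasCompactSupport_derivAlong hc (phaseDir d)) p]
  have h1 : ∀ w : OscSpace n, (oscFactor w • fderiv ℝ τ (p + scaleMap 1 1 w)) v =
      ∑ d, phaseCoord d v * (oscFactor w * derivAlong (phaseDir d) τ (p + scaleMap 1 1 w)) := by
    intro w
    have := derivAlong_eq_sum τ v (p + scaleMap 1 1 w)
    rw [derivAlong] at this
    rw [_root_.smul_apply, this, smul_eq_mul, Finset.mul_sum]
    refine Finset.sum_congr rfl fun d _ => ?_
    ring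
  simp_rw [h1]
  rw [integral_finsetSum _ fun d _ => (hint (contDiff_derivAlong hτ (phaseDir d)).continuous
    (hasCompactSupport_derivAlong hc (phaseDir d)) p).const_mul _, smul_eq_mul, Finset.mul_sum]
  refine Finset.sum_congr rfl fun d _ => ?_
  rw [integral_const_mul]
  ring

theorem exists_phaseWeight_rpow_le (p : Phase n) (a : ℝ) :
    ∃ B : ℝ, 0 ≤ B ∧ ∀ q ∈ Metric.closedBall p 1, phaseWeight q ^ a ≤ B := by
  refine ⟨(phaseWeight p + 2) ^ |a|, by have := phaseWeight_pos p; positivity, fun q hq => ?_⟩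
  have h6 : ‖q - p‖ ≤ 1 := by simpa [dist_eq_norm] using hq
  have h1 : ‖q.2.1 - p.2.1‖ ≤ ‖q - p‖ := (norm_fst_le (q - p).2).trans (norm_snd_le (q - p))
  have h2 : ‖q.2.2 - p.2.2‖ ≤ ‖q - p‖ := (norm_snd_le (q - p).2).trans (norm_snd_le (q - p))
  have h3 := norm_sub_norm_le q.2.1 p.2.1
  have h4 := norm_sub_norm_le q.2.2 p.2.2
  have h5 : phaseWeight q ≤ phaseWeight p + 2 := by
    simp only [phaseWeight]
    linarith
  refine (Real.rpow_le_rpow_of_exponent_le (one_le_phaseWeight q) (le_abs_self a)).trans ?_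
  exact Real.rpow_le_rpow (phaseWeight_pos q).le h5 (abs_nonneg _)

section LocalBounds

variable {ι : Type*} {F : ι → Symb n}

theorem exists_local_norm_oscOp_le (hδ : 0 ≤ δ) (hδ1 : δ < 1) (hδρ : δ ≤ ρ)
    (hF : BSFamily m ρ δ F) (hc : ∀ i, HasCompactSupport (F i))
    (p : Phase n) : ∃ K : ℝ, 0 ≤ K ∧ ∀ i, ∀ q ∈ Metric.closedBall p 1, ‖oscOp 1 (F i) q‖ ≤ K := by
  obtain ⟨C, hC0, hC⟩ := exists_norm_oscOp_le hδ hδ1 hδρ hF hc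
  obtain ⟨B, hB0, hB⟩ := exists_phaseWeight_rpow_le p m
  exact ⟨C * B, by positivity, fun i q hq => (hC i 1 (by simp) q).trans
    (mul_le_mul_of_nonneg_left (hB q hq) hC0)⟩

theorem exists_local_lipschitz_oscOp (hδ : 0 ≤ δ) (hδ1 : δ < 1) (hδρ : δ ≤ ρ)
    (hF : BSFamily m ρ δ F) (hc : ∀ i, HasCompactSupport (F i))
    (p : Phase n) : ∃ K : ℝ, 0 ≤ K ∧ ∀ i, ∀ q ∈ Metric.closedBall p 1,
      ‖oscOp 1 (F i) q - oscOp 1 (F i) p‖ ≤ K * ‖q - p‖ := by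
  choose K hK0 hK using fun d => exists_local_norm_oscOp_le hδ hδ1 hδρ (BSFamily.derivAlong hF d)
    (fun i => hasCompactSupport_derivAlong (hc i) _) p
  refine ⟨∑ d, K d, Finset.sum_nonneg fun d _ => hK0 d, fun i q hq => ?_⟩
  refine (convex_closedBall p 1).norm_image_sub_le_of_norm_hasFDerivWithin_le
    (fun x _ => (hasFDerivAt_oscOp (hF.smooth i) (hc i) x).hasFDerivWithinAt)
    (fun x hx => (norm_gradMap_le _).trans (Finset.sum_le_sum fun d _ => hK d i x hx))
    (Metric.mem_closedBall_self zero_le_one) hq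

/-- A first-order Taylor estimate uniform in the family. It survives pointwise limits, so the limit
is differentiable and no uniform convergence of derivatives is needed. -/
theorem exists_local_quadratic_oscOp (hδ : 0 ≤ δ) (hδ1 : δ < 1) (hδρ : δ ≤ ρ)
    (hF : BSFamily m ρ δ F) (hc : ∀ i, HasCompactSupport (F i))
    (p : Phase n) : ∃ K : ℝ, 0 ≤ K ∧ ∀ i, ∀ q ∈ Metric.closedBall p 1,
      ‖oscOp 1 (F i) q - oscOp 1 (F i) p -
        gradMap (fun d => oscOp 1 (derivAlong (phaseDir d) (F i)) p) (q - p)‖ ≤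
          K * ‖q - p‖ ^ 2 := by
  choose K hK0 hK using fun d => exists_local_lipschitz_oscOp hδ hδ1 hδρ
    (BSFamily.derivAlong hF d) (fun i => hasCompactSupport_derivAlong (hc i) _) p
  refine ⟨∑ d, K d, Finset.sum_nonneg fun d _ => hK0 d, fun i q hq => ?_⟩
  have hq1 : ‖q - p‖ ≤ 1 := by simpa [dist_eq_norm] using hq
  -- The mean value inequality is used on the ball of radius ‖q-p‖ instead of 1: there the
  -- derivative varies by at most a multiple of ‖q-p‖, which produces the square.
  have := (convex_closedBall p ‖q - p‖).norm_image_sub_le_of_norm_hasFDerivWithin_le'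
    (C := (∑ d, K d) * ‖q - p‖)
    (φ := gradMap (fun d => oscOp 1 (derivAlong (phaseDir d) (F i)) p))
    (fun x _ => (hasFDerivAt_oscOp (hF.smooth i) (hc i) x).hasFDerivWithinAt)
    (fun x hx => ?_) (Metric.mem_closedBall_self (norm_nonneg _))
    (y := q) (by simp [dist_eq_norm])
  · rwa [mul_assoc, ← sq] at this
  · have hx1 : ‖x - p‖ ≤ ‖q - p‖ := by simpa [dist_eq_norm] using hx
    have hsub : ∀ a b : Fin n ⊕ Fin n ⊕ Fin n → ℂ,
        gradMap a - gradMap b = gradMap fun d => a d - b d := by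
      intro a b
      refine ContinuousLinearMap.ext fun v => ?_
      rw [_root_.sub_apply, gradMap_apply, gradMap_apply, gradMap_apply,
        ← Finset.sum_sub_distrib]
      refine Finset.sum_congr rfl fun d _ => ?_
      ring
    rw [hsub, Finset.sum_mul]
    refine (norm_gradMap_le _).trans (Finset.sum_le_sum fun d _ => ?_)
    refine (hK d i x ?_).trans (mul_le_mul_of_nonneg_left hx1 (hK0 d))
    simpa [dist_eq_norm] using hx1.trans hq1

end LocalBounds

theorem hasFDerivAt_symbolLim (hδ : 0 ≤ δ) (hδ1 : δ < 1) (hδρ : δ ≤ ρ) (hρ : ρ ≤ 1)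
    {τ : Symb n} (hτ : BSFamily m ρ δ fun _ : Unit => τ) (p : Phase n) :
    HasFDerivAt (symbolLim τ)
      (gradMap fun d => symbolLim (derivAlong (phaseDir d) τ) p) p := by
  have happ := isApprox_cutoff_mul hδ hρ hτ
  obtain ⟨K, hK0, hK⟩ := exists_local_quadratic_oscOp hδ hδ1 hδρ happ.family happ.compact p
  set L := gradMap fun d => symbolLim (derivAlong (phaseDir d) τ) p with hL
  have hlim : ∀ q ∈ Metric.closedBall p 1,
      ‖symbolLim τ q - symbolLim τ p - L (q - p)‖ ≤ K * ‖q - p‖ ^ 2 := by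
    intro q hq
    refine le_of_tendsto (Tendsto.norm (((happ.tendsto hδ hδ1 hδρ hρ hτ q).sub
      (happ.tendsto hδ hδ1 hδρ hρ hτ p)).sub ?_)) (Eventually.of_forall fun k => hK k q hq)
    simp_rw [hL, gradMap_apply]
    exact tendsto_finsetSum _ fun d _ => ((happ.derivAlong d).tendsto hδ hδ1 hδρ hρ
      (BSFamily.derivAlong hτ d) p).const_mul _
  have hO : (fun q => symbolLim τ q - symbolLim τ p - L (q - p)) =O[𝓝 p]
      fun q => ‖q - p‖ ^ 2 := by
    refine Asymptotics.IsBigO.of_bound K ?_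
    filter_upwards [Metric.closedBall_mem_nhds p one_pos] with q hq
    simpa using hlim q hq
  have h0 := hO.hasFDerivAt (𝕜 := ℝ) one_lt_two
  have h1 : HasFDerivAt (fun q => L (q - p)) L p :=
    L.hasFDerivAt.comp p ((hasFDerivAt_id p).sub_const p)
  have h2 := (h0.add h1).add_const (symbolLim τ p)
  refine (h2.congr_fderiv (zero_add L)).congr_of_eventuallyEq (Eventually.of_forall fun q => ?_)
  simp

theorem derivAlong_symbolLim (hδ : 0 ≤ δ) (hδ1 : δ < 1) (hδρ : δ ≤ ρ) (hρ : ρ ≤ 1)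
    {τ : Symb n} (hτ : BSFamily m ρ δ fun _ : Unit => τ) (d : Fin n ⊕ Fin n ⊕ Fin n) :
    derivAlong (phaseDir d) (symbolLim τ) = symbolLim (derivAlong (phaseDir d) τ) := by
  ext p
  rw [derivAlong, (hasFDerivAt_symbolLim hδ hδ1 hδρ hρ hτ p).fderiv, gradMap_phaseDir]

theorem iterDeriv_symbolLim (hδ : 0 ≤ δ) (hδ1 : δ < 1) (hδρ : δ ≤ ρ) (hρ : ρ ≤ 1)
    {τ : Symb n} (hτ : BSFamily m ρ δ fun _ : Unit => τ) (l : List (Fin n ⊕ Fin n ⊕ Fin n)) :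
    iterDeriv phaseDir l (symbolLim τ) = symbolLim (iterDeriv phaseDir l τ) := by
  induction l generalizing m τ with
  | nil => rfl
  | cons d l ih =>
    rw [iterDeriv_cons, derivAlong_symbolLim hδ hδ1 hδρ hρ hτ, ih (BSFamily.derivAlong hτ d)]
    rfl

/-- The derivative is a fixed linear combination of functions `symbolLim` of symbols again, so the
induction runs over all symbols and orders at once. -/
theorem contDiff_symbolLim (hδ : 0 ≤ δ) (hδ1 : δ < 1) (hδρ : δ ≤ ρ) (hρ : ρ ≤ 1)
    {τ : Symb n} (hτ : BSFamily m ρ δ fun _ : Unit => τ) : ContDiff ℝ ∞ (symbolLim τ) := by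
  refine contDiff_infty.2 fun N => ?_
  induction N generalizing m τ with
  | zero =>
    have : Continuous (symbolLim τ) := continuous_iff_continuousAt.2 fun p =>
      (hasFDerivAt_symbolLim hδ hδ1 hδρ hρ hτ p).continuousAt
    simpa using this
  | succ N ih =>
    have h := fun p => hasFDerivAt_symbolLim hδ hδ1 hδρ hρ hτ p
    push_cast
    refine contDiff_succ_iff_hasFDerivAt.2 ⟨_, ?_, h⟩
    simp only [gradMap]
    exact ContDiff.sum fun d _ => contDiff_const.smulRight (ih (BSFamily.derivAlong hτ d))

theorem derivAlong_mixedPow {τ : Symb n} (hτ : ContDiff ℝ ∞ τ) (v : Phase n) (j : ℕ) :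
    derivAlong v (mixedPow j τ) = mixedPow j (derivAlong v τ) := by
  induction j with
  | zero => rfl
  | succ j ih =>
    have hj := contDiff_mixedPow hτ j
    rw [mixedPow_succ, mixedPow_succ, derivAlong_smul (contDiff_mixedLap hj), ← ih, mixedLap,
      derivAlong_sum _ fun k _ => contDiff_derivAlong (contDiff_derivAlong hj _) _, mixedLap]
    congr 1
    refine Finset.sum_congr rfl fun k _ => ?_
    rw [derivAlong_comm (contDiff_derivAlong hj _), derivAlong_comm hj v]

theorem iterDeriv_mixedPow {τ : Symb n} (hτ : ContDiff ℝ ∞ τ)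
    (l : List (Fin n ⊕ Fin n ⊕ Fin n)) (j : ℕ) :
    iterDeriv phaseDir l (mixedPow j τ) = mixedPow j (iterDeriv phaseDir l τ) := by
  induction l generalizing τ with
  | nil => rfl
  | cons d l ih =>
    rw [iterDeriv_cons, derivAlong_mixedPow hτ, ih (contDiff_derivAlong hτ _)]
    rfl

theorem iterDeriv_sum {V D κ : Type*} [NormedAddCommGroup V] [NormedSpace ℝ V] (e : D → V)
    (l : List D) (s : Finset κ) {F : κ → V → ℂ} (hF : ∀ k ∈ s, ContDiff ℝ ∞ (F k)) :
    iterDeriv e l (∑ k ∈ s, F k) = ∑ k ∈ s, iterDeriv e l (F k) := by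
  induction l generalizing F with
  | nil => rfl
  | cons d l ih =>
    rw [iterDeriv_cons, derivAlong_sum s hF, ih fun k hk => contDiff_derivAlong (hF k hk) _]
    rfl

/-- The asymptotic expansion of `exp (-i ∂_x · ∂_ξ) τ`. -/
theorem bsFamily_symbolLim_sub (hδ : 0 ≤ δ) (hδ1 : δ < 1) (hδρ : δ ≤ ρ) (hρ : ρ ≤ 1)
    {τ : Symb n} (hτ : BSFamily m ρ δ fun _ : Unit => τ) (N : ℕ) :
    BSFamily (m + (δ - ρ) * N) ρ δ fun _ : Unit => symbolLim τ -
      ∑ j ∈ Finset.range N, ((j.factorial : ℂ))⁻¹ • mixedPow j τ := by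
  have hτs : ContDiff ℝ ∞ τ := hτ.smooth ()
  have hs := contDiff_symbolLim hδ hδ1 hδρ hρ hτ
  have hsj : ∀ j ∈ Finset.range N, ContDiff ℝ ∞ (((j.factorial : ℂ))⁻¹ • mixedPow j τ) :=
    fun j _ => contDiff_pi_smul (contDiff_mixedPow hτs j) _
  have hsum := contDiff_pi_sum _ hsj
  refine ⟨fun _ => hs.sub hsum, fun l => ?_⟩
  -- The pointwise estimate is applied to the differentiated symbol, of order m plus the cost of l.
  -- `symbolLim` and `mixedPow` commute with derivatives, so it bounds the derivative of the
  -- remainder.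
  obtain ⟨C, hC0, hC⟩ := exists_norm_symbolLim_sub_le hδ hδ1 hδρ hρ (BSFamily.iterDeriv hτ l) N
  refine ⟨C, hC0, fun _ p => ?_⟩
  have h1 : iterDeriv phaseDir l (symbolLim τ -
      ∑ j ∈ Finset.range N, ((j.factorial : ℂ))⁻¹ • mixedPow j τ) p =
      symbolLim (iterDeriv phaseDir l τ) p -
      ∑ j ∈ Finset.range N, ((j.factorial : ℂ))⁻¹ * mixedPow j (iterDeriv phaseDir l τ) p := by
    rw [sub_eq_add_neg, ← neg_one_smul ℂ (∑ j ∈ Finset.range N, _),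
      iterDeriv_add hs (contDiff_pi_smul hsum _), iterDeriv_smul hsum, iterDeriv_sum _ _ _ hsj,
      iterDeriv_symbolLim hδ hδ1 hδρ hρ hτ]
    simp only [Pi.add_apply, Pi.smul_apply, Finset.sum_apply, smul_eq_mul, neg_mul, one_mul,
      ← sub_eq_add_neg]
    congr 1
    refine Finset.sum_congr rfl fun j _ => ?_
    rw [iterDeriv_smul (contDiff_mixedPow hτs j), iterDeriv_mixedPow hτs, Pi.smul_apply,
      smul_eq_mul]
  rw [h1, ← Real.rpow_add (phaseWeight_pos p)]
  refine (hC p).trans_eq ?_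
  ring_nf

end SymbolLim

/-! ### Lists of directions versus multi-indices -/

section MultiIndexDerivatives

variable {n : ℕ}

instance {α β : Type*} [BEq α] [BEq β] [LawfulBEq α] [LawfulBEq β] : LawfulBEq (α ⊕ β) where
  rfl {a} := by
    cases a with
    | inl a => exact beq_self_eq_true a
    | inr a => exact beq_self_eq_true a
  eq_of_beq {a b} h := by
    cases a <;> cases b
    · exact congrArg Sum.inl (eq_of_beq h)
    · exact absurd h Bool.false_ne_true
    · exact absurd h Bool.false_ne_true
    · exact congrArg Sum.inr (eq_of_beq h)

/-- The list in which `i` occurs `α i` times. -/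
def MultiIndex.toList (α : MultiIndex n) : List (Fin n) :=
  ((List.finRange n).flatMap fun i => List.replicate (α i) i).reverse

theorem MultiIndex.count_toList (α : MultiIndex n) (i : Fin n) : α.toList.count i = α i := by
  rw [MultiIndex.toList, List.count_reverse, List.count_flatMap, ← Fin.sum_univ_def]
  simp [List.count_replicate]

theorem MultiIndex.length_toList (α : MultiIndex n) : α.toList.length = α.length := by
  rw [MultiIndex.toList, List.length_reverse, List.length_flatMap, ← Fin.sum_univ_def]
  simp [MultiIndex.length]

/-- The list of directions with `∂_x^α ∂_ξ^β ∂_η^γ` as its iterated derivative. -/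
def dirList (α β γ : MultiIndex n) : List (Fin n ⊕ Fin n ⊕ Fin n) :=
  γ.toList.map (fun i => Sum.inr (Sum.inr i)) ++ (β.toList.map (fun i => Sum.inr (Sum.inl i)) ++
    α.toList.map Sum.inl)

theorem count_dirList (α β γ : MultiIndex n) (d : Fin n ⊕ Fin n ⊕ Fin n) :
    (dirList α β γ).count d = Sum.elim α (Sum.elim β γ) d := by
  have h1 : Function.Injective (Sum.inl : Fin n → Fin n ⊕ Fin n ⊕ Fin n) := Sum.inl_injective
  have h2 : Function.Injective fun i : Fin n => (Sum.inr (Sum.inl i) : Fin n ⊕ Fin n ⊕ Fin n) :=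
    Sum.inr_injective.comp Sum.inl_injective
  have h3 : Function.Injective fun i : Fin n => (Sum.inr (Sum.inr i) : Fin n ⊕ Fin n ⊕ Fin n) :=
    Sum.inr_injective.comp Sum.inr_injective
  rw [dirList, List.count_append, List.count_append]
  rcases d with i | i | i
  · rw [List.count_map_of_injective _ _ h1, MultiIndex.count_toList, List.count_eq_zero_of_not_mem,
      List.count_eq_zero_of_not_mem] <;> simp
  · have := List.count_map_of_injective β.toList _ h2 i
    rw [this, MultiIndex.count_toList, List.count_eq_zero_of_not_mem,
      List.count_eq_zero_of_not_mem (l := α.toList.map _)] <;> simp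
  · have := List.count_map_of_injective γ.toList _ h3 i
    rw [this, MultiIndex.count_toList, List.count_eq_zero_of_not_mem,
      List.count_eq_zero_of_not_mem (l := α.toList.map _)] <;> simp

theorem cost_dirList (ρ δ : ℝ) (α β γ : MultiIndex n) :
    cost (phaseCost ρ δ) (dirList α β γ) =
      δ * (α.length : ℝ) - ρ * ((β.length : ℝ) + (γ.length : ℝ)) := by
  simp only [cost, dirList, List.map_append, List.map_map, List.sum_append]
  have h : ∀ (l : List (Fin n)) (f : Fin n → Fin n ⊕ Fin n ⊕ Fin n) (a : ℝ),
      (∀ i, phaseCost ρ δ (f i) = a) → (l.map (phaseCost ρ δ ∘ f)).sum = l.length * a := by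
    intro l f a hf
    have : phaseCost ρ δ ∘ f = fun _ => a := funext hf
    rw [this, List.map_const', List.sum_replicate, nsmul_eq_mul]
  rw [h _ _ (-ρ) fun _ => rfl, h _ _ (-ρ) fun _ => rfl, h _ _ δ fun _ => rfl]
  simp only [MultiIndex.length_toList]
  ring

theorem iterDeriv_replicate {V D : Type*} [NormedAddCommGroup V] [NormedSpace ℝ V] (e : D → V)
    (k : ℕ) (d : D) (F : V → ℂ) :
    iterDeriv e (List.replicate k d) F = (derivAlong (e d))^[k] F := by
  induction k generalizing F with
  | zero => rfl
  | succ k ih => exact ih _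

theorem iterDeriv_map {V D D' : Type*} [NormedAddCommGroup V] [NormedSpace ℝ V] (e : D' → V)
    (f : D → D') (l : List D) (F : V → ℂ) :
    iterDeriv e (l.map f) F = iterDeriv (fun d => e (f d)) l F := by
  induction l generalizing F with
  | nil => rfl
  | cons d l ih => exact ih _

/-- `foldr` applies the derivatives of the first index last, while `iterDeriv` applies the head of
the list first; hence the reversal in `MultiIndex.toList`. -/
theorem multiDeriv_eq_iterDeriv (v : Fin n → Phase n) (α : MultiIndex n) (F : Symb n) :
    multiDeriv v α F = iterDeriv v α.toList F := by
  rw [multiDeriv, MultiIndex.toList]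
  induction List.finRange n with
  | nil => rfl
  | cons i L ih =>
    rw [List.foldr_cons, ih, List.flatMap_cons, List.reverse_append, iterDeriv_append,
      List.reverse_replicate, iterDeriv_replicate]
    rfl

theorem partialD_eq_iterDeriv (α β γ : MultiIndex n) (F : Symb n) :
    partialD α β γ F = iterDeriv phaseDir (dirList α β γ) F := by
  rw [partialD, multiDeriv_eq_iterDeriv, multiDeriv_eq_iterDeriv, multiDeriv_eq_iterDeriv,
    dirList, iterDeriv_append, iterDeriv_append, iterDeriv_map, iterDeriv_map, iterDeriv_map]
  rfl

theorem iterDeriv_perm {V D : Type*} [NormedAddCommGroup V] [NormedSpace ℝ V] (e : D → V)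
    {l l' : List D} (h : l.Perm l') {F : V → ℂ} (hF : ContDiff ℝ ∞ F) :
    iterDeriv e l F = iterDeriv e l' F := by
  induction h generalizing F with
  | nil => rfl
  | cons d _ ih => exact ih (contDiff_derivAlong hF _)
  | swap d d' l => rw [iterDeriv_cons, iterDeriv_cons, derivAlong_comm hF]; rfl
  | trans _ _ ih ih' => rw [ih hF, ih' hF]

theorem perm_dirList (l : List (Fin n ⊕ Fin n ⊕ Fin n)) :
    l.Perm (dirList (fun i => l.count (Sum.inl i)) (fun i => l.count (Sum.inr (Sum.inl i)))
      (fun i => l.count (Sum.inr (Sum.inr i)))) := by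
  rw [List.perm_iff_count]
  intro d
  rw [count_dirList]
  rcases d with d | d | d <;> rfl

theorem cost_perm {D : Type*} (c : D → ℝ) {l l' : List D} (h : l.Perm l') :
    cost c l = cost c l' := (h.map c).sum_eq

/-- Mixed derivatives of smooth functions commute, so every list of directions may be sorted into
the order prescribed by its counts. Estimates over lists and over triples of multi-indices are
therefore the same. -/
theorem mem_BS_iff {m ρ δ : ℝ} {σ : Symb n} :
    σ ∈ BS n m ρ δ ↔ BSFamily m ρ δ fun _ : Unit => σ := by
  constructor
  · rintro ⟨hs, hb⟩
    refine ⟨fun _ => hs, fun l => ?_⟩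
    obtain ⟨C, hC0, hC⟩ := hb (fun i => l.count (Sum.inl i))
      (fun i => l.count (Sum.inr (Sum.inl i))) (fun i => l.count (Sum.inr (Sum.inr i)))
    refine ⟨C, hC0.le, fun _ p => ?_⟩
    rw [iterDeriv_perm _ (perm_dirList l) hs, ← partialD_eq_iterDeriv, cost_perm _ (perm_dirList l),
      cost_dirList, ← Real.rpow_add (phaseWeight_pos p), ← add_sub_assoc]
    exact hC p.1 p.2.1 p.2.2
  · intro h
    refine ⟨h.smooth (), fun α β γ => ?_⟩
    obtain ⟨C, hC0, hC⟩ := h.bound (dirList α β γ)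
    -- The class `BS` asks for a strictly positive constant, whereas C may be 0.
    refine ⟨C + 1, by positivity, fun x ξ η => ?_⟩
    have := hC () (x, ξ, η)
    rw [← partialD_eq_iterDeriv, cost_dirList, ← Real.rpow_add (phaseWeight_pos _),
      ← add_sub_assoc] at this
    refine this.trans (mul_le_mul_of_nonneg_right (by linarith) ?_)
    exact Real.rpow_nonneg (phaseWeight_pos (x, ξ, η)).le _

theorem mixedLap_partialD (k : Fin n) (α : MultiIndex n) {τ : Symb n} (hτ : ContDiff ℝ ∞ τ) :
    derivAlong (dirX k) (derivAlong (dirXi k) (partialD α α 0 τ)) =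
      partialD (α + Pi.single k 1) (α + Pi.single k 1) 0 τ := by
  rw [partialD_eq_iterDeriv, partialD_eq_iterDeriv]
  change iterDeriv phaseDir [Sum.inr (Sum.inl k), Sum.inl k] _ = _
  rw [← iterDeriv_append]
  refine iterDeriv_perm _ ?_ hτ
  rw [List.perm_iff_count]
  intro d
  rw [List.count_append, count_dirList, count_dirList]
  rcases d with d | d | d <;>
    simp [List.count_cons, Pi.single_apply, @eq_comm _ k]

theorem MultiIndex.fact_add_single (α : MultiIndex n) (k : Fin n) :
    (α + Pi.single k 1 : MultiIndex n).fact = (α k + 1) * α.fact := by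
  rw [fact, fact, ← Finset.mul_prod_erase _ _ (Finset.mem_univ k),
    ← Finset.mul_prod_erase Finset.univ (fun i => (α i).factorial) (Finset.mem_univ k), ← mul_assoc]
  congr 1
  · simp [Nat.factorial_succ]
  · refine Finset.prod_congr rfl fun i hi => ?_
    simp [Finset.ne_of_mem_erase hi]

theorem MultiIndex.fact_ne_zero (α : MultiIndex n) : (α.fact : ℂ) ≠ 0 :=
  Nat.cast_ne_zero.2 (Finset.prod_ne_zero_iff.2 fun _ _ => Nat.factorial_ne_zero _)

theorem MultiIndex.length_add_single (α : MultiIndex n) (k : Fin n) :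
    (α + Pi.single k 1 : MultiIndex n).length = α.length + 1 := by
  simp [length, Finset.sum_add_distrib]

theorem contDiff_partialD {τ : Symb n} (hτ : ContDiff ℝ ∞ τ) (α β γ : MultiIndex n) :
    ContDiff ℝ ∞ (partialD α β γ τ) := by
  rw [partialD_eq_iterDeriv]
  exact contDiff_iterDeriv hτ _ _

/-- Applying ∂_{x_k} ∂_{ξ_k} moves α to β = α + e_k, and 1/α! = β_k/β!. Summing over k gives the
factor |β| = j+1. -/
theorem mixedLap_sum_partialD {τ : Symb n} (hτ : ContDiff ℝ ∞ τ) (j : ℕ) :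
    mixedLap (∑ α ∈ MultiIndex.ofLength n j, (α.fact : ℂ)⁻¹ • partialD α α 0 τ) =
      ((j + 1 : ℕ) : ℂ) • ∑ α ∈ MultiIndex.ofLength n (j + 1),
        (α.fact : ℂ)⁻¹ • partialD α α 0 τ := by
  have hs := fun α : MultiIndex n => contDiff_partialD hτ α α 0
  have hk : ∀ k : Fin n, derivAlong (dirX k) (derivAlong (dirXi k)
      (∑ α ∈ MultiIndex.ofLength n j, (α.fact : ℂ)⁻¹ • partialD α α 0 τ)) =
      ∑ β ∈ MultiIndex.ofLength n (j + 1),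
        ((β k : ℂ) * (β.fact : ℂ)⁻¹) • partialD β β 0 τ := by
    intro k
    rw [derivAlong_sum _ fun α _ => contDiff_pi_smul (hs α) _,
      derivAlong_sum _ fun α _ => contDiff_derivAlong (contDiff_pi_smul (hs α) _) _]
    refine Finset.sum_of_injOn (fun α => α + Pi.single k 1) (fun a _ b _ h => add_right_cancel h)
      ?_ ?_ ?_
    · intro α hα
      rw [Finset.mem_coe, MultiIndex.mem_ofLength] at hα ⊢
      rw [MultiIndex.length_add_single, hα]
    · intro β hβ hn
      -- The multi-indices missed by the shift are those with `β k = 0`, and their coefficient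
      -- vanishes.
      rcases Nat.eq_zero_or_pos (β k) with h0 | h0
      · simp [h0]
      · refine absurd ⟨β - Pi.single k 1, ?_, ?_⟩ hn
        all_goals
          have hβk : (β - Pi.single k 1 : MultiIndex n) + Pi.single k 1 = β := by
            ext i
            rcases eq_or_ne i k with rfl | hi
            · simp; omega
            · simp [hi]
        · rw [Finset.mem_coe, MultiIndex.mem_ofLength]
          rw [MultiIndex.mem_ofLength, ← hβk, MultiIndex.length_add_single] at hβ
          omega
        · exact hβk
    · intro α _
      rw [derivAlong_smul (hs α), derivAlong_smul (contDiff_derivAlong (hs α) _),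
        mixedLap_partialD k α hτ, MultiIndex.fact_add_single]
      congr 1
      have := α.fact_ne_zero
      have h1 : (α k : ℂ) + 1 ≠ 0 := by exact_mod_cast Nat.succ_ne_zero (α k)
      simp only [Pi.add_apply, Pi.single_eq_same]
      push_cast
      field_simp
  rw [mixedLap]
  simp_rw [hk]
  rw [Finset.sum_comm, Finset.smul_sum]
  refine Finset.sum_congr rfl fun β hβ => ?_
  rw [← Finset.sum_smul, ← Finset.sum_mul, ← Nat.cast_sum, smul_smul]
  congr 3
  exact MultiIndex.mem_ofLength.1 hβ

/-- The multinomial theorem for (-i ∂_x·∂_ξ)^j / j!. It identifies the Taylor terms in t with the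
terms of the asymptotic expansion. -/
theorem sum_partialD_eq_mixedPow {τ : Symb n} (hτ : ContDiff ℝ ∞ τ) (j : ℕ) :
    ∑ α ∈ MultiIndex.ofLength n j,
      ((-Complex.I) ^ α.length / (α.fact : ℂ)) • partialD α α 0 τ =
      ((j.factorial : ℂ))⁻¹ • mixedPow j τ := by
  have h : mixedPow j τ = ((-Complex.I) ^ j * (j.factorial : ℂ)) •
      ∑ α ∈ MultiIndex.ofLength n j, (α.fact : ℂ)⁻¹ • partialD α α 0 τ := by
    induction j with
    | zero =>
      have : MultiIndex.ofLength n 0 = {0} := by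
        ext α
        simp [MultiIndex.mem_ofLength, MultiIndex.length, funext_iff]
      rw [this]
      have h : dirList (0 : MultiIndex n) 0 0 = [] := by
        simp [dirList, MultiIndex.toList]
      simp [MultiIndex.fact, partialD_eq_iterDeriv, h]
    | succ j ih =>
      have hs : ContDiff ℝ ∞
          (∑ α ∈ MultiIndex.ofLength n j, (α.fact : ℂ)⁻¹ • partialD α α 0 τ) :=
        contDiff_pi_sum _ fun α _ => contDiff_pi_smul (contDiff_partialD hτ α α 0) _
      have hl : ∀ (a : ℂ) {F : Symb n}, ContDiff ℝ ∞ F → mixedLap (a • F) = a • mixedLap F := by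
        intro a F hF
        rw [mixedLap, mixedLap, Finset.smul_sum]
        refine Finset.sum_congr rfl fun k _ => ?_
        rw [derivAlong_smul hF, derivAlong_smul (contDiff_derivAlong hF _)]
      rw [mixedPow_succ, ih, hl _ hs, mixedLap_sum_partialD hτ, smul_smul, smul_smul,
        Nat.factorial_succ, pow_succ]
      congr 1
      push_cast
      ring
  rw [h, smul_smul, Finset.smul_sum]
  refine Finset.sum_congr rfl fun α hα => ?_
  rw [smul_smul, MultiIndex.mem_ofLength.1 hα]
  congr 1
  have : (j.factorial : ℂ) ≠ 0 := Nat.cast_ne_zero.2 j.factorial_ne_zero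
  field_simp

end MultiIndexDerivatives

/-! ### Invariance under the linear changes of the frequency variables -/

section Reflections

variable {n : ℕ} {m ρ δ : ℝ}

theorem derivAlong_comp_clm {V W : Type*} [NormedAddCommGroup V] [NormedSpace ℝ V]
    [NormedAddCommGroup W] [NormedSpace ℝ W] (L : V →L[ℝ] W) {F : W → ℂ} (hF : ContDiff ℝ ∞ F)
    (v : V) : derivAlong v (F ∘ L) = derivAlong (L v) F ∘ L := by
  ext p
  have h : HasFDerivAt (F ∘ L) ((fderiv ℝ F (L p)).comp L) p :=
    ((hF.differentiable (by simp) _).hasFDerivAt).comp p L.hasFDerivAt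
  simp [derivAlong, h.fderiv]

/-- The hypothesis on derivatives along `L (phaseDir d)` says that L mixes only directions whose
cost is compatible. The weights must be comparable on both sides because m may have either sign. -/
theorem BSFamily.comp_clm (L : Phase n →L[ℝ] Phase n) {B : ℝ}
    (hL1 : ∀ p, phaseWeight (L p) ≤ B * phaseWeight p)
    (hL2 : ∀ p, phaseWeight p ≤ B * phaseWeight (L p))
    (hd : ∀ (d : Fin n ⊕ Fin n ⊕ Fin n) (m : ℝ) (F : Symb n), BSFamily m ρ δ (fun _ : Unit => F) →
      BSFamily (m + phaseCost ρ δ d) ρ δ fun _ : Unit => BilinearHormander.derivAlong (L (phaseDir d)) F)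
    {F : Symb n} (hF : BSFamily m ρ δ fun _ : Unit => F) :
    BSFamily m ρ δ fun _ : Unit => F ∘ L := by
  refine ⟨fun _ => (hF.smooth ()).comp L.contDiff, fun l => ?_⟩
  induction l generalizing m F with
  | nil =>
    obtain ⟨C, hC0, hC⟩ := hF.norm_le
    have hB : 0 < B := by
      have h1 := hL1 0
      have h2 := phaseWeight_pos (L 0)
      by_contra h
      have := phaseWeight_pos (0 : Phase n)
      nlinarith
    refine ⟨C * B ^ |m|, by positivity, fun _ p => ?_⟩
    have hp := phaseWeight_pos p
    have hLp := phaseWeight_pos (L p)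
    have key : phaseWeight (L p) ^ m ≤ B ^ |m| * phaseWeight p ^ m := by
      rcases le_total 0 m with hm | hm
      · rw [abs_of_nonneg hm, ← Real.mul_rpow hB.le hp.le]
        exact Real.rpow_le_rpow hLp.le (hL1 p) hm
      · rw [abs_of_nonpos hm]
        have h1 := Real.rpow_le_rpow_of_nonpos hp (hL2 p) hm
        rw [Real.mul_rpow hB.le hLp.le] at h1
        calc phaseWeight (L p) ^ m = B ^ (-m) * (B ^ m * phaseWeight (L p) ^ m) := by
              rw [← mul_assoc, ← Real.rpow_add hB]; simp
          _ ≤ _ := by gcongr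
    simp only [iterDeriv_nil, cost_nil, Real.rpow_zero, mul_one, Function.comp_apply]
    refine (hC () (L p)).trans ?_
    rw [mul_assoc]
    gcongr
  | cons d l ih =>
    obtain ⟨C, hC0, hC⟩ := ih (hd d m F hF)
    refine ⟨C, hC0, fun _ p => ?_⟩
    rw [iterDeriv_cons, derivAlong_comp_clm L (hF.smooth ())]
    refine (hC () p).trans_eq ?_
    rw [cost_cons, Real.rpow_add (phaseWeight_pos p), Real.rpow_add (phaseWeight_pos p), mul_assoc]

theorem derivAlong_sub_dir {V : Type*} [NormedAddCommGroup V] [NormedSpace ℝ V]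
    (v w : V) (F : V → ℂ) : derivAlong (v - w) F = derivAlong v F - derivAlong w F := by
  ext p
  simp [derivAlong]

theorem derivAlong_neg_dir {V : Type*} [NormedAddCommGroup V] [NormedSpace ℝ V]
    (v : V) (F : V → ℂ) : derivAlong (-v) F = (-1 : ℂ) • derivAlong v F := by
  ext p
  simp [derivAlong]

/-- The map `(x, ξ, η) ↦ (x, -ξ-η, η)`. -/
def reflectMap : Phase n →L[ℝ] Phase n :=
  (ContinuousLinearMap.fst ℝ _ _).prod
    (ContinuousLinearMap.prod (-((ContinuousLinearMap.fst ℝ (E n) (E n)).comp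
        (ContinuousLinearMap.snd ℝ (E n) (E n × E n))) -
      (ContinuousLinearMap.snd ℝ (E n) (E n)).comp (ContinuousLinearMap.snd ℝ (E n) (E n × E n)))
      ((ContinuousLinearMap.snd ℝ _ _).comp (ContinuousLinearMap.snd ℝ _ _)))

theorem reflectMap_apply (p : Phase n) : reflectMap p = (p.1, -p.2.1 - p.2.2, p.2.2) := rfl

theorem reflectMap_reflectMap (p : Phase n) : reflectMap (reflectMap p) = p := by
  simp [reflectMap_apply]

theorem reflectOne_reflectOne (σ : Symb n) : reflectOne (reflectOne σ) = σ := by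
  ext p
  simp [reflectOne]

theorem phaseWeight_reflectMap_le (p : Phase n) : phaseWeight (reflectMap p) ≤ 2 * phaseWeight p := by
  have h := norm_sub_le (-p.2.1) p.2.2
  rw [norm_neg] at h
  have h1 := norm_nonneg p.2.1
  simp only [phaseWeight, reflectMap_apply]
  linarith

/-- The map fixes the x-directions, sends ξ-directions to their negatives and η-directions to η-ξ,
so only directions of the same cost -ρ are mixed. It is an involution, so one weight inequality
gives both. -/
theorem bsFamily_reflectOne {σ : Symb n} (hσ : BSFamily m ρ δ fun _ : Unit => σ) :
    BSFamily m ρ δ fun _ : Unit => reflectOne σ := by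
  refine BSFamily.comp_clm reflectMap phaseWeight_reflectMap_le (fun p => ?_) ?_ hσ
  · simpa [reflectMap_reflectMap] using phaseWeight_reflectMap_le (reflectMap p)
  · rintro (d | d | d) m F hF
    · have : (reflectMap (phaseDir (Sum.inl d)) : Phase n) = phaseDir (Sum.inl d) := by
        simp [phaseDir, dirX, reflectMap_apply]
      rw [this]
      exact BSFamily.derivAlong hF _
    · have : (reflectMap (phaseDir (Sum.inr (Sum.inl d))) : Phase n) =
          -phaseDir (Sum.inr (Sum.inl d)) := by
        simp [phaseDir, dirXi, reflectMap_apply]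
      simp only [this, derivAlong_neg_dir]
      exact (BSFamily.derivAlong hF _).smul _
    · have : (reflectMap (phaseDir (Sum.inr (Sum.inr d))) : Phase n) =
          phaseDir (Sum.inr (Sum.inr d)) - phaseDir (Sum.inr (Sum.inl d)) := by
        simp [phaseDir, dirXi, dirEta, reflectMap_apply]
      simp only [this, derivAlong_sub_dir]
      exact (BSFamily.derivAlong hF (Sum.inr (Sum.inr d))).sub
        (BSFamily.derivAlong hF (Sum.inr (Sum.inl d)))

/-- The map `(x, ξ, η) ↦ (x, η, ξ)`. -/
def swapMap : Phase n →L[ℝ] Phase n :=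
  (ContinuousLinearMap.fst ℝ _ _).prod
    (((ContinuousLinearMap.snd ℝ _ _).comp (ContinuousLinearMap.snd ℝ _ _)).prod
      ((ContinuousLinearMap.fst ℝ _ _).comp (ContinuousLinearMap.snd ℝ _ _)))

@[simp] theorem swapMap_apply (p : Phase n) : swapMap p = (p.1, p.2.2, p.2.1) := rfl

/-- The exchange of the two frequency directions. -/
def swapDir : Fin n ⊕ Fin n ⊕ Fin n → Fin n ⊕ Fin n ⊕ Fin n := Sum.map id Sum.swap

theorem swapMap_phaseDir (d : Fin n ⊕ Fin n ⊕ Fin n) :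
    swapMap (phaseDir d) = phaseDir (swapDir d) := by
  rcases d with d | d | d <;> simp [phaseDir, swapDir, dirX, dirXi, dirEta]

theorem comp_swapMap_comp_swapMap (σ : Symb n) : (σ ∘ swapMap) ∘ swapMap = σ := by
  ext p
  simp

theorem bsFamily_comp_swapMap {σ : Symb n} (hσ : BSFamily m ρ δ fun _ : Unit => σ) :
    BSFamily m ρ δ fun _ : Unit => σ ∘ swapMap := by
  have h : ∀ p : Phase n, phaseWeight (swapMap p) = phaseWeight p := fun p => by
    simp only [phaseWeight, swapMap_apply]
    ring
  refine BSFamily.comp_clm swapMap (B := 1) (fun p => by rw [h, one_mul])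
    (fun p => by rw [h, one_mul]) ?_ hσ
  intro d m F hF
  rw [swapMap_phaseDir]
  have : phaseCost ρ δ d = phaseCost ρ δ (swapDir d) := by
    rcases d with d | d | d <;> rfl
  rw [this]
  exact BSFamily.derivAlong hF _

theorem comp_swapMap_mem_BS {σ : Symb n} (hσ : σ ∈ BS n m ρ δ) : σ ∘ swapMap ∈ BS n m ρ δ :=
  mem_BS_iff.2 (bsFamily_comp_swapMap (mem_BS_iff.1 hσ))

/-- Conjugation by the exchange of ξ and η reduces the second transpose to the first. -/
theorem reflectTwo_eq (σ : Symb n) : reflectTwo σ = reflectOne (σ ∘ swapMap) ∘ swapMap := by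
  ext p
  simp [reflectTwo, reflectOne, sub_eq_add_neg, add_comm]

theorem partialD_comp_swapMap {F : Symb n} (hF : ContDiff ℝ ∞ F) (α β γ : MultiIndex n) :
    partialD α β γ (F ∘ swapMap) = partialD α γ β F ∘ swapMap := by
  have h : ∀ {l : List (Fin n ⊕ Fin n ⊕ Fin n)} {F : Symb n}, ContDiff ℝ ∞ F →
      iterDeriv phaseDir l (F ∘ swapMap) = iterDeriv phaseDir (l.map swapDir) F ∘ swapMap := by
    intro l
    induction l with
    | nil => intros; rfl
    | cons d l ih =>
      intro F hF
      rw [iterDeriv_cons, derivAlong_comp_clm _ hF, ih (contDiff_derivAlong hF _),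
        swapMap_phaseDir]
      rfl
  rw [partialD_eq_iterDeriv, h hF, partialD_eq_iterDeriv]
  congr 1
  refine iterDeriv_perm _ ?_ hF
  have hinv : Function.Involutive (swapDir : Fin n ⊕ Fin n ⊕ Fin n → _) := by
    rintro (d | d | d) <;> rfl
  rw [List.perm_iff_count]
  intro d
  obtain ⟨d, rfl⟩ := hinv.surjective d
  rw [List.count_map_of_injective _ _ hinv.injective, count_dirList, count_dirList]
  rcases d with d | d | d <;> rfl

theorem termOne_eq {σ : Symb n} (hσ : ContDiff ℝ ∞ σ) (j : ℕ) :
    termOne σ j = ((j.factorial : ℂ))⁻¹ • mixedPow j (reflectOne σ) :=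
  sum_partialD_eq_mixedPow (hσ.comp reflectMap.contDiff) j

theorem termTwo_eq {σ : Symb n} (hσ : ContDiff ℝ ∞ σ) (j : ℕ) :
    termTwo σ j = termOne (σ ∘ swapMap) j ∘ swapMap := by
  have hs : ContDiff ℝ ∞ (reflectOne (σ ∘ swapMap)) :=
    (hσ.comp swapMap.contDiff).comp reflectMap.contDiff
  ext p
  simp only [termTwo, termOne, Function.comp_apply, Finset.sum_apply, Pi.smul_apply]
  refine Finset.sum_congr rfl fun α _ => ?_
  rw [reflectTwo_eq, partialD_comp_swapMap hs]
  rfl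

end Reflections

/-! ### The pairing ⟨T_σ(f,g),h⟩ and the transposition formula -/

section Pairing

variable {n : ℕ} {m ρ δ : ℝ}

/-- The kernel against which the symbol is integrated in `⟨T_σ(f, g), h⟩`. -/
def opKernel (f g h : SchwartzMap (E n) ℂ) (p : Phase n) : ℂ :=
  fourierHat f p.2.1 * fourierHat g p.2.2 *
    Complex.exp (Complex.I * ((inner ℝ p.1 (p.2.1 + p.2.2) : ℝ) : ℂ)) * h p.1

theorem continuous_fourierHat (f : SchwartzMap (E n) ℂ) : Continuous (fourierHat f) := by
  have : fourierHat f = schwartzHat f := by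
    ext ξ
    simp
  rw [this]
  exact (schwartzHat f).continuous

theorem continuous_opKernel (f g h : SchwartzMap (E n) ℂ) : Continuous (opKernel f g h) := by
  have h1 := continuous_fourierHat f
  have h2 := continuous_fourierHat g
  have h3 := h.continuous
  unfold opKernel
  fun_prop

theorem norm_opKernel (f g h : SchwartzMap (E n) ℂ) (p : Phase n) :
    ‖opKernel f g h p‖ = ‖h p.1‖ * (‖fourierHat f p.2.1‖ * ‖fourierHat g p.2.2‖) := by
  rw [opKernel, norm_mul, norm_mul, norm_mul, norm_cexp_I]
  ring

theorem integrable_one_add_norm_pow_mul (f : SchwartzMap (E n) ℂ) (N : ℕ) :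
    Integrable fun x => (1 + ‖x‖) ^ N * ‖f x‖ := by
  have h1 := ((f.integrable_pow_mul volume 0).add (f.integrable_pow_mul volume N)).const_mul
    (2 ^ (N - 1))
  refine h1.mono' (Continuous.aestronglyMeasurable (by have := f.continuous; fun_prop))
    (Eventually.of_forall fun x => ?_)
  rw [Real.norm_of_nonneg (by positivity)]
  have := add_pow_le zero_le_one (norm_nonneg x) N
  calc (1 + ‖x‖) ^ N * ‖f x‖ ≤ 2 ^ (N - 1) * (1 ^ N + ‖x‖ ^ N) * ‖f x‖ := by gcongr
    _ = _ := by
      simp only [Pi.add_apply, pow_zero, one_pow]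
      ring

/-- The weight is at most (1+|ξ|)(1+|η|), so its growth is split between the rapidly decreasing f̂
and ĝ, while h handles x. -/
theorem integrable_phaseWeight_rpow_mul_norm_opKernel (f g h : SchwartzMap (E n) ℂ) (m : ℝ) :
    Integrable fun p => phaseWeight p ^ m * ‖opKernel f g h p‖ := by
  obtain ⟨N, hN⟩ := exists_nat_ge m
  have h1 := (h.integrable (μ := volume)).norm.mul_prod
    ((integrable_one_add_norm_pow_mul (schwartzHat f) N).mul_prod
      (integrable_one_add_norm_pow_mul (schwartzHat g) N))
  refine h1.mono' ?_ (Eventually.of_forall fun p => ?_)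
  · refine Continuous.aestronglyMeasurable (Continuous.mul (Continuous.rpow_const ?_ fun p =>
      Or.inl (phaseWeight_pos p).ne') (continuous_opKernel f g h).norm)
    unfold phaseWeight
    fun_prop
  · have hw := phaseWeight_pos p
    rw [Real.norm_of_nonneg (by positivity), norm_opKernel]
    simp only [schwartzHat_apply]
    have h2 : phaseWeight p ^ m ≤ ((1 + ‖p.2.1‖) * (1 + ‖p.2.2‖)) ^ N := by
      refine (Real.rpow_le_rpow_of_exponent_le (one_le_phaseWeight p) hN).trans ?_
      rw [Real.rpow_natCast]
      refine pow_le_pow_left₀ hw.le ?_ _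
      have := norm_nonneg p.2.1
      have := norm_nonneg p.2.2
      simp only [phaseWeight]
      nlinarith
    calc _ ≤ ((1 + ‖p.2.1‖) * (1 + ‖p.2.2‖)) ^ N *
          (‖h p.1‖ * (‖fourierHat f p.2.1‖ * ‖fourierHat g p.2.2‖)) := by gcongr
      _ = _ := by
        rw [mul_pow]
        ring

theorem integrable_mul_opKernel {σ : Symb n} (hσ : Continuous σ) {C : ℝ}
    (hC : ∀ p, ‖σ p‖ ≤ C * phaseWeight p ^ m) (f g h : SchwartzMap (E n) ℂ) :
    Integrable fun p => σ p * opKernel f g h p := by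
  refine ((integrable_phaseWeight_rpow_mul_norm_opKernel f g h m).const_mul C).mono'
    (hσ.mul (continuous_opKernel f g h)).aestronglyMeasurable (Eventually.of_forall fun p => ?_)
  rw [norm_mul, ← mul_assoc]
  exact mul_le_mul_of_nonneg_right (hC p) (norm_nonneg _)

theorem integral_opT_mul {σ : Symb n} {f g h : SchwartzMap (E n) ℂ}
    (hi : Integrable fun p => σ p * opKernel f g h p) :
    ∫ x, opT σ f g x * h x = ∫ p, σ p * opKernel f g h p := by
  refine Eq.symm ((integral_prod _ hi).trans ?_)
  refine integral_congr_ae ?_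
  filter_upwards [Integrable.prod_right_ae hi] with x hx
  refine (integral_prod _ hx).trans ?_
  rw [opT, ← integral_mul_const]
  refine integral_congr_ae (Eventually.of_forall fun ξ => ?_)
  beta_reduce
  rw [← integral_mul_const]
  refine integral_congr_ae (Eventually.of_forall fun η => ?_)
  simp only [opKernel]
  ring

/-- η is made the outer variable because the first transposition acts on (x,ξ) only. -/
theorem integral_phase_eq {F : Symb n} (hF : Integrable F) :
    ∫ p, F p = ∫ η, ∫ u : E n × E n, F (u.1, u.2, η) := by
  have hmp : MeasurePreserving (MeasurableEquiv.prodAssoc : (E n × E n) × E n ≃ᵐ Phase n)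
      volume volume := volume_preserving_prodAssoc
  rw [← hmp.integral_comp' F]
  exact integral_prod_symm _
    ((hmp.integrable_comp_emb MeasurableEquiv.prodAssoc.measurableEmbedding).2 hF)

theorem oscOp_one_eq {τ : Symb n} (hτ : Continuous τ) (hc : HasCompactSupport τ)
    (x ξ η : E n) :
    oscOp 1 τ (x, ξ, η) = (((2 * Real.pi) ^ n : ℝ) : ℂ)⁻¹ *
      ∫ w : OscSpace n, oscFactor (w - (x, ξ)) * τ (w.1, w.2, η) := by
  rw [oscOp_eq_integral_scaleMap hτ hc one_pos one_pos,
    ← integral_add_right_eq_self (fun w : OscSpace n => oscFactor (w - (x, ξ)) * τ (w.1, w.2, η))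
      (x, ξ)]
  congr 2
  ext w
  rw [add_sub_cancel_right]
  congr 2
  ext <;> simp [add_comm]

/-- The substitution ξ → -η-ξ removes the reflection from the symbol and turns the phase x·(ξ+η)
into -x·ξ. -/
theorem integral_reflectOne_slice (τ : Symb n) (f g h : SchwartzMap (E n) ℂ) (η : E n) :
    ∫ u : E n × E n, reflectOne τ (u.1, u.2, η) * opKernel f g h (u.1, u.2, η) =
      ∫ w : E n × E n, τ (w.1, w.2, η) * (fourierHat f (-w.2 - η) * fourierHat g η *
        Complex.exp (-Complex.I * ((inner ℝ w.1 w.2 : ℝ) : ℂ)) * h w.1) := by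
  set G : E n × E n → ℂ := fun w => τ (w.1, w.2, η) * (fourierHat f (-w.2 - η) * fourierHat g η *
        Complex.exp (-Complex.I * ((inner ℝ w.1 w.2 : ℝ) : ℂ)) * h w.1) with hG
  have hmp : MeasurePreserving (fun u : E n × E n => (u.1, -η - u.2)) volume volume :=
    (MeasurePreserving.id volume).prod (Measure.measurePreserving_sub_left volume (-η))
  have hme : MeasurableEmbedding (fun u : E n × E n => (u.1, -η - u.2)) :=
    ((Homeomorph.refl (E n)).prodCongr (Homeomorph.subLeft (-η))).measurableEmbedding
  rw [← hmp.integral_comp hme G]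
  refine integral_congr_ae (Eventually.of_forall fun u => ?_)
  have h1 : -u.2 - η = -η - u.2 := by abel
  have h2 : -(-η - u.2) - η = u.2 := by abel
  have h3 : -Complex.I * ((inner ℝ u.1 (-η - u.2) : ℝ) : ℂ) =
      Complex.I * ((inner ℝ u.1 (u.2 + η) : ℝ) : ℂ) := by
    rw [show -η - u.2 = -(u.2 + η) by abel, inner_neg_right]
    push_cast
    ring
  simp only [hG, reflectOne, opKernel, h1, h2, h3]

/-- The phases recombine so that the variables separate: the x-integral is (2π)ⁿ f̂(-ζ-η), and the
ξ-integral recovers h(y) by Fourier inversion. -/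
theorem integral_cexp_mul_fourier (f h : SchwartzMap (E n) ℂ) (η y ζ : E n) :
    ∫ u : E n × E n, oscFactor (((y, ζ) : OscSpace n) - u) *
      (fourierHat h u.2 * Complex.exp (Complex.I * ((inner ℝ u.1 (u.2 + η) : ℝ) : ℂ)) * f u.1) =
      (((2 * Real.pi) ^ n : ℝ) : ℂ) * (fourierHat f (-ζ - η) *
        Complex.exp (-Complex.I * ((inner ℝ y ζ : ℝ) : ℂ)) * h y) := by
  have h1 : ∀ u : E n × E n, oscFactor (((y, ζ) : OscSpace n) - u) *
      (fourierHat h u.2 * Complex.exp (Complex.I * ((inner ℝ u.1 (u.2 + η) : ℝ) : ℂ)) * f u.1) =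
      Complex.exp (-Complex.I * ((inner ℝ y ζ : ℝ) : ℂ)) *
      ((f u.1 * Complex.exp (-Complex.I * ((inner ℝ u.1 (-ζ - η) : ℝ) : ℂ))) *
        (fourierHat h u.2 * Complex.exp (Complex.I * ((inner ℝ y u.2 : ℝ) : ℂ)))) := by
    intro u
    have : oscFactor (((y, ζ) : OscSpace n) - u) *
        Complex.exp (Complex.I * ((inner ℝ u.1 (u.2 + η) : ℝ) : ℂ)) =
        Complex.exp (-Complex.I * ((inner ℝ y ζ : ℝ) : ℂ)) *
        Complex.exp (-Complex.I * ((inner ℝ u.1 (-ζ - η) : ℝ) : ℂ)) *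
        Complex.exp (Complex.I * ((inner ℝ y u.2 : ℝ) : ℂ)) := by
      rw [oscFactor, ← Complex.exp_add, ← Complex.exp_add, ← Complex.exp_add]
      congr 1
      simp only [oscPhase, Prod.fst_sub, Prod.snd_sub, inner_sub_left, inner_sub_right,
        inner_add_right, inner_neg_right]
      push_cast
      ring
    linear_combination (fourierHat h u.2 * f u.1) * this
  simp_rw [h1]
  rw [integral_const_mul]
  have h2 := integral_prod_mul (μ := (volume : Measure (E n))) (ν := (volume : Measure (E n)))
    (fun x => f x * Complex.exp (-Complex.I * ((inner ℝ x (-ζ - η) : ℝ) : ℂ)))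
    (fun ξ => fourierHat h ξ * Complex.exp (Complex.I * ((inner ℝ y ξ : ℝ) : ℂ)))
  rw [integral_fourierHat_mul_cexp] at h2
  refine (congrArg _ h2).trans ?_
  rw [fourierHat, mul_assoc, mul_assoc, mul_inv_cancel_left₀ two_pi_pow_ne_zero]
  ring

/-- With η fixed, compact support of τ makes the double integrand absolutely integrable. After the
exchange of integrals the inner one is `integral_cexp_mul_fourier`, whose (2π)ⁿ cancels the constant
in `oscOp`. -/
theorem integral_oscOp_slice {τ : Symb n} (hτ : Continuous τ) (hc : HasCompactSupport τ)
    (f g h : SchwartzMap (E n) ℂ) (η : E n) :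
    ∫ u : E n × E n, oscOp 1 τ (u.1, u.2, η) * opKernel h g f (u.1, u.2, η) =
      ∫ w : E n × E n, τ (w.1, w.2, η) * (fourierHat f (-w.2 - η) * fourierHat g η *
        Complex.exp (-Complex.I * ((inner ℝ w.1 w.2 : ℝ) : ℂ)) * h w.1) := by
  set a : E n × E n → ℂ := fun u => fourierHat h u.2 *
    Complex.exp (Complex.I * ((inner ℝ u.1 (u.2 + η) : ℝ) : ℂ)) * f u.1 with ha
  have hcf := f.continuous
  have hch := continuous_fourierHat h
  have hac : Continuous a := by
    clear hτ hc
    rw [ha]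
    fun_prop
  have hai : Integrable a := by
    have h1 := (f.integrable (μ := volume)).norm.mul_prod
      ((schwartzHat h).integrable (μ := volume)).norm
    refine h1.mono' hac.aestronglyMeasurable (Eventually.of_forall fun u => ?_)
    simp only [ha, norm_mul, norm_cexp_I, schwartzHat_apply]
    exact le_of_eq (by ring)
  have hτc : Continuous fun w : E n × E n => τ (w.1, w.2, η) :=
    hτ.comp (continuous_fst.prodMk (continuous_snd.prodMk continuous_const))
  have hτi : Integrable fun w : E n × E n => τ (w.1, w.2, η) := by
    have hemb : IsClosedEmbedding fun w : E n × E n => ((w.1, w.2, η) : Phase n) :=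
      Function.LeftInverse.isClosedEmbedding (f := fun p : Phase n => (p.1, p.2.1))
        (fun _ => rfl) (by fun_prop) (by fun_prop)
    exact hτc.integrable_of_hasCompactSupport (hc.comp_isClosedEmbedding hemb)
  have hK : Integrable (Function.uncurry fun (u w : E n × E n) =>
      (oscFactor (w - u : OscSpace n) * a u) * τ (w.1, w.2, η)) (volume.prod volume) := by
    refine (hai.norm.mul_prod hτi.norm).mono' (Continuous.aestronglyMeasurable ?_)
      (Eventually.of_forall fun z => ?_)
    · have := continuous_oscFactor (n := n)
      have hz : Continuous fun z : (E n × E n) × (E n × E n) =>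
          oscFactor (z.2 - z.1 : OscSpace n) := this.comp (continuous_snd.sub continuous_fst)
      exact (hz.mul (hac.comp continuous_fst)).mul (hτc.comp continuous_snd)
    · simp only [Function.uncurry]
      rw [norm_mul, norm_mul, norm_oscFactor, one_mul]
  calc _ = ∫ u : E n × E n, ((((2 * Real.pi) ^ n : ℝ) : ℂ)⁻¹ * fourierHat g η) *
        ∫ w : E n × E n, (oscFactor (w - u : OscSpace n) * a u) * τ (w.1, w.2, η) := by
        refine integral_congr_ae (Eventually.of_forall fun u => ?_)
        beta_reduce
        have h1 : ∫ w : E n × E n, (oscFactor (w - u : OscSpace n) * a u) * τ (w.1, w.2, η) =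
            (∫ w : OscSpace n, oscFactor (w - u) * τ (w.1, w.2, η)) * a u := by
          rw [← integral_mul_const]
          refine integral_congr_ae (Eventually.of_forall fun w => ?_)
          ring
        rw [oscOp_one_eq hτ hc, h1]
        simp only [opKernel, ha]
        ring
    _ = ((((2 * Real.pi) ^ n : ℝ) : ℂ)⁻¹ * fourierHat g η) * ∫ w : E n × E n,
        ∫ u : E n × E n, (oscFactor (w - u : OscSpace n) * a u) * τ (w.1, w.2, η) := by
        rw [integral_const_mul, integral_integral_swap hK]
    _ = _ := by
        rw [← integral_const_mul]
        refine integral_congr_ae (Eventually.of_forall fun w => ?_)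
        beta_reduce
        rw [integral_mul_const]
        have h1 := integral_cexp_mul_fourier f h η w.1 w.2
        rw [ha, h1]
        have := two_pi_pow_ne_zero (n := n)
        field_simp

/-- The first transpose of an operator with a compactly supported symbol. -/
theorem integral_reflectOne_mul_opKernel {τ : Symb n} (hτ : Continuous τ)
    (hc : HasCompactSupport τ) {f g h : SchwartzMap (E n) ℂ}
    (h1 : Integrable fun p => reflectOne τ p * opKernel f g h p)
    (h2 : Integrable fun p => oscOp 1 τ p * opKernel h g f p) :
    ∫ p, reflectOne τ p * opKernel f g h p = ∫ p, oscOp 1 τ p * opKernel h g f p := by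
  rw [integral_phase_eq h1, integral_phase_eq h2]
  simp_rw [integral_reflectOne_slice, integral_oscOp_slice hτ hc]

/-- The formula for compactly supported symbols is applied to the cut-off reflected symbol. On both
sides the symbols are O(λ^m) uniformly in k and converge pointwise, so dominated convergence
applies. -/
theorem isTransposeOne_symbolLim (hδ : 0 ≤ δ) (hδ1 : δ < 1) (hδρ : δ ≤ ρ) (hρ : ρ ≤ 1)
    {σ : Symb n} (hσ : BSFamily m ρ δ fun _ : Unit => σ) :
    IsTransposeOne (opT σ) (opT (symbolLim (reflectOne σ))) := by
  intro f g h
  have hτ := bsFamily_reflectOne hσ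
  set τ := reflectOne σ with hτdef
  have hs : BSFamily m ρ δ fun _ : Unit => symbolLim τ := by
    simpa using bsFamily_symbolLim_sub hδ hδ1 hδρ hρ hτ 0
  have happ := isApprox_cutoff_mul hδ hρ hτ
  obtain ⟨C, hC0, hC⟩ := hσ.norm_le
  obtain ⟨C', hC0', hC'⟩ := hs.norm_le
  obtain ⟨C₁, hC₁0, hC₁⟩ := exists_norm_oscOp_le hδ hδ1 hδρ happ.family happ.compact
  obtain ⟨M, hM0, hM⟩ := (bsFamily_cutoff (n := n) hδ hρ).norm_le
  -- The reflection is an involution, so reflecting the truncated τ gives σ times a reflected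
  -- cutoff, which tends to σ.
  have hcR : ∀ k, reflectOne (cutoff n k * τ) = fun p => cutoff n k (reflectMap p) * σ p := by
    intro k
    ext p
    change cutoff n k (reflectMap p) * reflectOne (reflectOne σ) p = _
    rw [reflectOne_reflectOne]
  have hcont : ∀ k, Continuous (reflectOne (cutoff n k * τ)) := fun k =>
    (happ.family.smooth k).continuous.comp reflectMap.continuous
  have hbd : ∀ k p, ‖reflectOne (cutoff n k * τ) p‖ ≤ (M * C) * phaseWeight p ^ m := by
    intro k p
    have h1 := hM k (reflectMap p)
    rw [Real.rpow_zero, mul_one] at h1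
    rw [hcR, norm_mul, mul_assoc]
    exact mul_le_mul h1 (hC () p) (norm_nonneg _) hM0
  have hocont : ∀ k, Continuous (oscOp 1 (cutoff n k * τ)) := fun k =>
    continuous_iff_continuousAt.2 fun p =>
      (hasFDerivAt_oscOp (happ.family.smooth k) (happ.compact k) p).continuousAt
  have hobd : ∀ k p, ‖oscOp 1 (cutoff n k * τ) p‖ ≤ C₁ * phaseWeight p ^ m := fun k p =>
    hC₁ k 1 (by simp) p
  rw [integral_opT_mul (integrable_mul_opKernel (hσ.smooth ()).continuous (hC ()) f g h),
    integral_opT_mul (integrable_mul_opKernel (hs.smooth ()).continuous (hC' ()) h g f)]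
  have hdct : ∀ {K : ℕ → Symb n} {κ : Symb n} {B : ℝ} (f g h : SchwartzMap (E n) ℂ),
      (∀ k, Continuous (K k)) → (∀ k p, ‖K k p‖ ≤ B * phaseWeight p ^ m) →
      (∀ p, Tendsto (fun k => K k p) atTop (𝓝 (κ p))) →
      Tendsto (fun k => ∫ p, K k p * opKernel f g h p) atTop
        (𝓝 (∫ p, κ p * opKernel f g h p)) := by
    intro K κ B f g h hKc hKb hKt
    refine tendsto_integral_of_dominated_convergence
      (fun p => B * (phaseWeight p ^ m * ‖opKernel f g h p‖))
      (fun k => ((hKc k).mul (continuous_opKernel f g h)).aestronglyMeasurable)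
      ((integrable_phaseWeight_rpow_mul_norm_opKernel f g h m).const_mul B)
      (fun k => Eventually.of_forall fun p => ?_)
      (Eventually.of_forall fun p => (hKt p).mul_const _)
    rw [norm_mul, ← mul_assoc]
    exact mul_le_mul_of_nonneg_right (hKb k p) (norm_nonneg _)
  have t1 := hdct (κ := σ) f g h hcont hbd fun p => by
    refine Tendsto.congr' ?_ tendsto_const_nhds
    filter_upwards [cutoff_eventuallyEq_one (reflectMap p)] with k hk
    rw [hcR]
    beta_reduce
    rw [hk.eq_of_nhds, Pi.one_apply, one_mul]
  have t2 := hdct h g f hocont hobd (happ.tendsto hδ hδ1 hδρ hρ hτ)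
  refine tendsto_nhds_unique t1 (t2.congr fun k => ?_)
  exact (integral_reflectOne_mul_opKernel (happ.family.smooth k).continuous (happ.compact k)
    (integrable_mul_opKernel (hcont k) (hbd k) f g h)
    (integrable_mul_opKernel (hocont k) (hobd k) h g f)).symm

end Pairing

/-! ### A symbol is determined by its bilinear operator -/

section Uniqueness

variable {n : ℕ} {m m' ρ δ : ℝ}

/-- A smooth bump function as a Schwartz function. -/
def bumpSchwartz {c : E n} (b : ContDiffBump c) : SchwartzMap (E n) ℂ :=
  (b.hasCompactSupport.comp_left (g := fun x : ℝ => (x : ℂ)) rfl).toSchwartzMap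
    (Complex.ofRealCLM.contDiff.comp b.contDiff)

theorem bumpSchwartz_apply {c : E n} (b : ContDiffBump c) (x : E n) :
    bumpSchwartz b x = (b x : ℂ) := rfl

/-- A continuous function which is orthogonal to the tensor products of Schwartz functions
vanishes. -/
theorem eq_zero_of_integral_mul_schwartz {ν : Symb n} (hν : Continuous ν)
    (h : ∀ a b c : SchwartzMap (E n) ℂ, ∫ p : Phase n, ν p * (a p.1 * b p.2.1 * c p.2.2) = 0) :
    ν = 0 := by
  by_contra hne
  obtain ⟨p₀, hp₀⟩ := Function.ne_iff.1 hne
  rw [Pi.zero_apply] at hp₀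
  -- Rotating ν by the conjugate of its value at p₀ makes the real part positive near p₀, so a
  -- nonnegative bump detects it.
  set u : Phase n → ℝ := fun p => (starRingEnd ℂ (ν p₀) * ν p).re with hu
  have huc : Continuous u := Complex.continuous_re.comp (continuous_const.mul hν)
  have hu0 : 0 < u p₀ := by
    simp only [hu]
    rw [← Complex.normSq_eq_conj_mul_self, Complex.ofReal_re]
    exact Complex.normSq_pos.2 hp₀
  obtain ⟨r, hr, hball⟩ := Metric.isOpen_iff.1 (isOpen_lt continuous_const huc) p₀ hu0
  -- The product carries the maximum distance, so three bumps of equal radius multiply to one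
  -- supported in a ball of that radius.
  have bump : ∀ c : E n, ∃ b : ContDiffBump c, b.rOut = r := fun c =>
    ⟨⟨r / 2, r, by positivity, by linarith⟩, rfl⟩
  obtain ⟨a, ha⟩ := bump p₀.1
  obtain ⟨b, hb⟩ := bump p₀.2.1
  obtain ⟨c, hc⟩ := bump p₀.2.2
  set B : Phase n → ℝ := fun p => a p.1 * b p.2.1 * c p.2.2 with hB
  have hB0 : ∀ p, 0 ≤ B p := fun p => mul_nonneg (mul_nonneg a.nonneg b.nonneg) c.nonneg
  have hBc : Continuous B :=
    ((a.continuous.comp continuous_fst).mul (b.continuous.comp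
      (continuous_fst.comp continuous_snd))).mul (c.continuous.comp
      (continuous_snd.comp continuous_snd))
  have hBr : ∀ p, B p ≠ 0 → p ∈ Metric.ball p₀ r := by
    intro p hp
    simp only [hB, mul_ne_zero_iff] at hp
    have h1 : p.1 ∈ Metric.ball p₀.1 r := by
      rw [← ha, ← a.support_eq]
      exact hp.1.1
    have h2 : p.2.1 ∈ Metric.ball p₀.2.1 r := by
      rw [← hb, ← b.support_eq]
      exact hp.1.2
    have h3 : p.2.2 ∈ Metric.ball p₀.2.2 r := by
      rw [← hc, ← c.support_eq]
      exact hp.2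
    rw [Metric.mem_ball] at h1 h2 h3 ⊢
    rw [Prod.dist_eq, Prod.dist_eq]
    exact max_lt h1 (max_lt h2 h3)
  have hBs : HasCompactSupport B :=
    HasCompactSupport.of_support_subset_isCompact (isCompact_closedBall p₀ r)
      fun p hp => Metric.ball_subset_closedBall (hBr p hp)
  have : (volume : Measure (E n × E n)).IsOpenPosMeasure := inferInstanceAs
    ((volume : Measure (E n)).prod (volume : Measure (E n))).IsOpenPosMeasure
  have : (volume : Measure (Phase n)).IsOpenPosMeasure := inferInstanceAs
    ((volume : Measure (E n)).prod (volume : Measure (E n × E n))).IsOpenPosMeasure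
  have hpos : 0 < ∫ p, u p * B p := by
    refine (huc.mul hBc).integral_pos_of_hasCompactSupport_nonneg_nonzero (x := p₀) hBs.mul_left
      (fun p => ?_) (mul_ne_zero hu0.ne' ?_)
    · by_cases hp : B p = 0
      · simp [hp]
      · exact mul_nonneg (hball (hBr p hp)).le (hB0 p)
    · have h1 := a.pos_of_mem_ball (Metric.mem_ball_self a.rOut_pos)
      have h2 := b.pos_of_mem_ball (Metric.mem_ball_self b.rOut_pos)
      have h3 := c.pos_of_mem_ball (Metric.mem_ball_self c.rOut_pos)
      exact (mul_pos (mul_pos h1 h2) h3).ne'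
  have hz := h (bumpSchwartz a) (bumpSchwartz b) (bumpSchwartz c)
  have hint : Integrable fun p => starRingEnd ℂ (ν p₀) * (ν p * (B p : ℂ)) :=
    Continuous.integrable_of_hasCompactSupport
      (continuous_const.mul (hν.mul (Complex.continuous_ofReal.comp hBc)))
      (((hBs.comp_left (g := fun x : ℝ => (x : ℂ)) rfl).mul_left (f := ν)).mul_left)
  have h1 : ∫ p, u p * B p = (∫ p, starRingEnd ℂ (ν p₀) * (ν p * (B p : ℂ))).re := by
    rw [← RCLike.re_eq_complex_re, ← integral_re hint]
    refine integral_congr_ae (Eventually.of_forall fun p => ?_)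
    simp only [hu, RCLike.re_eq_complex_re]
    rw [← mul_assoc (starRingEnd ℂ (ν p₀)), Complex.re_mul_ofReal]
  have h2 : ∫ p, ν p * (B p : ℂ) = 0 := by
    rw [← hz]
    refine integral_congr_ae (Eventually.of_forall fun p => ?_)
    simp [hB, bumpSchwartz_apply]
  rw [h1, integral_const_mul, h2, mul_zero, Complex.zero_re] at hpos
  exact lt_irrefl _ hpos

/-- A symbol is determined by its operator. -/
theorem eq_of_integral_opT_mul_eq {σ τ : Symb n} (hσ : BSFamily m ρ δ fun _ : Unit => σ)
    (hτ : BSFamily m' ρ δ fun _ : Unit => τ)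
    (h : ∀ f g k : SchwartzMap (E n) ℂ, ∫ x, opT τ f g x * k x = ∫ x, opT σ f g x * k x) :
    τ = σ := by
  obtain ⟨C, -, hC⟩ := hσ.norm_le
  obtain ⟨C', -, hC'⟩ := hτ.norm_le
  have hcσ := (hσ.smooth ()).continuous
  have hcτ := (hτ.smooth ()).continuous
  have hcexp : Continuous fun p : Phase n =>
      Complex.exp (Complex.I * ((inner ℝ p.1 (p.2.1 + p.2.2) : ℝ) : ℂ)) := by fun_prop
  -- The exponential never vanishes and is absorbed into ν. Every Schwartz function is a Fourier
  -- transform, so the kernels `opKernel` provide all tensor products.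
  have key := eq_zero_of_integral_mul_schwartz (ν := fun p => (τ p - σ p) *
    Complex.exp (Complex.I * ((inner ℝ p.1 (p.2.1 + p.2.2) : ℝ) : ℂ)))
    ((hcτ.sub hcσ).mul hcexp) fun k F G => by
      obtain ⟨f, rfl⟩ := exists_schwartzHat_eq F
      obtain ⟨g, rfl⟩ := exists_schwartzHat_eq G
      have i1 := integrable_mul_opKernel hcτ (hC' ()) f g k
      have i2 := integrable_mul_opKernel hcσ (hC ()) f g k
      have h0 := h f g k
      rw [integral_opT_mul i1, integral_opT_mul i2, ← sub_eq_zero, ← integral_sub i1 i2] at h0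
      rw [← h0]
      refine integral_congr_ae (Eventually.of_forall fun p => ?_)
      simp only [opKernel, schwartzHat_apply]
      ring
  ext p
  have := congrFun key p
  simpa [sub_eq_zero] using this

end Uniqueness

/-! ### Assembly of both transposes -/

section Transposes

variable {n : ℕ} {m ρ δ : ℝ}

theorem opT_comp_swapMap_integral {σ : Symb n} (hσ : BSFamily m ρ δ fun _ : Unit => σ)
    (f g h : SchwartzMap (E n) ℂ) :
    ∫ x, opT (σ ∘ swapMap) f g x * h x = ∫ x, opT σ g f x * h x := by
  obtain ⟨C, -, hC⟩ := hσ.norm_le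
  obtain ⟨C', -, hC'⟩ := (bsFamily_comp_swapMap hσ).norm_le
  rw [integral_opT_mul (integrable_mul_opKernel (hσ.smooth ()).continuous (hC ()) g f h),
    integral_opT_mul (integrable_mul_opKernel ((bsFamily_comp_swapMap hσ).smooth ()).continuous
      (hC' ()) f g h)]
  have hmp : MeasurePreserving (fun p : Phase n => swapMap p) volume volume :=
    (MeasurePreserving.id volume).prod Measure.measurePreserving_swap
  have hme : MeasurableEmbedding (fun p : Phase n => swapMap p) :=
    ((Homeomorph.refl (E n)).prodCongr (Homeomorph.prodComm (E n) (E n))).measurableEmbedding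
  rw [← hmp.integral_comp hme]
  refine integral_congr_ae (Eventually.of_forall fun p => ?_)
  simp only [opKernel, swapMap_apply, Function.comp_apply, add_comm p.2.2]
  ring

/-- Exchanging the frequency variables of a symbol exchanges the arguments of its operator, so the
second transpose becomes a first transpose. -/
theorem isTransposeTwo_iff {σ τ : Symb n} {m' : ℝ} (hσ : BSFamily m ρ δ fun _ : Unit => σ)
    (hτ : BSFamily m' ρ δ fun _ : Unit => τ) :
    IsTransposeTwo (opT σ) (opT τ) ↔ IsTransposeOne (opT (σ ∘ swapMap)) (opT (τ ∘ swapMap)) := by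
  constructor
  · intro h f g k
    rw [opT_comp_swapMap_integral hσ, opT_comp_swapMap_integral hτ]
    exact h g f k
  · intro h f g k
    have := h g f k
    rwa [opT_comp_swapMap_integral hσ, opT_comp_swapMap_integral hτ] at this

/-- The first transpose, its uniqueness and its asymptotic expansion. -/
theorem exists_transposeOne (hδ : 0 ≤ δ) (hδρ : δ < ρ) (hρ : ρ ≤ 1) {σ : Symb n}
    (hσ : σ ∈ BS n m ρ δ) :
    ∃ σ₁ ∈ BS n m ρ δ, IsTransposeOne (opT σ) (opT σ₁) ∧
      (∀ m' : ℝ, ∀ τ ∈ BS n m' ρ δ, IsTransposeOne (opT σ) (opT τ) → τ = σ₁) ∧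
      ∀ N : ℕ, σ₁ - ∑ j ∈ Finset.range N, termOne σ j ∈ BS n (m + (δ - ρ) * N) ρ δ := by
  rw [mem_BS_iff] at hσ
  have hδ1 : δ < 1 := hδρ.trans_le hρ
  have hexp : ∀ N : ℕ, symbolLim (reflectOne σ) - ∑ j ∈ Finset.range N, termOne σ j ∈
      BS n (m + (δ - ρ) * N) ρ δ := by
    intro N
    simp_rw [termOne_eq (hσ.smooth ())]
    exact mem_BS_iff.2 (bsFamily_symbolLim_sub hδ hδ1 hδρ.le hρ (bsFamily_reflectOne hσ) N)
  have hmem : symbolLim (reflectOne σ) ∈ BS n m ρ δ := by simpa using hexp 0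
  have htr := isTransposeOne_symbolLim hδ hδ1 hδρ.le hρ hσ
  refine ⟨_, hmem, htr, fun m' τ hτ h => ?_, hexp⟩
  -- Any two first transposes have the same pairings, both being equal to a pairing of T_σ with f
  -- and the test function exchanged.
  exact eq_of_integral_opT_mul_eq (mem_BS_iff.1 hmem) (mem_BS_iff.1 hτ) fun f g k =>
    (h k g f).symm.trans (htr k g f)

theorem isAsymptoticTo_of_forall (hδρ : δ < ρ) {σ : Symb n} {s : ℕ → Symb n}
    (h : ∀ N : ℕ, σ - ∑ j ∈ Finset.range N, s j ∈ BS n (m + (δ - ρ) * N) ρ δ) :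
    IsAsymptoticTo ρ δ σ s := by
  refine ⟨fun N => m + (δ - ρ) * N, fun a b hab => ?_, ?_, fun N _ => h N⟩
  · have : (a : ℝ) ≤ b := by exact_mod_cast hab
    nlinarith
  · exact tendsto_atBot_add_const_left _ _
      (tendsto_natCast_atTop_atTop.const_mul_atTop_of_neg (sub_neg.2 hδρ))

/-- The second transpose, its uniqueness and its asymptotic expansion. -/
theorem exists_transposeTwo (hδ : 0 ≤ δ) (hδρ : δ < ρ) (hρ : ρ ≤ 1) {σ : Symb n}
    (hσ : σ ∈ BS n m ρ δ) :
    ∃ σ₂ ∈ BS n m ρ δ, IsTransposeTwo (opT σ) (opT σ₂) ∧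
      (∀ m' : ℝ, ∀ τ ∈ BS n m' ρ δ, IsTransposeTwo (opT σ) (opT τ) → τ = σ₂) ∧
      ∀ N : ℕ, σ₂ - ∑ j ∈ Finset.range N, termTwo σ j ∈ BS n (m + (δ - ρ) * N) ρ δ := by
  obtain ⟨σ₁, hmem, htr, huniq, hexp⟩ := exists_transposeOne hδ hδρ hρ (comp_swapMap_mem_BS hσ)
  have hσ' := mem_BS_iff.1 hσ
  have hmem' := comp_swapMap_mem_BS hmem
  refine ⟨σ₁ ∘ swapMap, hmem', ?_, fun m' τ hτ h => ?_, fun N => ?_⟩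
  · rwa [isTransposeTwo_iff hσ' (mem_BS_iff.1 hmem'), comp_swapMap_comp_swapMap]
  · rw [isTransposeTwo_iff hσ' (mem_BS_iff.1 hτ)] at h
    rw [← huniq m' _ (comp_swapMap_mem_BS hτ) h, comp_swapMap_comp_swapMap]
  · have := comp_swapMap_mem_BS (hexp N)
    have e : (σ₁ - ∑ j ∈ Finset.range N, termOne (σ ∘ swapMap) j) ∘ swapMap =
        σ₁ ∘ swapMap - ∑ j ∈ Finset.range N, termTwo σ j := by
      ext p
      simp [termTwo_eq (hσ'.smooth ())]
    rwa [e] at this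

end Transposes

end BilinearHormander

end

theorem theorem2 (n : ℕ) (m ρ δ : ℝ) (hδ : 0 ≤ δ) (hδρ : δ < ρ) (hρ : ρ ≤ 1)
    (σ : BilinearHormander.Symb n) (hσ : σ ∈ BilinearHormander.BS n m ρ δ) :
    (∃ σ₁ : BilinearHormander.Symb n,
      σ₁ ∈ BilinearHormander.BS n m ρ δ ∧
      BilinearHormander.IsTransposeOne
        (BilinearHormander.opT σ) (BilinearHormander.opT σ₁) ∧
      (∀ (m' : ℝ), ∀ τ ∈ BilinearHormander.BS n m' ρ δ,
        BilinearHormander.IsTransposeOne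
          (BilinearHormander.opT σ) (BilinearHormander.opT τ) → τ = σ₁) ∧
      BilinearHormander.IsAsymptoticTo ρ δ σ₁ (BilinearHormander.termOne σ) ∧
      ∀ N : ℕ, (σ₁ - ∑ j ∈ Finset.range N, BilinearHormander.termOne σ j) ∈
        BilinearHormander.BS n (m + (δ - ρ) * (N : ℝ)) ρ δ) ∧
    (∃ σ₂ : BilinearHormander.Symb n,
      σ₂ ∈ BilinearHormander.BS n m ρ δ ∧
      BilinearHormander.IsTransposeTwo
        (BilinearHormander.opT σ) (BilinearHormander.opT σ₂) ∧
      (∀ (m' : ℝ), ∀ τ ∈ BilinearHormander.BS n m' ρ δ,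
        BilinearHormander.IsTransposeTwo
          (BilinearHormander.opT σ) (BilinearHormander.opT τ) → τ = σ₂) ∧
      BilinearHormander.IsAsymptoticTo ρ δ σ₂ (BilinearHormander.termTwo σ) ∧
      ∀ N : ℕ, (σ₂ - ∑ j ∈ Finset.range N, BilinearHormander.termTwo σ j) ∈
        BilinearHormander.BS n (m + (δ - ρ) * (N : ℝ)) ρ δ) := by
  obtain ⟨σ₁, h1, h2, h3, h4⟩ := BilinearHormander.exists_transposeOne hδ hδρ hρ hσ
  obtain ⟨σ₂, k1, k2, k3, k4⟩ := BilinearHormander.exists_transposeTwo hδ hδρ hρ hσ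
  exact ⟨⟨σ₁, h1, h2, h3, BilinearHormander.isAsymptoticTo_of_forall hδρ h4, h4⟩,
    ⟨σ₂, k1, k2, k3, BilinearHormander.isAsymptoticTo_of_forall hδρ k4, k4⟩⟩
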